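/- **Conventions.** $\mathcal L$ is a possibly multi-sorted first-order language extending the language of fields $\{0,1,+,-,\cdot,{}^{-1}\}$ (with $0^{-1}=0$) on a distinguished field sort, whose restriction to the field sort is a relational extension of the language of fields together with a set $\Omega$ of constants. An *$\mathcal L$-theory of topological fields* is the complete theory $T=\mathrm{Th}(K_0)$ of an $\mathcal L$-structure $K_0$ whose field sort is a field of characteristic $0$, together with an $\mathcal L$-formula $\chi(x,z)$ ($x$ one field variable, $z$ a tuple of variables of any sorts) such that the sets $\chi(K_0,a)$ form a basis of neighbourhoods of $0$ for a non-discrete Hausdorff field topology on $K_0$. For a model $K$ of $T$, $(K,\delta)$ is a model of $T_\delta$ if $\delta$ is a derivation on the field $K$ with $\delta(c)=0$ for all $c\in\Omega$. For a differential polynomial $P\in K\{x\}$ in one variable of order $m$, let $P^*\in K[y_0,\dots,y_m]$ be the ordinary polynomial with $P(x)=P^*(x,\delta x,\dots,\delta^m x)$ and let $s_P=\partial P/\partial(\delta^m x)$. A model $(K,\delta)$ of $T_\delta$ is a *model of $T_\delta^*$* if for every $m\ge 1$, every $P\in K\{x\}$ of order $m$, every tuple $c$ of the sorts of $z$, and every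 $y\in K^{m+1}$ with $P^*(y)=0$ and $s_P^*(y)\neq0$, there is $b\in K$ with $P(b)=0$, $s_P(b)\ne0$ and $K\models\chi(\delta^i(b)-y_i,c)$ for $i=0,\dots,m$. The theory $T_\delta^*$ is *consistent* if it has a model. We say that $(T,\chi)$ *has generic extensions* if for every model $(K,\delta)$ of $T_\delta$ there are an $\mathcal L$-elementary extension $L$ of $K$ and an extension of $\delta$ to a derivation on $L$ making $L$ a model of $T_\delta^*$. **Theorem.** 1. Let $T$ be an $\mathcal L$-theory of topological fields with formula $\chi$. Assume that every model $K$ of $T$ has an $\mathcal L$-elementary extension $F$ with a henselian valuation $v$ such that the topology defined by $\chi$ on $F$ is the valuation topology of $v$. Then $(T,\chi)$ has generic extensions, and $T_\delta^*$ is consistent. 2. Let $\mathcal L$ contain a binary relation symbol $\mathrm{div}$ on the field sort and let $T$ be an $\mathcal L$-theory of topological fields whose formula $\chi(x,z)$ is "$z\neq 0\to v(x)>v(z)$", i.e. $z\ne0\to\neg\,\mathrm{div}(x,z)$. Assume that in every model $K$ of $T$ the symbol $\mathrm{div}(x,y)$ is interpreted as $v(x)\le v(y)$ for some henselian valuation $v$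 on $K$. Then $(T,\chi)$ has generic extensions, and $T_\delta^*$ is consistent. 3. In each of the following cases there is an $\mathcal L$-formula defining the indicated topology on $K_0$, and for every such formula $\chi$, $T=\mathrm{Th}(K_0)$ is an $\mathcal L$-theory of topological fields with formula $\chi$, $(T,\chi)$ has generic extensions, and $T_\delta^*$ is consistent: * (a) $K_0$ is a real closed field in the language of ordered fields, with the order topology; * (b) $K_0$ is an algebraically closed, non-trivially valued field of characteristic $0$ in the language of fields with $\mathrm{div}(x,y)\Leftrightarrow v(x)\le v(y)$, with the valuation topology; * (c) $K_0$ is a real closed field with a non-trivial valuation whose valuation ring is convex, in the language of ordered fields with $\mathrm{div}$, with the valuation topology, which coincides with the order topology; * (d) $p$ is a prime and $K_0$ is a $p$-adically closed field of $p$-rank $d$ (that is, a valued field of characteristic $0$ with valuation ring $\mathcal O$ and residue characteristic $p$ such that $\dim_{\mathbb F_p}\mathcal O/p\mathcal O=d$, without proper algebraic valued extensions of the same kind, with the same $p$ and $d$), in the language of fields with $\mathrm{div}$, constants $c_1,\dots,c_d$ for elements of $\mathcal O$ whose residues form an $\mathbb F_p$-basis of $\mathcal O/p\mathcal O$, and predicates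 $P_n$ for the set of $n$-th powers ($n\ge1$), with the valuation topology; * (e) $K_0$ is a henselian, non-trivially valued field of characteristic $0$ in the multi-sorted language of leading terms, with the valuation topology. Here, if $p\ge 0$ is the residue characteristic and $\mathfrak m$ is the maximal ideal of the valuation ring, the auxiliary sorts are $RV_n=K_0^\times/(1+p^n\mathfrak m)\cup\{0\}$ for $n\in\mathbb N$ if $p>0$, and only $RV_0=K_0^\times/(1+\mathfrak m)\cup\{0\}$ if $p=0$; there are symbols for the maps $K_0\to RV_n$, the natural maps $RV_n\to RV_m$ for $m\le n$, and, on each $RV_n$, for $0$, $1$, multiplication, the partial addition (the image of the graph of $+$) and the relation $v(x)\le v(y)$. -/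

import Mathlib

open Topology

universe u w

namespace GenericDerivation

/-! ### Multi-sorted first-order logic over expansions of fields -/

/-- The sorts: one field sort, and the auxiliary sorts. -/
inductive Srt (Aux : Type u) : Type u
  | field : Srt Aux
  | aux (a : Aux) : Srt Aux

/-- A multi-sorted language extending the language of fields `0, 1, +, -, ·, ⁻¹` (these symbols
are built into the terms below) whose restriction to the field sort is a relational extension of
the language of fields together with a set `Const` of additional constants.  All other function
symbols (`Fn σ s`, with argument sorts `σ` and value sort `s`) involve some auxiliary sort. -/
structure FieldLanguage : Type (u + 1) where
  Aux : Type u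
  Const : Type u
  Fn : List (Srt Aux) → Srt Aux → Type u
  Rel : List (Srt Aux) → Type u
  fn_mixed : ∀ σ : List (Srt Aux), (∀ s ∈ σ, s = Srt.field) → IsEmpty (Fn σ Srt.field)

/-- A structure for such a language whose field sort is a field and in which the built-in
symbols have their usual meaning (with `0⁻¹ = 0`). -/
structure FieldStructure (L : FieldLanguage.{u}) : Type (max u (w + 1)) where
  carrier : Srt L.Aux → Type w
  [fieldInst : Field (carrier Srt.field)]
  const : L.Const → carrier Srt.field
  fn : ∀ {σ : List (Srt L.Aux)} {s : Srt L.Aux}, L.Fn σ s →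
    (∀ i : Fin σ.length, carrier (σ.get i)) → carrier s
  rel : ∀ {σ : List (Srt L.Aux)}, L.Rel σ → (∀ i : Fin σ.length, carrier (σ.get i)) → Prop

attribute [instance] FieldStructure.fieldInst

/-- The field sort of a structure. -/
abbrev FieldStructure.K {L : FieldLanguage.{u}} (M : FieldStructure.{u, w} L) : Type w :=
  M.carrier Srt.field

/-- Tuples of elements of `M` of the sorts listed in `Γ`. -/
abbrev Tuple {L : FieldLanguage.{u}} (M : FieldStructure.{u, w} L) (Γ : List (Srt L.Aux)) :
    Type w :=
  ∀ i : Fin Γ.length, M.carrier (Γ.get i)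

/-- The empty tuple. -/
def Tuple.nil {L : FieldLanguage.{u}} (M : FieldStructure.{u, w} L) : Tuple M [] :=
  fun i => i.elim0

/-- Put an element in front of a tuple. -/
def Tuple.cons {L : FieldLanguage.{u}} {M : FieldStructure.{u, w} L} {s : Srt L.Aux}
    {Γ : List (Srt L.Aux)} (a : M.carrier s) (v : Tuple M Γ) : Tuple M (s :: Γ) :=
  Fin.cons (α := fun i : Fin (Γ.length + 1) => M.carrier ((s :: Γ).get i)) a v

/-- Terms with variables from the context `Γ` (the list of the sorts of the variables). -/
inductive Term (L : FieldLanguage.{u}) (Γ : List (Srt L.Aux)) : Srt L.Aux → Type u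
  | var (i : Fin Γ.length) : Term L Γ (Γ.get i)
  | zero : Term L Γ Srt.field
  | one : Term L Γ Srt.field
  | add (t₁ t₂ : Term L Γ Srt.field) : Term L Γ Srt.field
  | neg (t : Term L Γ Srt.field) : Term L Γ Srt.field
  | mul (t₁ t₂ : Term L Γ Srt.field) : Term L Γ Srt.field
  | inv (t : Term L Γ Srt.field) : Term L Γ Srt.field
  | const (c : L.Const) : Term L Γ Srt.field
  | app {σ : List (Srt L.Aux)} {s : Srt L.Aux} (f : L.Fn σ s)
      (ts : ∀ i : Fin σ.length, Term L Γ (σ.get i)) : Term L Γ s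

/-- First-order formulas whose free variables are in the context `Γ`.  In `all φ` the quantified
variable is the first variable of `φ`. -/
inductive Formula (L : FieldLanguage.{u}) : List (Srt L.Aux) → Type u
  | falsum {Γ : List (Srt L.Aux)} : Formula L Γ
  | eq {Γ : List (Srt L.Aux)} {s : Srt L.Aux} (t₁ t₂ : Term L Γ s) : Formula L Γ
  | rel {Γ σ : List (Srt L.Aux)} (R : L.Rel σ)
      (ts : ∀ i : Fin σ.length, Term L Γ (σ.get i)) : Formula L Γ
  | imp {Γ : List (Srt L.Aux)} (φ ψ : Formula L Γ) : Formula L Γ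
  | all {Γ : List (Srt L.Aux)} {s : Srt L.Aux} (φ : Formula L (s :: Γ)) : Formula L Γ

/-- Negation. -/
def Formula.not {L : FieldLanguage.{u}} {Γ : List (Srt L.Aux)} (φ : Formula L Γ) : Formula L Γ :=
  Formula.imp φ Formula.falsum

/-- The value of a term. -/
def Term.eval {L : FieldLanguage.{u}} {Γ : List (Srt L.Aux)} (M : FieldStructure.{u, w} L)
    (v : Tuple M Γ) : ∀ {s : Srt L.Aux}, Term L Γ s → M.carrier s
  | _, .var i => v i
  | _, .zero => (0 : M.K)
  | _, .one => (1 : M.K)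
  | _, .add t₁ t₂ => (t₁.eval M v + t₂.eval M v : M.K)
  | _, .neg t => (-(t.eval M v) : M.K)
  | _, .mul t₁ t₂ => (t₁.eval M v * t₂.eval M v : M.K)
  | _, .inv t => ((t.eval M v)⁻¹ : M.K)
  | _, .const c => M.const c
  | _, .app f ts => M.fn f (fun i => (ts i).eval M v)

/-- Satisfaction of a formula at a tuple. -/
def Formula.Realize {L : FieldLanguage.{u}} (M : FieldStructure.{u, w} L) :
    ∀ {Γ : List (Srt L.Aux)}, Formula L Γ → Tuple M Γ → Prop
  | _, .falsum, _ => False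
  | _, .eq t₁ t₂, v => t₁.eval M v = t₂.eval M v
  | _, .rel R ts, v => M.rel R (fun i => (ts i).eval M v)
  | _, .imp φ ψ, v => φ.Realize M v → ψ.Realize M v
  | _, .all (s := s) φ, v => ∀ a : M.carrier s, φ.Realize M (Tuple.cons a v)

/-- Theories: sets of sentences. -/
abbrev Theory (L : FieldLanguage.{u}) : Type u := Set (Formula L [])

/-- `M` is a model of `T`. -/
def IsModel {L : FieldLanguage.{u}} (T : Theory L) (M : FieldStructure.{u, w} L) : Prop :=
  ∀ φ ∈ T, φ.Realize M (Tuple.nil M)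

/-- The complete theory of a structure. -/
def Th {L : FieldLanguage.{u}} (M : FieldStructure.{u, w} L) : Theory L :=
  {φ | φ.Realize M (Tuple.nil M)}

/-- Elementary embeddings; `N` together with an elementary embedding `M → N` is an elementary
extension of `M`. -/
structure ElementaryEmbedding {L : FieldLanguage.{u}} (M N : FieldStructure.{u, w} L) where
  toFun : ∀ s : Srt L.Aux, M.carrier s → N.carrier s
  realize_iff : ∀ {Γ : List (Srt L.Aux)} (φ : Formula L Γ) (v : Tuple M Γ),
    φ.Realize N (fun i => toFun _ (v i)) ↔ φ.Realize M v

/-! ### Theories of topological fields -/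

/-- The sets `χ(M, a)`, where `a` runs over the tuples of the sorts `Γ`, form a basis of
neighbourhoods of `0` for the topology `τ`. -/
def DefinesTopology {L : FieldLanguage.{u}} {Γ : List (Srt L.Aux)}
    (χ : Formula L (Srt.field :: Γ)) (M : FieldStructure.{u, w} L)
    (τ : TopologicalSpace M.K) : Prop :=
  (@nhds M.K τ 0).HasBasis (fun _ : Tuple M Γ => True)
    (fun a => {x : M.K | χ.Realize M (Tuple.cons x a)})

/-- `T` is an `L`-theory of topological fields and `χ` defines its topology: `T` is the complete
theory of an `L`-structure on a field of characteristic `0` in which `χ` provides a basis of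
neighbourhoods of `0` for a non-discrete Hausdorff field topology. -/
def IsTopologicalFieldTheory {L : FieldLanguage.{u}} {Γ : List (Srt L.Aux)} (T : Theory L)
    (χ : Formula L (Srt.field :: Γ)) : Prop :=
  ∃ (M : FieldStructure.{u, w} L) (τ : TopologicalSpace M.K),
    CharZero M.K ∧ T = Th M ∧ @IsTopologicalDivisionRing M.K _ τ ∧ @T2Space M.K τ ∧
      ¬ @DiscreteTopology M.K τ ∧ DefinesTopology χ M τ

/-- The valuation topology of (the valuation attached to) a valuation ring. -/
@[reducible] noncomputable def valuationTopology {K : Type w} [Field K] (A : ValuationSubring K) : TopologicalSpace K :=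
  (Valued.mk' A.valuation).toTopologicalSpace

/-! ### Differential polynomials in one variable and the theory `T_δ^*` -/

/-- Differential polynomials in one differential indeterminate `x`: the variable `j` stands
for `δ^j x`. -/
abbrev DiffPoly (K : Type w) [Field K] : Type w := MvPolynomial ℕ K

/-- The order: the largest `j` such that `δ^j x` occurs in `P`, or `⊥` if there is none. -/
noncomputable def DiffPoly.ord {K : Type w} [Field K] (P : DiffPoly K) : WithBot ℕ :=
  P.vars.max

/-- The value of a differential polynomial at `b`. -/
noncomputable def DiffPoly.evalAt {K : Type w} [Field K] (δ : Derivation ℤ K K) (b : K)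
    (P : DiffPoly K) : K :=
  MvPolynomial.eval (fun j => δ^[j] b) P

/-- The separant of a differential polynomial of order `m`. -/
noncomputable def DiffPoly.separant {K : Type w} [Field K] (m : ℕ) (P : DiffPoly K) :
    DiffPoly K :=
  MvPolynomial.pderiv m P

/-- The ordinary polynomial in `y_0, …, y_m` of a differential polynomial of order at
most `m`. -/
noncomputable def DiffPoly.star {K : Type w} [Field K] (m : ℕ) (P : DiffPoly K) :
    MvPolynomial (Fin (m + 1)) K :=
  MvPolynomial.killCompl (Fin.val_injective (n := m + 1)) P

/-- The scheme (DL): for every differential polynomial `P` of order `m ≥ 1`, near every regular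
zero `y` of the ordinary polynomial of `P` there is a tuple `(x, δ x, …, δ^m x)` for which `x` is
a regular zero of `P`. -/
def SatisfiesDL {L : FieldLanguage.{u}} {Γ : List (Srt L.Aux)} (χ : Formula L (Srt.field :: Γ))
    (M : FieldStructure.{u, w} L) (δ : Derivation ℤ M.K M.K) : Prop :=
  ∀ (m : ℕ) (P : DiffPoly M.K), 1 ≤ m → P.ord = (m : WithBot ℕ) →
    ∀ (z : Tuple M Γ) (y : Fin (m + 1) → M.K),
      MvPolynomial.eval y (P.star m) = 0 →
      MvPolynomial.eval y ((P.separant m).star m) ≠ 0 →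
      ∃ x : M.K, P.evalAt δ x = 0 ∧ (P.separant m).evalAt δ x ≠ 0 ∧
        ∀ i : Fin (m + 1), χ.Realize M (Tuple.cons (s := Srt.field) (δ^[i] x - y i) z)

/-- `(M, δ)` is a model of `T_δ`: `M` is a model of `T`, and the derivation `δ` of the field sort
vanishes at the additional constants of the field sort. -/
def IsModelTDelta {L : FieldLanguage.{u}} (T : Theory L) (M : FieldStructure.{u, w} L)
    (δ : Derivation ℤ M.K M.K) : Prop :=
  IsModel T M ∧ ∀ c : L.Const, δ (M.const c) = 0

/-- `(M, δ)` is a model of `T_δ^*`. -/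
def IsModelTDeltaStar {L : FieldLanguage.{u}} {Γ : List (Srt L.Aux)} (T : Theory L)
    (χ : Formula L (Srt.field :: Γ)) (M : FieldStructure.{u, w} L)
    (δ : Derivation ℤ M.K M.K) : Prop :=
  IsModelTDelta T M δ ∧ SatisfiesDL χ M δ

/-- Every model `(M, δ)` of `T_δ` has an extension `(N, δ')` that is a model of `T_δ^*` and for
which `N` is an `L`-elementary extension of `M`. -/
def HasGenericExtensions {L : FieldLanguage.{u}} {Γ : List (Srt L.Aux)} (T : Theory L)
    (χ : Formula L (Srt.field :: Γ)) : Prop :=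
  ∀ (M : FieldStructure.{u, w} L) (δ : Derivation ℤ M.K M.K), IsModelTDelta T M δ →
    ∃ (N : FieldStructure.{u, w} L) (δ' : Derivation ℤ N.K N.K) (e : ElementaryEmbedding M N),
      (∀ x : M.K, e.toFun Srt.field (δ x) = δ' (e.toFun Srt.field x)) ∧
        IsModelTDeltaStar T χ N δ'

/-- The theory `T_δ^*` is consistent, i.e. it has a model. -/
def IsConsistentTDeltaStar {L : FieldLanguage.{u}} {Γ : List (Srt L.Aux)} (T : Theory L)
    (χ : Formula L (Srt.field :: Γ)) : Prop :=
  ∃ (N : FieldStructure.{u, w} L) (δ : Derivation ℤ N.K N.K), IsModelTDeltaStar T χ N δ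

/-- For a binary relation symbol `div` of the field sort, read as `v(x) ≤ v(y)`, the formula
`z ≠ 0 → v(x) > v(z)` in the variables `x, z`. -/
def valuationFormula {L : FieldLanguage.{u}} (div : L.Rel [Srt.field, Srt.field]) :
    Formula L [Srt.field, Srt.field] :=
  Formula.imp
    (Formula.not (Formula.eq (s := Srt.field)
      (Term.var (Γ := [Srt.field, Srt.field]) (1 : Fin 2)) Term.zero))
    (Formula.not (Formula.rel div fun i => Term.var (Γ := [Srt.field, Srt.field]) i))

/-- The interpretation of `div` is `v(x) ≤ v(y)` for the (additively written) valuation of `A`. -/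
def IsDivOf {L : FieldLanguage.{u}} (div : L.Rel [Srt.field, Srt.field])
    (M : FieldStructure.{u, w} L) (A : ValuationSubring M.K) : Prop :=
  ∀ x y : M.K, M.rel div (Tuple.cons (s := Srt.field) x (Tuple.cons (s := Srt.field) y
    (Tuple.nil M))) ↔ A.valuation y ≤ A.valuation x

/-! ### One-sorted examples -/

/-- No auxiliary sorts: the underlying sorts of a one-sorted structure. -/
def oneSorted (K : Type w) : Srt Empty → Type w
  | .field => K
  | .aux a => a.elim

/-- The one-sorted language of fields with additional constants `C` and with relation symbols `R`
of the given arities. -/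
def oneSortedLanguage (C : Type) (R : List (Srt Empty) → Type) : FieldLanguage.{0} where
  Aux := Empty
  Const := C
  Fn := fun _ _ => Empty
  Rel := R
  fn_mixed := fun _ _ => inferInstance

/-- A field with named constants and relations as a structure. -/
def oneSortedStructure {C : Type} {R : List (Srt Empty) → Type} (K : Type w) [Field K]
    (c : C → K)
    (r : ∀ {σ : List (Srt Empty)}, R σ → (∀ i : Fin σ.length, oneSorted K (σ.get i)) → Prop) :
    FieldStructure.{0, w} (oneSortedLanguage C R) where
  carrier := oneSorted K
  fieldInst := inferInstanceAs (Field K)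
  const := c
  fn := fun f => Empty.elim f
  rel := r

/-- The additional symbol `<`. -/
inductive OrderRel : List (Srt Empty) → Type
  | lt : OrderRel [Srt.field, Srt.field]

/-- The additional symbol `div`. -/
inductive DivRel : List (Srt Empty) → Type
  | div : DivRel [Srt.field, Srt.field]

/-- The additional symbols `<` and `div`. -/
inductive OrderDivRel : List (Srt Empty) → Type
  | lt : OrderDivRel [Srt.field, Srt.field]
  | div : OrderDivRel [Srt.field, Srt.field]

/-- The additional symbols `div` and `P_n` for `n ≥ 1`. -/
inductive PAdicRel : List (Srt Empty) → Type
  | div : PAdicRel [Srt.field, Srt.field]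
  | pow (n : ℕ+) : PAdicRel [Srt.field]

/-- An ordered field as a structure in the language of ordered fields. -/
def orderedFieldStructure (K : Type w) [Field K] [LinearOrder K] :
    FieldStructure.{0, w} (oneSortedLanguage Empty OrderRel) :=
  oneSortedStructure K Empty.elim fun {_} R a =>
    match R, a with
    | .lt, a => (show K from a (0 : Fin 2)) < (show K from a (1 : Fin 2))

/-- A valued field as a structure in the language of valued fields. -/
def valuedFieldStructure (K : Type w) [Field K] (A : ValuationSubring K) :
    FieldStructure.{0, w} (oneSortedLanguage Empty DivRel) :=
  oneSortedStructure K Empty.elim fun {_} R a =>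
    match R, a with
    | .div, a => A.valuation (show K from a (1 : Fin 2)) ≤ A.valuation (show K from a (0 : Fin 2))

/-- An ordered valued field as a structure in the language of ordered valued fields. -/
def orderedValuedFieldStructure (K : Type w) [Field K] [LinearOrder K] (A : ValuationSubring K) :
    FieldStructure.{0, w} (oneSortedLanguage Empty OrderDivRel) :=
  oneSortedStructure K Empty.elim fun {_} R a =>
    match R, a with
    | .lt, a => (show K from a (0 : Fin 2)) < (show K from a (1 : Fin 2))
    | .div, a => A.valuation (show K from a (1 : Fin 2)) ≤ A.valuation (show K from a (0 : Fin 2))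

/-- A valued field with named elements `c_1, …, c_d` as a structure in the language with `div`,
these constants, and predicates for the sets of `n`-th powers. -/
def pAdicFieldStructure (K : Type w) [Field K] (A : ValuationSubring K) {d : ℕ} (c : Fin d → A) :
    FieldStructure.{0, w} (oneSortedLanguage (Fin d) PAdicRel) :=
  oneSortedStructure K (fun i => (c i : K)) fun {_} R a =>
    match R, a with
    | .div, a => A.valuation (show K from a (1 : Fin 2)) ≤ A.valuation (show K from a (0 : Fin 2))
    | .pow n, a => ∃ b : K, b ^ (n : ℕ) = (show K from a (0 : Fin 1))

/-- The residues of `c_1, …, c_d` form a basis of `A / pA` over the field with `p` elements: every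
element of `A / pA` is in a unique way a combination of them with coefficients `0, …, p - 1`. -/
def IsResidueBasis (p : ℕ) {K : Type w} [Field K] (A : ValuationSubring K) {d : ℕ}
    (c : Fin d → A) : Prop :=
  Function.Bijective fun n : Fin d → Fin p =>
    Ideal.Quotient.mk (Ideal.span {(p : A)}) (∑ i, (n i : ℕ) • c i)

/-- `A` makes `K` a `p`-valued field of `p`-rank `d`: `K` has characteristic `0`, the residue field
has characteristic `p`, and `A / pA` has dimension `d` over the field with `p` elements. -/
def IsPValued (p d : ℕ) (K : Type w) [Field K] (A : ValuationSubring K) : Prop :=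
  CharZero K ∧ ¬ IsUnit (p : A) ∧ ∃ c : Fin d → A, IsResidueBasis p A c

/-- A `p`-adically closed field of `p`-rank `d`: a `p`-valued field of `p`-rank `d` without proper
algebraic extensions that are `p`-valued fields of the same `p`-rank. -/
def IsPAdicallyClosed (p d : ℕ) (K : Type w) [Field K] (A : ValuationSubring K) : Prop :=
  IsPValued p d K A ∧
    ∀ (E : Type w) [Field E] [Algebra K E] [Algebra.IsAlgebraic K E] (B : ValuationSubring E),
      B.comap (algebraMap K E) = A → IsPValued p d E B → Function.Surjective (algebraMap K E)

/-! ### Valued fields with their leading term sorts -/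

/-- The characteristic of the residue field. -/
noncomputable def residueChar {K : Type w} [Field K] (A : ValuationSubring K) : ℕ :=
  ringChar (IsLocalRing.ResidueField A)

/-- The leading term sorts are indexed by the natural numbers in residue characteristic `p > 0`,
and there is only the one of index `0` in residue characteristic `0`. -/
abbrev RVIndex (p : ℕ) : Type := {n : ℕ // p = 0 → n = 0}

theorem rv_radius_pos {K : Type w} [Field K] [CharZero K] (A : ValuationSubring K)
    (n : RVIndex (residueChar A)) :
    0 < A.valuation (((residueChar A : ℕ) : K) ^ (n : ℕ)) := by
  rw [zero_lt_iff, ne_eq, Valuation.zero_iff]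
  intro h
  have h1 := eq_zero_of_pow_eq_zero h
  have h2 : residueChar A = 0 := by exact_mod_cast h1
  rw [n.2 h2, pow_zero] at h
  exact one_ne_zero h

theorem rv_radius_antitone {K : Type w} [Field K] (A : ValuationSubring K) {m n : ℕ}
    (h : m ≤ n) :
    A.valuation (((residueChar A : ℕ) : K) ^ n) ≤ A.valuation (((residueChar A : ℕ) : K) ^ m) := by
  rw [map_pow, map_pow]
  refine pow_le_pow_right_of_le_one' ?_ h
  rw [ValuationSubring.valuation_le_one_iff]
  exact natCast_mem A _

theorem rv_valuation_eq_one {K : Type w} [Field K] (A : ValuationSubring K)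
    (n : ℕ) (x : K)
    (h : A.valuation (x - 1) < A.valuation (((residueChar A : ℕ) : K) ^ n)) :
    A.valuation x = 1 := by
  have h1 : A.valuation (x - 1) < 1 := by
    refine lt_of_lt_of_le h ?_
    simpa using rv_radius_antitone A (Nat.zero_le n)
  have h2 := Valuation.map_one_add_of_lt (v := A.valuation) h1
  simpa using h2

/-- The units `x` with `v(x - 1) > v(p^n)`, where `p` is the residue characteristic. -/
def rvSubgroup {K : Type w} [Field K] [CharZero K] (A : ValuationSubring K)
    (n : RVIndex (residueChar A)) : Subgroup Kˣ where
  carrier := {x | A.valuation ((x : K) - 1) < A.valuation (((residueChar A : ℕ) : K) ^ (n : ℕ))}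
  one_mem' := by
    simpa using rv_radius_pos A n
  mul_mem' := by
    intro x y hx hy
    have hx1 := rv_valuation_eq_one A n _ hx
    have e : ((x * y : Kˣ) : K) - 1 = (x : K) * ((y : K) - 1) + ((x : K) - 1) := by
      push_cast; ring
    change A.valuation (((x * y : Kˣ) : K) - 1) < _
    rw [e]
    refine Valuation.map_add_lt _ ?_ hx
    rw [map_mul, hx1, one_mul]
    exact hy
  inv_mem' := by
    intro x hx
    have hx1 := rv_valuation_eq_one A n _ hx
    have e : ((x⁻¹ : Kˣ) : K) - 1 = -((x : K)⁻¹ * ((x : K) - 1)) := by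
      have := x.ne_zero
      push_cast; field_simp; ring
    change A.valuation (((x⁻¹ : Kˣ) : K) - 1) < _
    rw [e, Valuation.map_neg, map_mul, map_inv₀, hx1, inv_one, one_mul]
    exact hx

theorem rvSubgroup_antitone {K : Type w} [Field K] [CharZero K] (A : ValuationSubring K)
    {m n : RVIndex (residueChar A)} (h : (m : ℕ) ≤ n) : rvSubgroup A n ≤ rvSubgroup A m :=
  fun _ hx => lt_of_lt_of_le hx (rv_radius_antitone A h)

/-- The leading term sort `RV_n`: the quotient of the multiplicative group by the subgroup above,
together with `0`. -/
abbrev RV {K : Type w} [Field K] [CharZero K] (A : ValuationSubring K)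
    (n : RVIndex (residueChar A)) : Type w :=
  WithZero (Kˣ ⧸ rvSubgroup A n)

open Classical in
/-- The leading term map `rv_n`. -/
noncomputable def rvMap {K : Type w} [Field K] [CharZero K] (A : ValuationSubring K)
    (n : RVIndex (residueChar A)) (x : K) : RV A n :=
  if h : x = 0 then 0 else ((QuotientGroup.mk (Units.mk0 x h) : Kˣ ⧸ rvSubgroup A n) : RV A n)

/-- The natural map `RV_n → RV_m` for `m ≤ n`. -/
def rvTransition {K : Type w} [Field K] [CharZero K] (A : ValuationSubring K)
    {m n : RVIndex (residueChar A)} (h : (m : ℕ) ≤ n) (x : RV A n) : RV A m :=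
  WithZero.map' (QuotientGroup.map (rvSubgroup A n) (rvSubgroup A m) (MonoidHom.id Kˣ)
    (fun _ hx => rvSubgroup_antitone A h hx)) x

/-- Function symbols of the language of leading terms: the maps `rv_n`, the natural maps between
the sorts `RV_n`, and `0`, `1` and the multiplication of each sort `RV_n`. -/
inductive RVFn (p : ℕ) : List (Srt (RVIndex p)) → Srt (RVIndex p) → Type
  | rv (n : RVIndex p) : RVFn p [Srt.field] (Srt.aux n)
  | res {m n : RVIndex p} (h : (m : ℕ) ≤ n) : RVFn p [Srt.aux n] (Srt.aux m)
  | zero (n : RVIndex p) : RVFn p [] (Srt.aux n)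
  | one (n : RVIndex p) : RVFn p [] (Srt.aux n)
  | mul (n : RVIndex p) : RVFn p [Srt.aux n, Srt.aux n] (Srt.aux n)

/-- Relation symbols of the language of leading terms: on each sort `RV_n`, the partial addition
and the comparison of valuations. -/
inductive RVRel (p : ℕ) : List (Srt (RVIndex p)) → Type
  | oplus (n : RVIndex p) : RVRel p [Srt.aux n, Srt.aux n, Srt.aux n]
  | div (n : RVIndex p) : RVRel p [Srt.aux n, Srt.aux n]

/-- The multi-sorted language of leading terms for valued fields of residue characteristic `p`. -/
def rvLanguage (p : ℕ) : FieldLanguage.{0} where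
  Aux := RVIndex p
  Const := Empty
  Fn := RVFn p
  Rel := RVRel p
  fn_mixed := fun _ _ => ⟨fun f => nomatch f⟩

/-- The sorts of a valued field in the language of leading terms. -/
def rvSorts (K : Type w) [Field K] [CharZero K] (A : ValuationSubring K) :
    Srt (RVIndex (residueChar A)) → Type w
  | .field => K
  | .aux n => RV A n

/-- A valued field as a structure in the language of leading terms. -/
noncomputable def rvStructure (K : Type w) [Field K] [CharZero K] (A : ValuationSubring K) :
    FieldStructure.{0, w} (rvLanguage (residueChar A)) where
  carrier := rvSorts K A
  fieldInst := inferInstanceAs (Field K)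
  const := Empty.elim
  fn := fun {_ _} f a =>
    match f, a with
    | .rv n, a => (rvMap A n (show K from a (0 : Fin 1)) : RV A n)
    | .res (n := n) h, a => rvTransition A h (show RV A n from a (0 : Fin 1))
    | .zero n, _ => (0 : RV A n)
    | .one n, _ => (1 : RV A n)
    | .mul n, a => (show RV A n from a (0 : Fin 2)) * (show RV A n from a (1 : Fin 2))
  rel := fun {_} R a =>
    match R, a with
    | .oplus n, a => ∃ x y : K, rvMap A n x = (show RV A n from a (0 : Fin 3)) ∧
        rvMap A n y = (show RV A n from a (1 : Fin 3)) ∧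
        rvMap A n (x + y) = (show RV A n from a (2 : Fin 3))
    | .div n, a => ∃ x y : K, rvMap A n x = (show RV A n from a (0 : Fin 2)) ∧
        rvMap A n y = (show RV A n from a (1 : Fin 2)) ∧ A.valuation y ≤ A.valuation x

/-- The claim for an example `M` with topology `τ`, where `T` is the complete theory of `M`: some
formula defines `τ`, and for every such formula `T` is a theory of topological fields with the
two consistency properties. -/
def ExampleClaim {L : FieldLanguage.{u}} (M : FieldStructure.{u, w} L)
    (τ : TopologicalSpace M.K) : Prop :=
  (∃ (Γ : List (Srt L.Aux)) (χ : Formula L (Srt.field :: Γ)), DefinesTopology χ M τ) ∧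
    ∀ (Γ : List (Srt L.Aux)) (χ : Formula L (Srt.field :: Γ)), DefinesTopology χ M τ →
      IsTopologicalFieldTheory.{u, w} (Th M) χ ∧ HasGenericExtensions.{u, w} (Th M) χ ∧
        IsConsistentTDeltaStar.{u, w} (Th M) χ

end GenericDerivation

open GenericDerivation

/-! Everything rests on one first-order property `Tame` of a structure with its formula χ. The sets
χ(M, c) form a separated, non-discrete filter base in characteristic 0. Moreover, if a polynomial
has a zero y at which its last partial derivative does not vanish, then every small increment of the
other coordinates can be completed by a small increment of the last one to another such zero. The
second clause is a scheme with one sentence for each list of exponents, so tameness passes between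
elementarily equivalent structures (`Tame.of_elemEquiv`) and need only be verified in one model of
the complete theory.

Let (M, δ) be tame, and let Q in y_0, ..., y_m have a regular zero y, with m ≥ 1. Choose increments
x_0, ..., x_{m-1} infinitesimal and algebraically independent over M, solve for the last increment
x_m, and require δ'(y_i + x_i) = y_{i+1} + x_{i+1} for i < m. In characteristic 0 a derivation
extends to every field extension with arbitrary values at algebraically independent elements
(`exists_derivation_extension`), so such a δ' exists and b = y_0 + x_0 is the desired zero. A single
ultrapower, indexed by all assignments of increments, treats all Q, y and radii over M
simultaneously (`Tame.exists_step`). Repeating this ω times and taking the union of the elementary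
chain also covers the parameters that appear on the way (`Tame.exists_generic_extension`).
Consistency follows by starting from the zero derivation.

What remains is to verify the implicit function clause for the given topologies. Expansion in the
last increment reduces it to the continuity of simple roots of polynomials in one variable
(`HasStableSimpleRoots.implicit`). For a henselian valuation, a substitution turns the search for a
small root into a monic Hensel problem at 1 (`exists_root_of_henselian`). For a real closed field, a
simple root is a sign change, which persists and yields a root by the intermediate value property;
the latter follows from the bound 2 on the degrees of irreducible polynomials. Valuation rings of
algebraically closed fields are henselian because polynomials split. For a p-adically closed field,
adjoining a root above a simple residue root does not change the valuation ring modulo p, so by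
maximality the root is already present (`henselianLocalRing_of_isPAdicallyClosed`). -/

namespace GenericDerivation

/-! ### Substitution and definability -/

section Definability

variable {L : FieldLanguage.{u}}

/-- Weakening of a term by one variable in front. -/
def Term.weaken {Γ : List (Srt L.Aux)} (r : Srt L.Aux) :
    ∀ {s : Srt L.Aux}, Term L Γ s → Term L (r :: Γ) s
  | _, .var i => Term.var (Γ := r :: Γ) i.succ
  | _, .zero => .zero
  | _, .one => .one
  | _, .add t₁ t₂ => .add (t₁.weaken r) (t₂.weaken r)
  | _, .neg t => .neg (t.weaken r)
  | _, .mul t₁ t₂ => .mul (t₁.weaken r) (t₂.weaken r)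
  | _, .inv t => .inv (t.weaken r)
  | _, .const c => .const c
  | _, .app f ts => .app f (fun i => (ts i).weaken r)

/-- Substitutions of terms in the context `Δ` for the variables of `Γ`. -/
abbrev Subst (L : FieldLanguage.{u}) (Γ Δ : List (Srt L.Aux)) : Type u :=
  ∀ i : Fin Γ.length, Term L Δ (Γ.get i)

/-- The tuple of values of a substitution. -/
def Subst.eval {Γ Δ : List (Srt L.Aux)} (σ : Subst L Γ Δ) (M : FieldStructure.{u, w} L)
    (v : Tuple M Δ) : Tuple M Γ :=
  fun i => (σ i).eval M v

/-- Substitution in terms. -/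
def Term.subst {Γ Δ : List (Srt L.Aux)} (σ : Subst L Γ Δ) :
    ∀ {s : Srt L.Aux}, Term L Γ s → Term L Δ s
  | _, .var i => σ i
  | _, .zero => .zero
  | _, .one => .one
  | _, .add t₁ t₂ => .add (t₁.subst σ) (t₂.subst σ)
  | _, .neg t => .neg (t.subst σ)
  | _, .mul t₁ t₂ => .mul (t₁.subst σ) (t₂.subst σ)
  | _, .inv t => .inv (t.subst σ)
  | _, .const c => .const c
  | _, .app f ts => .app f (fun i => (ts i).subst σ)

/-- Put a term in front of a substitution. -/
def Subst.cons {Γ Δ : List (Srt L.Aux)} {r : Srt L.Aux} (t : Term L Δ r) (σ : Subst L Γ Δ) :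
    Subst L (r :: Γ) Δ :=
  Fin.cons (α := fun i : Fin (Γ.length + 1) => Term L Δ ((r :: Γ).get i)) t σ

/-- Extension of a substitution by a new first variable. -/
def Subst.lift {Γ Δ : List (Srt L.Aux)} (r : Srt L.Aux) (σ : Subst L Γ Δ) :
    Subst L (r :: Γ) (r :: Δ) :=
  Subst.cons
    (Term.var (Γ := r :: Δ) (0 : Fin (Δ.length + 1))) (fun i => (σ i).weaken r)

/-- Substitution in formulas. -/
def Formula.subst : ∀ {Γ Δ : List (Srt L.Aux)}, Formula L Γ → Subst L Γ Δ → Formula L Δ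
  | _, _, .falsum, _ => .falsum
  | _, _, .eq t₁ t₂, σ => .eq (t₁.subst σ) (t₂.subst σ)
  | _, _, .rel R ts, σ => .rel R (fun i => (ts i).subst σ)
  | _, _, .imp φ ψ, σ => .imp (φ.subst σ) (ψ.subst σ)
  | _, _, .all (s := s) φ, σ => .all (φ.subst (σ.lift s))

variable (M : FieldStructure.{u, w} L)

theorem Term.eval_weaken {Γ : List (Srt L.Aux)} {r s : Srt L.Aux} (t : Term L Γ s)
    (a : M.carrier r) (v : Tuple M Γ) : (t.weaken r).eval M (Tuple.cons a v) = t.eval M v := by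
  induction t with
  | var i => rfl
  | zero => rfl
  | one => rfl
  | add t₁ t₂ h₁ h₂ => simp only [weaken, eval, h₁, h₂]
  | neg t h => simp only [weaken, eval, h]
  | mul t₁ t₂ h₁ h₂ => simp only [weaken, eval, h₁, h₂]
  | inv t h => simp only [weaken, eval, h]
  | const c => rfl
  | app f ts h => simp only [weaken, eval, h]

theorem Term.eval_subst {Γ Δ : List (Srt L.Aux)} (σ : Subst L Γ Δ) {s : Srt L.Aux}
    (t : Term L Γ s) (v : Tuple M Δ) : (t.subst σ).eval M v = t.eval M (σ.eval M v) := by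
  induction t with
  | var i => rfl
  | zero => rfl
  | one => rfl
  | add t₁ t₂ h₁ h₂ => simp only [subst, eval, h₁, h₂]
  | neg t h => simp only [subst, eval, h]
  | mul t₁ t₂ h₁ h₂ => simp only [subst, eval, h₁, h₂]
  | inv t h => simp only [subst, eval, h]
  | const c => rfl
  | app f ts h => simp only [subst, eval, h]

theorem Subst.eval_cons {Γ Δ : List (Srt L.Aux)} {r : Srt L.Aux} (t : Term L Δ r)
    (σ : Subst L Γ Δ) (v : Tuple M Δ) :
    (Subst.cons t σ).eval M v = Tuple.cons (t.eval M v) (σ.eval M v) := by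
  funext i
  refine Fin.cases ?_ (fun j => ?_) i <;> rfl

theorem Subst.eval_lift {Γ Δ : List (Srt L.Aux)} (σ : Subst L Γ Δ) {r : Srt L.Aux}
    (a : M.carrier r) (v : Tuple M Δ) :
    (σ.lift r).eval M (Tuple.cons a v) = Tuple.cons a (σ.eval M v) := by
  funext i
  refine Fin.cases ?_ (fun j => ?_) i
  · rfl
  · exact Term.eval_weaken M (σ j) a v

theorem Formula.realize_subst {Γ Δ : List (Srt L.Aux)} (φ : Formula L Γ) (σ : Subst L Γ Δ)
    (v : Tuple M Δ) : (φ.subst σ).Realize M v ↔ φ.Realize M (σ.eval M v) := by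
  induction φ generalizing Δ with
  | falsum => rfl
  | eq t₁ t₂ => simp only [subst, Realize, Term.eval_subst]
  | rel R ts => simp only [subst, Realize, Term.eval_subst]
  | imp φ ψ h₁ h₂ => simp only [subst, Realize, h₁, h₂]
  | all φ h => simp only [subst, Realize, h, Subst.eval_lift]

variable {M}

theorem Tuple.cons_eta {r : Srt L.Aux} {Γ : List (Srt L.Aux)} (v : Tuple M (r :: Γ)) :
    Tuple.cons (v (0 : Fin (Γ.length + 1))) (fun i => v (Fin.succ i)) = v := by
  funext i
  refine Fin.cases ?_ (fun j => ?_) i <;> rfl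

/-- A family of functions that is uniformly the value of a term. -/
def TermDefinable (Δ : List (Srt L.Aux)) {s : Srt L.Aux}
    (f : ∀ M : FieldStructure.{u, w} L, Tuple M Δ → M.carrier s) : Prop :=
  ∃ t : Term L Δ s, ∀ M v, t.eval M v = f M v

/-- A family of predicates that is uniformly defined by a formula. -/
def FormulaDefinable (Δ : List (Srt L.Aux))
    (P : ∀ M : FieldStructure.{u, w} L, Tuple M Δ → Prop) : Prop :=
  ∃ φ : Formula L Δ, ∀ M v, φ.Realize M v ↔ P M v

/-! ### Closure of uniformly definable families under field and logical operations -/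

section

variable {Δ : List (Srt L.Aux)}

theorem TermDefinable.term {s : Srt L.Aux} (t : Term L Δ s) :
    TermDefinable.{u, w} Δ (fun M v => t.eval M v) :=
  ⟨t, fun _ _ => rfl⟩

/-- Carries a variable bound by an outer quantifier below the inner ones. -/
theorem TermDefinable.comp {Δ' : List (Srt L.Aux)} {s : Srt L.Aux}
    {f : ∀ M : FieldStructure.{u, w} L, Tuple M Δ → M.carrier s} (h : TermDefinable Δ f)
    (ρ : Subst L Δ Δ') : TermDefinable Δ' (fun M v => f M (ρ.eval M v)) := by
  obtain ⟨t, ht⟩ := h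
  exact ⟨t.subst ρ, fun M v => by rw [Term.eval_subst, ht]⟩

theorem TermDefinable.zero :
    TermDefinable.{u, w} (s := Srt.field) Δ (fun M _ => (0 : M.K)) :=
  ⟨.zero, fun _ _ => rfl⟩

theorem TermDefinable.one :
    TermDefinable.{u, w} (s := Srt.field) Δ (fun M _ => (1 : M.K)) :=
  ⟨.one, fun _ _ => rfl⟩

theorem TermDefinable.add {f g : ∀ M : FieldStructure.{u, w} L, Tuple M Δ → M.K}
    (hf : TermDefinable (s := Srt.field) Δ f) (hg : TermDefinable (s := Srt.field) Δ g) :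
    TermDefinable (s := Srt.field) Δ (fun M v => f M v + g M v) := by
  obtain ⟨s, hs⟩ := hf
  obtain ⟨t, ht⟩ := hg
  exact ⟨.add s t, fun M v => by simp only [Term.eval, hs, ht]⟩

theorem TermDefinable.mul {f g : ∀ M : FieldStructure.{u, w} L, Tuple M Δ → M.K}
    (hf : TermDefinable (s := Srt.field) Δ f) (hg : TermDefinable (s := Srt.field) Δ g) :
    TermDefinable (s := Srt.field) Δ (fun M v => f M v * g M v) := by
  obtain ⟨s, hs⟩ := hf
  obtain ⟨t, ht⟩ := hg
  exact ⟨.mul s t, fun M v => by simp only [Term.eval, hs, ht]⟩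

theorem TermDefinable.natCast (n : ℕ) :
    TermDefinable.{u, w} (s := Srt.field) Δ (fun M _ => (n : M.K)) := by
  induction n with
  | zero => simpa using TermDefinable.zero (L := L)
  | succ n ih => simpa using ih.add TermDefinable.one

theorem TermDefinable.pow {f : ∀ M : FieldStructure.{u, w} L, Tuple M Δ → M.K}
    (hf : TermDefinable (s := Srt.field) Δ f) (n : ℕ) :
    TermDefinable (s := Srt.field) Δ (fun M v => f M v ^ n) := by
  induction n with
  | zero => simpa using TermDefinable.one (L := L)
  | succ n ih => simpa [pow_succ] using ih.mul hf

theorem TermDefinable.sum {ι : Type*} (S : Finset ι)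
    {f : ι → ∀ M : FieldStructure.{u, w} L, Tuple M Δ → M.K}
    (hf : ∀ i, TermDefinable (s := Srt.field) Δ (f i)) :
    TermDefinable (s := Srt.field) Δ (fun M v => ∑ i ∈ S, f i M v) := by
  classical
  induction S using Finset.induction_on with
  | empty => simpa using TermDefinable.zero (L := L)
  | insert a S ha ih => simpa [Finset.sum_insert ha] using (hf a).add ih

theorem TermDefinable.prod {ι : Type*} (S : Finset ι)
    {f : ι → ∀ M : FieldStructure.{u, w} L, Tuple M Δ → M.K}
    (hf : ∀ i, TermDefinable (s := Srt.field) Δ (f i)) :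
    TermDefinable (s := Srt.field) Δ (fun M v => ∏ i ∈ S, f i M v) := by
  classical
  induction S using Finset.induction_on with
  | empty => simpa using TermDefinable.one (L := L)
  | insert a S ha ih => simpa [Finset.prod_insert ha] using (hf a).mul ih

/-- The exponents are fixed and only coefficients and point vary: a polynomial of a prescribed shape
is a term in its coefficients, while "all polynomials" is not a first-order quantifier. -/
theorem TermDefinable.evalPolynomial {n k : ℕ} (e : Fin k → (Fin n →₀ ℕ))
    {a : Fin k → ∀ M : FieldStructure.{u, w} L, Tuple M Δ → M.K}
    {z : Fin n → ∀ M : FieldStructure.{u, w} L, Tuple M Δ → M.K}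
    (ha : ∀ j, TermDefinable (s := Srt.field) Δ (a j))
    (hz : ∀ i, TermDefinable (s := Srt.field) Δ (z i)) :
    TermDefinable (s := Srt.field) Δ (fun M v => MvPolynomial.eval (fun i => z i M v)
      (∑ j, MvPolynomial.monomial (e j) (a j M v))) := by
  have h := TermDefinable.sum Finset.univ (fun j => (ha j).mul
    (TermDefinable.prod Finset.univ (fun i => (hz i).pow (e j i))))
  simpa [MvPolynomial.eval_monomial, Finsupp.prod_fintype] using h

theorem FormulaDefinable.imp {P Q : ∀ M : FieldStructure.{u, w} L, Tuple M Δ → Prop}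
    (hP : FormulaDefinable Δ P) (hQ : FormulaDefinable Δ Q) :
    FormulaDefinable Δ (fun M v => P M v → Q M v) := by
  obtain ⟨φ, hφ⟩ := hP
  obtain ⟨ψ, hψ⟩ := hQ
  exact ⟨.imp φ ψ, fun M v => by simp only [Formula.Realize, hφ, hψ]⟩

theorem FormulaDefinable.not {P : ∀ M : FieldStructure.{u, w} L, Tuple M Δ → Prop}
    (hP : FormulaDefinable Δ P) : FormulaDefinable Δ (fun M v => ¬ P M v) :=
  hP.imp ⟨.falsum, fun _ _ => Iff.rfl⟩

theorem FormulaDefinable.and {P Q : ∀ M : FieldStructure.{u, w} L, Tuple M Δ → Prop}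
    (hP : FormulaDefinable Δ P) (hQ : FormulaDefinable Δ Q) :
    FormulaDefinable Δ (fun M v => P M v ∧ Q M v) := by
  simpa only [Classical.not_imp, not_not] using (hP.imp hQ.not).not

theorem FormulaDefinable.eq {s : Srt L.Aux}
    {f g : ∀ M : FieldStructure.{u, w} L, Tuple M Δ → M.carrier s}
    (hf : TermDefinable Δ f) (hg : TermDefinable Δ g) :
    FormulaDefinable Δ (fun M v => f M v = g M v) := by
  obtain ⟨s, hs⟩ := hf
  obtain ⟨t, ht⟩ := hg
  exact ⟨.eq s t, fun M v => by simp only [Formula.Realize, hs, ht]⟩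

theorem FormulaDefinable.realize {s : Srt L.Aux} {Γ : List (Srt L.Aux)}
    (χ : Formula L (s :: Γ)) {x : ∀ M : FieldStructure.{u, w} L, Tuple M Δ → M.carrier s}
    {c : ∀ M : FieldStructure.{u, w} L, Tuple M Δ → Tuple M Γ}
    (hx : TermDefinable Δ x) (hc : ∀ i, TermDefinable Δ (fun M v => c M v i)) :
    FormulaDefinable Δ (fun M v => χ.Realize M (Tuple.cons (x M v) (c M v))) := by
  obtain ⟨t, ht⟩ := hx
  choose τ hτ using hc
  refine ⟨χ.subst (Subst.cons t τ), fun M v => ?_⟩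
  rw [Formula.realize_subst, Subst.eval_cons, ht]
  exact iff_of_eq (congrArg (fun y => χ.Realize M (Tuple.cons (x M v) y))
    (funext fun i => hτ i M v))

/-- Only the context `s :: Δ` with its fresh first variable is needed. Asking for all contexts and
substitutions allows quantifiers to be nested with bound variables treated as arbitrary terms,
without index bookkeeping. -/
theorem FormulaDefinable.all {s : Srt L.Aux}
    {P : ∀ M : FieldStructure.{u, w} L, M.carrier s → Tuple M Δ → Prop}
    (h : ∀ (Δ' : List (Srt L.Aux)) (ρ : Subst L Δ Δ') (t : Term L Δ' s),
      FormulaDefinable Δ' (fun M v => P M (t.eval M v) (ρ.eval M v))) :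
    FormulaDefinable Δ (fun M v => ∀ a, P M a v) := by
  obtain ⟨φ, hφ⟩ := h (s :: Δ) (fun i => Term.var (Γ := s :: Δ) (Fin.succ i))
    (Term.var (Γ := s :: Δ) (0 : Fin (Δ.length + 1)))
  exact ⟨.all φ, fun M v => forall_congr' fun a => hφ M _⟩

theorem FormulaDefinable.exists {s : Srt L.Aux}
    {P : ∀ M : FieldStructure.{u, w} L, M.carrier s → Tuple M Δ → Prop}
    (h : ∀ (Δ' : List (Srt L.Aux)) (ρ : Subst L Δ Δ') (t : Term L Δ' s),
      FormulaDefinable Δ' (fun M v => P M (t.eval M v) (ρ.eval M v))) :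
    FormulaDefinable Δ (fun M v => ∃ a, P M a v) := by
  simpa only [not_forall, not_not] using
    (FormulaDefinable.all (P := fun M a v => ¬ P M a v) fun Δ' ρ t => (h Δ' ρ t).not).not

theorem Subst.eval_comp {Γ Δ Δ' : List (Srt L.Aux)} (σ : Subst L Γ Δ) (ρ : Subst L Δ Δ')
    (M : FieldStructure.{u, w} L) (v : Tuple M Δ') :
    Subst.eval (fun i => (σ i).subst ρ) M v = σ.eval M (ρ.eval M v) :=
  funext fun i => Term.eval_subst M ρ (σ i) v

end

/-- A quantifier over n-tuples of field elements is n single quantifiers, split off by `Fin.cons`.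
-/
theorem FormulaDefinable.forallFun {n : ℕ} : ∀ {Δ : List (Srt L.Aux)}
    {P : ∀ M : FieldStructure.{u, w} L, (Fin n → M.K) → Tuple M Δ → Prop}
    (_ : ∀ (Δ' : List (Srt L.Aux)) (ρ : Subst L Δ Δ') (x : Fin n → Term L Δ' Srt.field),
      FormulaDefinable Δ' (fun M v => P M (fun i => (x i).eval M v) (ρ.eval M v))),
    FormulaDefinable Δ (fun M v => ∀ x, P M x v) := by
  induction n with
  | zero =>
    intro Δ P h
    obtain ⟨φ, hφ⟩ := h Δ (fun i => Term.var i) (fun i => i.elim0)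
    refine ⟨φ, fun M v => (hφ M v).trans ⟨fun H x => ?_, fun H => H _⟩⟩
    rw [Subsingleton.elim x (fun i => Term.eval M v (i.elim0 : Term L Δ Srt.field))]
    exact H
  | succ n ih =>
    intro Δ P h
    have key : FormulaDefinable Δ
        (fun M v => ∀ (a : M.K) (x : Fin n → M.K), P M (Fin.cons a x) v) := by
      refine FormulaDefinable.all (s := Srt.field)
        (P := fun M a v => ∀ x : Fin n → M.K, P M (Fin.cons a x) v) fun Δ₁ ρ₁ t => ?_
      refine ih (P := fun M x v => P M (Fin.cons (t.eval M v) x) (ρ₁.eval M v))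
        fun Δ₂ ρ₂ x => ?_
      obtain ⟨φ, hφ⟩ := h Δ₂ (fun i => (ρ₁ i).subst ρ₂) (Fin.cons (t.subst ρ₂) x)
      refine ⟨φ, fun M v => (hφ M v).trans (iff_of_eq (congrArg₂ (P M) (funext fun i => ?_)
        (Subst.eval_comp ρ₁ ρ₂ M v)))⟩
      refine Fin.cases ?_ (fun j => ?_) i
      · exact Term.eval_subst M ρ₂ t v
      · rfl
    obtain ⟨φ, hφ⟩ := key
    refine ⟨φ, fun M v => (hφ M v).trans ⟨fun H x => ?_, fun H a x => H _⟩⟩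
    simpa using H (x 0) (Fin.tail x)

theorem FormulaDefinable.forallTuple {Γ : List (Srt L.Aux)} : ∀ {Δ : List (Srt L.Aux)}
    {P : ∀ M : FieldStructure.{u, w} L, Tuple M Γ → Tuple M Δ → Prop}
    (_ : ∀ (Δ' : List (Srt L.Aux)) (ρ : Subst L Δ Δ') (x : Subst L Γ Δ'),
      FormulaDefinable Δ' (fun M v => P M (x.eval M v) (ρ.eval M v))),
    FormulaDefinable Δ (fun M v => ∀ x, P M x v) := by
  induction Γ with
  | nil =>
    intro Δ P h
    obtain ⟨φ, hφ⟩ := h Δ (fun i => Term.var i) (fun i => i.elim0)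
    refine ⟨φ, fun M v => (hφ M v).trans ⟨fun H x => ?_, fun H => H _⟩⟩
    have : x = Subst.eval (Γ := []) (fun i => i.elim0) M v := funext fun i => i.elim0
    rw [this]
    exact H
  | cons s Γ ih =>
    intro Δ P h
    have key : FormulaDefinable Δ
        (fun M v => ∀ (a : M.carrier s) (x : Tuple M Γ), P M (Tuple.cons a x) v) := by
      refine FormulaDefinable.all
        (P := fun M a v => ∀ x : Tuple M Γ, P M (Tuple.cons a x) v) fun Δ₁ ρ₁ t => ?_
      refine ih (P := fun M x v => P M (Tuple.cons (t.eval M v) x) (ρ₁.eval M v))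
        fun Δ₂ ρ₂ x => ?_
      obtain ⟨φ, hφ⟩ := h Δ₂ (fun i => (ρ₁ i).subst ρ₂)
        (Subst.cons (t.subst ρ₂) x)
      exact ⟨φ, fun M v => (hφ M v).trans (iff_of_eq (congrArg₂ (P M)
        ((Subst.eval_cons M _ x v).trans (congrArg (fun a => Tuple.cons a (x.eval M v))
          (Term.eval_subst M ρ₂ t v)))
        (Subst.eval_comp ρ₁ ρ₂ M v)))⟩
    obtain ⟨φ, hφ⟩ := key
    refine ⟨φ, fun M v => (hφ M v).trans ⟨fun H x => ?_, fun H a x => H _⟩⟩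
    rw [← Tuple.cons_eta x]
    exact H _ _

theorem FormulaDefinable.existsTuple {Γ Δ : List (Srt L.Aux)}
    {P : ∀ M : FieldStructure.{u, w} L, Tuple M Γ → Tuple M Δ → Prop}
    (h : ∀ (Δ' : List (Srt L.Aux)) (ρ : Subst L Δ Δ') (x : Subst L Γ Δ'),
      FormulaDefinable Δ' (fun M v => P M (x.eval M v) (ρ.eval M v))) :
    FormulaDefinable Δ (fun M v => ∃ x, P M x v) := by
  simpa only [not_forall, not_not] using
    (FormulaDefinable.forallTuple (P := fun M a v => ¬ P M a v) fun Δ' ρ t => (h Δ' ρ t).not).not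

end Definability
end GenericDerivation

namespace GenericDerivation

/-! ### Tame structures -/

/-- A zero of a polynomial at which the partial derivative in the last variable does not vanish. -/
def IsRegularZero {K : Type*} [Field K] {m : ℕ} (Q : MvPolynomial (Fin (m + 1)) K)
    (y : Fin (m + 1) → K) : Prop :=
  MvPolynomial.eval y Q = 0 ∧ MvPolynomial.eval y (MvPolynomial.pderiv (Fin.last m) Q) ≠ 0

section Tame

variable {L : FieldLanguage.{u}} {Γ : List (Srt L.Aux)}

/-- `a` lies in the basic neighbourhood `χ(M, c)` of `0`. -/
def Nbhd (χ : Formula L (Srt.field :: Γ)) (M : FieldStructure.{u, w} L) (c : Tuple M Γ)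
    (a : M.K) : Prop :=
  χ.Realize M (Tuple.cons (s := Srt.field) a c)

/-- The first-order properties of the family `χ(M, c)` on which the construction of generic
derivations depends: it is a separated non-discrete filter base in a field of characteristic zero
and satisfies the implicit function theorem for polynomials. -/
structure Tame (χ : Formula L (Srt.field :: Γ)) (M : FieldStructure.{u, w} L) : Prop where
  natCast_ne_zero : ∀ n : ℕ, ((n + 1 : ℕ) : M.K) ≠ 0
  exists_ne_zero : ∀ c : Tuple M Γ, ∃ a : M.K, a ≠ 0 ∧ Nbhd χ M c a
  exists_not_nbhd : ∀ a : M.K, a ≠ 0 → ∃ c : Tuple M Γ, ¬ Nbhd χ M c a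
  directed : ∀ c d : Tuple M Γ, ∃ e : Tuple M Γ, ∀ a, Nbhd χ M e a → Nbhd χ M c a ∧ Nbhd χ M d a
  implicit : ∀ (m : ℕ) (Q : MvPolynomial (Fin (m + 1)) M.K) (y : Fin (m + 1) → M.K),
    IsRegularZero Q y → ∀ c : Tuple M Γ, ∃ d : Tuple M Γ, ∀ x : Fin m → M.K,
      (∀ i, Nbhd χ M d (x i)) → ∃ t : M.K, Nbhd χ M c t ∧
        IsRegularZero Q (fun i => y i + Fin.snoc (α := fun _ => M.K) x t i)

/-- Elementary equivalence. -/
def ElemEquiv (M N : FieldStructure.{u, w} L) : Prop :=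
  ∀ φ : Formula L [], φ.Realize M (Tuple.nil M) ↔ φ.Realize N (Tuple.nil N)

theorem ElemEquiv.iff {M N : FieldStructure.{u, w} L} (h : ElemEquiv M N)
    {P : FieldStructure.{u, w} L → Prop} (hP : FormulaDefinable [] (fun M _ => P M)) :
    P M ↔ P N := by
  obtain ⟨φ, hφ⟩ := hP
  exact (hφ M (Tuple.nil M)).symm.trans ((h φ).trans (hφ N (Tuple.nil N)))

theorem ElemEquiv.symm {M N : FieldStructure.{u, w} L} (h : ElemEquiv M N) : ElemEquiv N M :=
  fun φ => (h φ).symm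

/-- `Th M` is complete: a sentence false in `M` has its negation in `Th M`. -/
theorem elemEquiv_of_isModel {M N : FieldStructure.{u, w} L} (h : IsModel (Th M) N) :
    ElemEquiv M N := by
  refine fun φ => ⟨h φ, fun hN => ?_⟩
  by_contra hM
  exact h φ.not hM hN

theorem isModel_of_elemEquiv {M N : FieldStructure.{u, w} L} (h : ElemEquiv M N) :
    IsModel (Th M) N :=
  fun φ hφ => (h φ).1 hφ

theorem ElementaryEmbedding.elemEquiv {M N : FieldStructure.{u, w} L}
    (e : ElementaryEmbedding M N) : ElemEquiv M N := by
  intro φ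
  rw [← e.realize_iff φ]
  exact iff_of_eq (congrArg (φ.Realize N) (funext fun i => i.elim0))

theorem FormulaDefinable.forallFin {n : ℕ} {Δ : List (Srt L.Aux)}
    {P : Fin n → ∀ M : FieldStructure.{u, w} L, Tuple M Δ → Prop}
    (h : ∀ i, FormulaDefinable Δ (P i)) : FormulaDefinable Δ (fun M v => ∀ i, P i M v) := by
  induction n with
  | zero => exact ⟨Formula.falsum.imp .falsum, fun M v => ⟨fun _ i => i.elim0, fun _ h => h⟩⟩
  | succ n ih => simpa only [Fin.forall_fin_succ] using (h 0).and (ih fun i => h i.succ)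

theorem FormulaDefinable.nbhd (χ : Formula L (Srt.field :: Γ)) {Δ : List (Srt L.Aux)}
    {x : ∀ M : FieldStructure.{u, w} L, Tuple M Δ → M.K}
    {c : ∀ M : FieldStructure.{u, w} L, Tuple M Δ → Tuple M Γ}
    (hx : TermDefinable (s := Srt.field) Δ x) (hc : ∀ i, TermDefinable Δ (fun M v => c M v i)) :
    FormulaDefinable Δ (fun M v => Nbhd χ M (c M v) (x M v)) :=
  FormulaDefinable.realize χ hx hc

/-- The derivative of a monomial is a monomial with lowered exponent and coefficient multiplied by a
natural number, so the separant is again of a fixed shape. -/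
theorem FormulaDefinable.isRegularZero {m k : ℕ} (e : Fin k → (Fin (m + 1) →₀ ℕ))
    {Δ : List (Srt L.Aux)} {a : Fin k → ∀ M : FieldStructure.{u, w} L, Tuple M Δ → M.K}
    {z : Fin (m + 1) → ∀ M : FieldStructure.{u, w} L, Tuple M Δ → M.K}
    (ha : ∀ j, TermDefinable (s := Srt.field) Δ (a j))
    (hz : ∀ i, TermDefinable (s := Srt.field) Δ (z i)) :
    FormulaDefinable Δ (fun M v => IsRegularZero
      (∑ j, MvPolynomial.monomial (e j) (a j M v)) (fun i => z i M v)) := by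
  have h1 := FormulaDefinable.eq (TermDefinable.evalPolynomial e ha hz) TermDefinable.zero
  have h2 := FormulaDefinable.eq (TermDefinable.evalPolynomial
    (fun j => e j - Finsupp.single (Fin.last m) 1)
    (fun j => (ha j).mul (TermDefinable.natCast (e j (Fin.last m)))) hz) TermDefinable.zero
  simpa only [IsRegularZero, map_sum, MvPolynomial.pderiv_monomial] using h1.and h2.not

theorem tame_exists_ne_zero_definable (χ : Formula L (Srt.field :: Γ)) :
    FormulaDefinable.{u, w} [] (fun M _ => ∀ c : Tuple M Γ, ∃ a : M.K, a ≠ 0 ∧ Nbhd χ M c a) :=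
  .forallTuple fun _ _ c => .exists fun _ ρ a =>
    ((FormulaDefinable.eq (.term a) .zero).not).and
      (.nbhd χ (.term a) fun i => (TermDefinable.term (c i)).comp ρ)

theorem tame_exists_not_nbhd_definable (χ : Formula L (Srt.field :: Γ)) :
    FormulaDefinable.{u, w} []
      (fun M _ => ∀ a : M.K, a ≠ 0 → ∃ c : Tuple M Γ, ¬ Nbhd χ M c a) :=
  .all fun _ _ a => (FormulaDefinable.eq (.term a) .zero).not.imp <|
    .existsTuple fun _ ρ c => 
      (FormulaDefinable.nbhd χ ((TermDefinable.term a).comp ρ) fun i => .term (c i)).not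

theorem tame_directed_definable (χ : Formula L (Srt.field :: Γ)) :
    FormulaDefinable.{u, w} [] (fun M _ => ∀ c d : Tuple M Γ, ∃ e : Tuple M Γ, ∀ a : M.K,
      Nbhd χ M e a → Nbhd χ M c a ∧ Nbhd χ M d a) := by
  refine .forallTuple fun Δ₁ _ c => .forallTuple fun Δ₂ ρ₂ d => .existsTuple fun Δ₃ ρ₃ e =>
    .all fun Δ₄ ρ₄ a => ?_
  exact (FormulaDefinable.nbhd χ (.term a) fun i => (TermDefinable.term (e i)).comp ρ₄).imp
    ((FormulaDefinable.nbhd χ (.term a) fun i =>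
        (((TermDefinable.term (c i)).comp ρ₂).comp ρ₃).comp ρ₄).and
      (FormulaDefinable.nbhd χ (.term a) fun i => ((TermDefinable.term (d i)).comp ρ₃).comp ρ₄))

/-- One instance of the implicit function scheme: a single sentence for each number of variables and
each list of exponents. -/
theorem tame_implicit_definable (χ : Formula L (Srt.field :: Γ)) {m k : ℕ}
    (e : Fin k → (Fin (m + 1) →₀ ℕ)) :
    FormulaDefinable.{u, w} [] (fun M _ => ∀ (a : Fin k → M.K) (y : Fin (m + 1) → M.K)
      (c : Tuple M Γ), IsRegularZero (∑ j, MvPolynomial.monomial (e j) (a j)) y →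
        ∃ d : Tuple M Γ, ∀ x : Fin m → M.K, (∀ i, Nbhd χ M d (x i)) → ∃ t : M.K, Nbhd χ M c t ∧
          IsRegularZero (∑ j, MvPolynomial.monomial (e j) (a j))
            (fun i => y i + Fin.snoc (α := fun _ => M.K) x t i)) := by
  refine .forallFun fun Δ₁ _ a => .forallFun fun Δ₂ ρ₂ y => .forallTuple fun Δ₃ ρ₃ c => ?_
  refine (FormulaDefinable.isRegularZero e
    (fun j => ((TermDefinable.term (a j)).comp ρ₂).comp ρ₃)
    (fun i => (TermDefinable.term (y i)).comp ρ₃)).imp ?_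
  refine .existsTuple fun Δ₄ ρ₄ d => .forallFun fun Δ₅ ρ₅ x => ?_
  refine (FormulaDefinable.forallFin fun i => FormulaDefinable.nbhd χ (.term (x i)) fun i =>
    (TermDefinable.term (d i)).comp ρ₅).imp ?_
  refine .exists fun Δ₆ ρ₆ t => ?_
  refine (FormulaDefinable.nbhd χ (.term t) fun i =>
    (((TermDefinable.term (c i)).comp ρ₄).comp ρ₅).comp ρ₆).and ?_
  refine FormulaDefinable.isRegularZero e
    (fun j => (((((TermDefinable.term (a j)).comp ρ₂).comp ρ₃).comp ρ₄).comp ρ₅).comp ρ₆)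
    (fun i => TermDefinable.add
      ((((((TermDefinable.term (y i)).comp ρ₃).comp ρ₄).comp ρ₅).comp ρ₆)) ?_)
  refine Fin.lastCases ?_ (fun j => ?_) i
  · simpa only [Fin.snoc_last] using TermDefinable.term t
  · simpa only [Fin.snoc_castSucc] using (TermDefinable.term (x j)).comp ρ₆

/-- Each clause of tameness is a sentence or a scheme of sentences. -/
theorem Tame.of_elemEquiv {χ : Formula L (Srt.field :: Γ)} {M N : FieldStructure.{u, w} L}
    (h : Tame χ M) (hMN : ElemEquiv M N) : Tame χ N where
  natCast_ne_zero n := (hMN.iff (P := fun M => ((n + 1 : ℕ) : M.K) ≠ 0)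
    (FormulaDefinable.eq (.natCast (n + 1)) .zero).not).1 (h.natCast_ne_zero n)
  exists_ne_zero := (hMN.iff (tame_exists_ne_zero_definable χ)).1 h.exists_ne_zero
  exists_not_nbhd := (hMN.iff (tame_exists_not_nbhd_definable χ)).1 h.exists_not_nbhd
  directed := (hMN.iff (tame_directed_definable χ)).1 h.directed
  implicit := by
    intro m Q y hy c
    -- The exponents of `Q` itself select the instance of the scheme, with the coefficients of `Q`
    -- as values of the quantified variables.
    let f := Q.support.equivFin.symm
    let e : Fin Q.support.card → (Fin (m + 1) →₀ ℕ) := fun j => f j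
    have hQ : Q = ∑ j, MvPolynomial.monomial (e j) (Q.coeff (e j)) := by
      conv_lhs => rw [← MvPolynomial.support_sum_monomial_coeff Q]
      rw [← Finset.sum_coe_sort, ← Equiv.sum_comp f]
    have key := (hMN.iff (tame_implicit_definable χ e)).1
      (fun a y c hy => h.implicit m _ y hy c) (fun j => Q.coeff (e j)) y c
    rw [← hQ] at key
    exact key hy

end Tame
end GenericDerivation

namespace GenericDerivation

/-! ### Ultrapowers -/

section Ultrapower

open Filter

variable {L : FieldLanguage.{u}} (M : FieldStructure.{u, w} L) {I : Type w} (U : Ultrafilter I)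

/-- The ultrapower of a structure. -/
noncomputable def ultrapower : FieldStructure.{u, w} L where
  carrier s := (U : Filter I).Germ (M.carrier s)
  fieldInst := inferInstanceAs (Field ((U : Filter I).Germ M.K))
  const c := ((fun _ => M.const c : I → M.K) : (U : Filter I).Germ M.K)
  fn f a := ((fun x => M.fn f (fun i => (a i).out x) : I → M.carrier _) :
    (U : Filter I).Germ (M.carrier _))
  rel R a := ∀ᶠ x in (U : Filter I), M.rel R (fun i => (a i).out x)

/-- The class of a function in the ultrapower. -/
def ultrapower.mk {s : Srt L.Aux} (f : I → M.carrier s) : (ultrapower M U).carrier s :=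
  (f : (U : Filter I).Germ (M.carrier s))

variable {M U}

theorem ultrapower.exists_rep {s : Srt L.Aux} (a : (ultrapower M U).carrier s) :
    ∃ f : I → M.carrier s, ultrapower.mk M U f = a :=
  Quotient.exists_rep a

theorem ultrapower.mk_eq_mk {s : Srt L.Aux} {f g : I → M.carrier s} :
    ultrapower.mk M U f = ultrapower.mk M U g ↔ ∀ᶠ x in (U : Filter I), f x = g x :=
  Germ.coe_eq

/-- Symbols of the ultrapower are interpreted at the representatives picked by `Quotient.out`. There
are finitely many arguments, so these agree with any given representatives on one common large set.
-/
theorem ultrapower.eventually_out_eq {σ : List (Srt L.Aux)}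
    (v : ∀ i : Fin σ.length, I → M.carrier (σ.get i)) :
    ∀ᶠ x in (U : Filter I), ∀ i, Quotient.out (ultrapower.mk M U (v i)) x = v i x :=
  eventually_all.2 fun _ => ultrapower.mk_eq_mk.1 (Quotient.out_eq _)

theorem Term.eval_ultrapower {Γ : List (Srt L.Aux)} {s : Srt L.Aux} (t : Term L Γ s)
    (v : ∀ i : Fin Γ.length, I → M.carrier (Γ.get i)) :
    t.eval (ultrapower M U) (fun i => ultrapower.mk M U (v i)) =
      ultrapower.mk M U (fun x => t.eval M (fun i => v i x)) := by
  induction t with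
  | var i => rfl
  | zero => rfl
  | one => rfl
  | add t₁ t₂ h₁ h₂ => simp only [eval, h₁, h₂]; rfl
  | neg t h => simp only [eval, h]; rfl
  | mul t₁ t₂ h₁ h₂ => simp only [eval, h₁, h₂]; rfl
  | inv t h => simp only [eval, h]; rfl
  | const c => rfl
  | app f ts h =>
    simp only [eval, h]
    refine ultrapower.mk_eq_mk.2 ?_
    filter_upwards [ultrapower.eventually_out_eq (U := U)
      (fun i x => (ts i).eval M (fun j => v j x))] with x hx
    exact congrArg _ (funext hx)

/-- Łoś's theorem. -/
theorem Formula.realize_ultrapower {Γ : List (Srt L.Aux)} (φ : Formula L Γ)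
    (v : ∀ i : Fin Γ.length, I → M.carrier (Γ.get i)) :
    φ.Realize (ultrapower M U) (fun i => ultrapower.mk M U (v i)) ↔
      ∀ᶠ x in (U : Filter I), φ.Realize M (fun i => v i x) := by
  induction φ with
  | falsum => simpa [Realize] using U.neBot.ne
  | eq t₁ t₂ => simp only [Realize, Term.eval_ultrapower]; exact ultrapower.mk_eq_mk
  | rel R ts =>
    simp only [Realize, Term.eval_ultrapower]
    refine eventually_congr ?_
    filter_upwards [ultrapower.eventually_out_eq (U := U)
      (fun i x => (ts i).eval M (fun j => v j x))] with x hx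
    exact iff_of_eq (congrArg _ (funext hx))
  | imp φ ψ h₁ h₂ => simp only [Realize, h₁, h₂]; exact Ultrafilter.eventually_imp.symm
  | @all Γ s φ h =>
    have key : ∀ f : I → M.carrier s,
        φ.Realize (ultrapower M U)
          (Tuple.cons (ultrapower.mk M U f) (fun i => ultrapower.mk M U (v i))) ↔
        ∀ᶠ x in (U : Filter I), φ.Realize M (Tuple.cons (f x) (fun i => v i x)) := by
      intro f
      have := h (Fin.cons (α := fun i : Fin (Γ.length + 1) => I → M.carrier ((s :: Γ).get i)) f v)
      convert this using 2
      · funext i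
        refine Fin.cases ?_ (fun j => ?_) i <;> rfl
      · funext x
        refine congrArg _ (funext fun i => ?_)
        refine Fin.cases ?_ (fun j => ?_) i <;> rfl
    simp only [Realize]
    constructor
    · intro H
      by_contra hc
      have hc' := Ultrafilter.eventually_not.2 hc
      -- A counterexample is chosen at each index that has one. Sorts are not assumed nonempty, so
      -- the default value at the other indices is a counterexample taken from one index.
      have : ∃ f : I → M.carrier s, ∀ x,
          (∃ a, ¬ φ.Realize M (Tuple.cons a (fun i => v i x))) →
            ¬ φ.Realize M (Tuple.cons (f x) (fun i => v i x)) := by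
        obtain ⟨x₀, hx₀⟩ := hc'.exists
        rw [not_forall] at hx₀
        obtain ⟨a₀, -⟩ := hx₀
        classical
        refine ⟨fun x => if hx : ∃ a, ¬ φ.Realize M (Tuple.cons a (fun i => v i x)) then
          hx.choose else a₀, fun x hx => ?_⟩
        simp only [dif_pos hx]
        exact hx.choose_spec
      obtain ⟨f, hf⟩ := this
      obtain ⟨x, hx₁, hx₂⟩ := (hc'.and ((key f).1 (H _))).exists
      exact hf x (not_forall.1 hx₁) hx₂
    · intro H a
      obtain ⟨f, rfl⟩ := ultrapower.exists_rep a
      exact (key f).2 (H.mono fun x hx => hx _)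

/-- The diagonal embedding into an ultrapower. -/
def ultrapower.diag (M : FieldStructure.{u, w} L) (U : Ultrafilter I) :
    ElementaryEmbedding M (ultrapower M U) where
  toFun _ a := ultrapower.mk M U (fun _ => a)
  realize_iff φ v := by
    rw [Formula.realize_ultrapower φ (fun i _ => v i)]
    exact eventually_const

end Ultrapower
end GenericDerivation

namespace GenericDerivation

/-! ### Elementary embeddings and limits of elementary chains -/

section Elementary

variable {L : FieldLanguage.{u}} {M N : FieldStructure.{u, w} L}

/-- Elementarity is applied to the formula "first variable = t". -/
theorem ElementaryEmbedding.toFun_eval (e : ElementaryEmbedding M N) {Γ : List (Srt L.Aux)}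
    {s : Srt L.Aux} (t : Term L Γ s) (v : Tuple M Γ) :
    e.toFun s (t.eval M v) = t.eval N (fun i => e.toFun _ (v i)) := by
  have h := (e.realize_iff (Formula.eq (Term.var (Γ := s :: Γ) (0 : Fin (Γ.length + 1)))
    (t.weaken s)) (Tuple.cons (t.eval M v) v)).2 (Term.eval_weaken M t _ v).symm
  have h2 : (fun i => e.toFun _ (Tuple.cons (t.eval M v) v i)) =
      Tuple.cons (M := N) (e.toFun s (t.eval M v)) (fun i => e.toFun _ (v i)) := by
    funext i
    refine Fin.cases ?_ (fun j => ?_) i <;> rfl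
  rw [h2] at h
  exact h.trans (Term.eval_weaken N t _ _)

theorem ElementaryEmbedding.injective (e : ElementaryEmbedding M N) (s : Srt L.Aux) :
    Function.Injective (e.toFun s) := by
  intro a b hab
  exact (e.realize_iff (Formula.eq (s := s) (Term.var (Γ := [s, s]) (0 : Fin 2))
    (Term.var (Γ := [s, s]) (1 : Fin 2))) (Tuple.cons a (Tuple.cons b (Tuple.nil M)))).1 hab

/-- The homomorphism of fields given by an elementary embedding. -/
def ElementaryEmbedding.ringHom (e : ElementaryEmbedding M N) : M.K →+* N.K where
  toFun := e.toFun Srt.field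
  map_zero' := e.toFun_eval (Γ := []) .zero (Tuple.nil M)
  map_one' := e.toFun_eval (Γ := []) .one (Tuple.nil M)
  map_add' a b := e.toFun_eval (Γ := [Srt.field, Srt.field])
    (.add (.var (Γ := [Srt.field, Srt.field]) (0 : Fin 2))
      (.var (Γ := [Srt.field, Srt.field]) (1 : Fin 2)))
    (Tuple.cons (s := Srt.field) a (Tuple.cons (s := Srt.field) b (Tuple.nil M)))
  map_mul' a b := e.toFun_eval (Γ := [Srt.field, Srt.field])
    (.mul (.var (Γ := [Srt.field, Srt.field]) (0 : Fin 2))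
      (.var (Γ := [Srt.field, Srt.field]) (1 : Fin 2)))
    (Tuple.cons (s := Srt.field) a (Tuple.cons (s := Srt.field) b (Tuple.nil M)))

theorem ElementaryEmbedding.map_const (e : ElementaryEmbedding M N) (c : L.Const) :
    e.toFun Srt.field (M.const c) = N.const c :=
  e.toFun_eval (Γ := []) (.const c) (Tuple.nil M)

theorem ElementaryEmbedding.map_fn (e : ElementaryEmbedding M N) {σ : List (Srt L.Aux)}
    {s : Srt L.Aux} (f : L.Fn σ s) (a : Tuple M σ) :
    e.toFun s (M.fn f a) = N.fn f (fun i => e.toFun _ (a i)) :=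
  e.toFun_eval (Γ := σ) (.app f (fun i => .var i)) a

theorem ElementaryEmbedding.map_rel (e : ElementaryEmbedding M N) {σ : List (Srt L.Aux)}
    (R : L.Rel σ) (a : Tuple M σ) : N.rel R (fun i => e.toFun _ (a i)) ↔ M.rel R a :=
  e.realize_iff (Γ := σ) (.rel R (fun i => .var i)) a

theorem ElementaryEmbedding.nbhd_iff {Γ : List (Srt L.Aux)} (χ : Formula L (Srt.field :: Γ))
    (e : ElementaryEmbedding M N) (c : Tuple M Γ) (a : M.K) :
    Nbhd χ N (fun i => e.toFun _ (c i)) (e.ringHom a) ↔ Nbhd χ M c a := by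
  refine Iff.trans (iff_of_eq (congrArg (χ.Realize N) ?_)) (e.realize_iff χ _)
  funext i
  refine Fin.cases ?_ (fun j => ?_) i <;> rfl

/-- The identity embedding. -/
def ElementaryEmbedding.refl (M : FieldStructure.{u, w} L) : ElementaryEmbedding M M where
  toFun _ a := a
  realize_iff _ _ := Iff.rfl

/-- Composition of elementary embeddings. -/
def ElementaryEmbedding.comp {P : FieldStructure.{u, w} L} (g : ElementaryEmbedding N P)
    (f : ElementaryEmbedding M N) : ElementaryEmbedding M P where
  toFun s a := g.toFun s (f.toFun s a)
  realize_iff φ v := (g.realize_iff φ _).trans (f.realize_iff φ v)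

end Elementary

/-- A directed system of elementary embeddings indexed by the natural numbers. -/
structure ElementaryChain (L : FieldLanguage.{u}) where
  obj : ℕ → FieldStructure.{u, w} L
  map : ∀ {i j : ℕ}, i ≤ j → ElementaryEmbedding (obj i) (obj j)
  map_self : ∀ (i : ℕ) (s : Srt L.Aux) (a : (obj i).carrier s), (map le_rfl).toFun s a = a
  map_map : ∀ {i j k : ℕ} (hij : i ≤ j) (hjk : j ≤ k) (s : Srt L.Aux) (a : (obj i).carrier s),
    (map hjk).toFun s ((map hij).toFun s a) = (map (hij.trans hjk)).toFun s a

namespace ElementaryChain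

variable {L : FieldLanguage.{u}} (C : ElementaryChain.{u, w} L)

/-- Equality in the limit. -/
def setoid (s : Srt L.Aux) : Setoid (Σ i, (C.obj i).carrier s) where
  r x y := ∃ (i : ℕ) (hx : x.1 ≤ i) (hy : y.1 ≤ i),
    (C.map hx).toFun s x.2 = (C.map hy).toFun s y.2
  iseqv := ⟨fun x => ⟨x.1, le_rfl, le_rfl, rfl⟩, fun ⟨i, hx, hy, h⟩ => ⟨i, hy, hx, h.symm⟩,
    fun ⟨j, hx, hy, h⟩ ⟨k, hy', hz, h'⟩ => ⟨max j k, hx.trans (le_max_left j k),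
      hz.trans (le_max_right j k), by
        rw [← C.map_map hx (le_max_left j k), ← C.map_map hz (le_max_right j k), h, ← h',
          C.map_map, C.map_map]⟩⟩

/-- The sorts of the limit. -/
abbrev Lim (s : Srt L.Aux) : Type w := Quotient (C.setoid s)

/-- The map from a member of the chain to the limit. -/
def ι (i : ℕ) {s : Srt L.Aux} (a : (C.obj i).carrier s) : C.Lim s := Quotient.mk _ ⟨i, a⟩

theorem ι_map {i j : ℕ} (h : i ≤ j) {s : Srt L.Aux} (a : (C.obj i).carrier s) :
    C.ι j ((C.map h).toFun s a) = C.ι i a :=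
  Quotient.sound ⟨j, le_rfl, h, C.map_self j s _⟩

theorem ι_injective (i : ℕ) (s : Srt L.Aux) :
    Function.Injective (C.ι i : (C.obj i).carrier s → C.Lim s) := by
  intro a b h
  obtain ⟨j, hx, hy, h⟩ := Quotient.exact h
  exact (C.map hx).injective s h

theorem exists_rep {s : Srt L.Aux} (a : C.Lim s) : ∃ i b, C.ι i b = a := by
  obtain ⟨⟨i, b⟩, rfl⟩ := Quotient.exists_rep a
  exact ⟨i, b, rfl⟩

theorem exists_rep_ge {s : Srt L.Aux} (a : C.Lim s) (k : ℕ) : ∃ i, k ≤ i ∧ ∃ b, C.ι i b = a := by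
  obtain ⟨i, b, rfl⟩ := C.exists_rep a
  exact ⟨max k i, le_max_left k i, _, C.ι_map (le_max_right k i) b⟩

theorem exists_common_rep {σ : List (Srt L.Aux)} (a : ∀ i : Fin σ.length, C.Lim (σ.get i))
    (k₀ : ℕ) : ∃ k, k₀ ≤ k ∧ ∃ b : Tuple (C.obj k) σ, (fun i => C.ι k (b i)) = a := by
  choose k b hb using fun i => C.exists_rep (a i)
  -- The sum serves as a stage above `k₀` and above the stages of all entries.
  refine ⟨k₀ + ∑ i, k i, Nat.le_add_right _ _, fun i => (C.map (j := k₀ + ∑ i, k i)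
    ((Finset.single_le_sum (fun _ _ => Nat.zero_le _) (Finset.mem_univ i)).trans
      (Nat.le_add_left _ _))).toFun _ (b i), funext fun i => ?_⟩
  rw [C.ι_map, hb]

instance directedSystem : DirectedSystem (fun i => (C.obj i).K)
    (fun _ _ h => ((C.map h).ringHom : (C.obj _).K → (C.obj _).K)) where
  map_self i a := C.map_self i _ a
  map_map _ _ _ hij hjk a := C.map_map hij hjk _ a

noncomputable instance : Field (C.Lim Srt.field) :=
  inferInstanceAs (Field (DirectLimit (fun i => (C.obj i).K) (fun _ _ h => (C.map h).ringHom)))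

theorem ι_zero (i : ℕ) : C.ι i (0 : (C.obj i).K) = (0 : C.Lim Srt.field) :=
  (DirectLimit.zero_def (f := fun _ _ h => (C.map h).ringHom) i).symm

theorem ι_one (i : ℕ) : C.ι i (1 : (C.obj i).K) = (1 : C.Lim Srt.field) :=
  (DirectLimit.one_def (f := fun _ _ h => (C.map h).ringHom) i).symm

theorem ι_add (i : ℕ) (a b : (C.obj i).K) :
    C.ι i (s := Srt.field) (a + b) = (C.ι i a + C.ι i b : C.Lim Srt.field) :=
  (DirectLimit.add_def (G := fun i => (C.obj i).K)
    (f := fun _ _ h => (C.map h).ringHom) i a b).symm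

theorem ι_mul (i : ℕ) (a b : (C.obj i).K) :
    C.ι i (s := Srt.field) (a * b) = (C.ι i a * C.ι i b : C.Lim Srt.field) :=
  (DirectLimit.mul_def (G := fun i => (C.obj i).K)
    (f := fun _ _ h => (C.map h).ringHom) i a b).symm

/-- The map to the limit as a homomorphism of fields. -/
noncomputable def ιHom (i : ℕ) : (C.obj i).K →+* C.Lim Srt.field where
  toFun a := C.ι i a
  map_zero' := C.ι_zero i
  map_one' := C.ι_one i
  map_add' := C.ι_add i
  map_mul' := C.ι_mul i

/-- Makes the value of a function symbol in the limit independent of the chosen representatives: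
both tuples become equal at the later of the two stages. -/
theorem fn_unique {σ : List (Srt L.Aux)} {s : Srt L.Aux} (f : L.Fn σ s) {j k : ℕ}
    (a : Tuple (C.obj j) σ) (b : Tuple (C.obj k) σ)
    (h : (fun i => C.ι j (a i)) = fun i => C.ι k (b i)) :
    C.ι j ((C.obj j).fn f a) = C.ι k ((C.obj k).fn f b) := by
  rw [← C.ι_map (le_max_left j k), ← C.ι_map (le_max_right j k), ElementaryEmbedding.map_fn,
    ElementaryEmbedding.map_fn]
  congr 2
  funext i
  apply C.ι_injective
  rw [C.ι_map, C.ι_map]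
  exact congrFun h i

theorem rel_unique {σ : List (Srt L.Aux)} (R : L.Rel σ) {j k : ℕ}
    (a : Tuple (C.obj j) σ) (b : Tuple (C.obj k) σ)
    (h : (fun i => C.ι j (a i)) = fun i => C.ι k (b i)) :
    (C.obj j).rel R a ↔ (C.obj k).rel R b := by
  rw [← (C.map (le_max_left j k)).map_rel, ← (C.map (le_max_right j k)).map_rel]
  refine iff_of_eq (congrArg _ (funext fun i => ?_))
  apply C.ι_injective
  rw [C.ι_map, C.ι_map]
  exact congrFun h i

/-- The limit of an elementary chain. -/
noncomputable def lim : FieldStructure.{u, w} L where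
  carrier := C.Lim
  fieldInst := inferInstance
  const c := C.ι 0 ((C.obj 0).const c)
  fn f a := C.ι _ ((C.obj _).fn f (C.exists_common_rep a 0).choose_spec.2.choose)
  rel R a := ∃ (k : ℕ) (b : Tuple (C.obj k) _), (fun i => C.ι k (b i)) = a ∧ (C.obj k).rel R b

theorem eval_lim (k : ℕ) {Γ : List (Srt L.Aux)} {s : Srt L.Aux} (t : Term L Γ s)
    (v : Tuple (C.obj k) Γ) :
    t.eval C.lim (fun i => C.ι k (v i)) = C.ι k (t.eval (C.obj k) v) := by
  induction t with
  | var i => rfl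
  | zero => exact (C.ι_zero k).symm
  | one => exact (C.ι_one k).symm
  | add t₁ t₂ h₁ h₂ => simp only [Term.eval, h₁, h₂]; exact (C.ι_add k _ _).symm
  | neg t h => simp only [Term.eval, h]; exact (map_neg (C.ιHom k) _).symm
  | mul t₁ t₂ h₁ h₂ => simp only [Term.eval, h₁, h₂]; exact (C.ι_mul k _ _).symm
  | inv t h => simp only [Term.eval, h]; exact (map_inv₀ (C.ιHom k) _).symm
  | const c =>
    simp only [Term.eval]
    rw [← (C.map (Nat.zero_le k)).map_const, C.ι_map]
    rfl
  | app f ts h =>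
    simp only [Term.eval, h]
    exact C.fn_unique f _ _ (C.exists_common_rep _ 0).choose_spec.2.choose_spec

/-- Tarski's theorem on unions of elementary chains. The stage is kept general in the induction
because a quantified element may live at a later stage than the parameters. -/
theorem realize_lim {Γ : List (Srt L.Aux)} (φ : Formula L Γ) (k : ℕ) (v : Tuple (C.obj k) Γ) :
    φ.Realize C.lim (fun i => C.ι k (v i)) ↔ φ.Realize (C.obj k) v := by
  induction φ generalizing k with
  | falsum => rfl
  | eq t₁ t₂ =>
    simp only [Formula.Realize, eval_lim]
    exact (C.ι_injective k _).eq_iff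
  | rel R ts =>
    simp only [Formula.Realize, eval_lim]
    exact ⟨fun ⟨j, b, hb, h⟩ => (C.rel_unique R _ _ hb).1 h, fun h => ⟨k, _, rfl, h⟩⟩
  | imp φ ψ h₁ h₂ => simp only [Formula.Realize, h₁, h₂]
  | @all Γ s φ h =>
    have key : ∀ (j : ℕ) (a : (C.obj j).carrier s) (v : Tuple (C.obj j) Γ),
        φ.Realize C.lim (Tuple.cons (M := C.lim) (C.ι j a) (fun i => C.ι j (v i))) ↔
          φ.Realize (C.obj j) (Tuple.cons a v) := by
      intro j a v
      refine Iff.trans (iff_of_eq (congrArg (φ.Realize C.lim) (funext fun i => ?_))) (h j _)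
      refine Fin.cases ?_ (fun j => ?_) i <;> rfl
    constructor
    · intro H a
      exact (key k a v).1 (H _)
    · intro H a
      -- The element is represented at some stage `j ≥ k`, and the universal statement holds there
      -- because the map from stage `k` to stage `j` is elementary.
      obtain ⟨j, hj, b, rfl⟩ := C.exists_rep_ge a k
      have hv : (fun i => C.ι k (v i)) = fun i => C.ι j ((C.map hj).toFun _ (v i)) :=
        funext fun i => (C.ι_map hj _).symm
      rw [hv]
      refine (key j b _).2 ?_
      exact ((C.map hj).realize_iff (Formula.all φ) v).2 H b

/-- The elementary embedding of a member of the chain into the limit. -/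
noncomputable def toLim (i : ℕ) : ElementaryEmbedding (C.obj i) C.lim where
  toFun _ a := C.ι i a
  realize_iff φ v := C.realize_lim φ i v

/-- The chain of compositions of a sequence of elementary embeddings. -/
def ofSteps (M : ℕ → FieldStructure.{u, w} L)
    (e : ∀ n, ElementaryEmbedding (M n) (M (n + 1))) : ElementaryChain.{u, w} L where
  obj := M
  map {i _} h := Nat.leRecOn (C := fun k => ElementaryEmbedding (M i) (M k)) h (fun {k} g => (e k).comp g) (ElementaryEmbedding.refl (M i))
  map_self i s a := by rw [Nat.leRecOn_self]; rfl
  map_map {i j k} hij hjk s a := by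
    induction k, hjk using Nat.le_induction with
    | base => rw [Nat.leRecOn_self]; rfl
    | succ k hjk ih =>
      rw [Nat.leRecOn_succ hjk, Nat.leRecOn_succ (hij.trans hjk)]
      exact congrArg ((e k).toFun s) ih

theorem ofSteps_map_succ (M : ℕ → FieldStructure.{u, w} L)
    (e : ∀ n, ElementaryEmbedding (M n) (M (n + 1))) (n : ℕ) (s : Srt L.Aux)
    (a : (M n).carrier s) : ((ofSteps M e).map (Nat.le_succ n)).toFun s a = (e n).toFun s a := by
  change (Nat.leRecOn (C := fun k => ElementaryEmbedding (M n) (M k)) (Nat.le_succ n)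
    (fun {k} g => (e k).comp g)
    (ElementaryEmbedding.refl (M n)) : ElementaryEmbedding (M n) (M (n + 1))).toFun s a = _
  rw [Nat.leRecOn_succ le_rfl, Nat.leRecOn_self]
  rfl

/-! ### Derivations on the limit -/

section Derivation

variable (δ : ∀ i, Derivation ℤ (C.obj i).K (C.obj i).K)
  (hδ : ∀ {i j : ℕ} (h : i ≤ j) (a : (C.obj i).K),
    (C.map h).ringHom (δ i a) = δ j ((C.map h).ringHom a))

include hδ in
theorem exists_derivation_lim : ∃ D : Derivation ℤ C.lim.K C.lim.K,
    ∀ i (a : (C.obj i).K), D ((C.toLim i).ringHom a) = (C.toLim i).ringHom (δ i a) := by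
  let D : C.lim.K → C.lim.K := fun x => Quotient.liftOn x (fun a => C.ι a.1 (δ a.1 a.2))
    (fun a b ⟨i, ha, hb, h⟩ => by
      rw [← C.ι_map ha, ← C.ι_map hb]
      refine congrArg (C.ι i) ?_
      exact (hδ ha a.2).trans ((congrArg (δ i) h).trans (hδ hb b.2).symm))
  have hD : ∀ i (a : (C.obj i).K), D ((C.toLim i).ringHom a) = (C.toLim i).ringHom (δ i a) :=
    fun i a => rfl
  have hrep : ∀ x y : C.lim.K, ∃ i a b, (C.toLim i).ringHom a = x ∧ (C.toLim i).ringHom b = y := by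
    intro x y
    obtain ⟨i, a, rfl⟩ := C.exists_rep (s := Srt.field) x
    obtain ⟨j, hj, b, rfl⟩ := C.exists_rep_ge (s := Srt.field) y i
    exact ⟨j, _, b, C.ι_map hj a, rfl⟩
  have hadd : ∀ x y, D (x + y) = D x + D y := by
    intro x y
    obtain ⟨i, a, b, rfl, rfl⟩ := hrep x y
    rw [← map_add, hD, hD, hD, map_add, map_add]
  have hmul : ∀ x y, D (x * y) = x • D y + y • D x := by
    intro x y
    obtain ⟨i, a, b, rfl, rfl⟩ := hrep x y
    rw [← map_mul, hD, hD, hD, Derivation.leibniz, map_add, smul_eq_mul, smul_eq_mul, smul_eq_mul,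
      smul_eq_mul, map_mul, map_mul]
  exact ⟨Derivation.mk' (AddMonoidHom.toIntLinearMap (AddMonoidHom.mk' D hadd)) hmul, hD⟩

end Derivation

end ElementaryChain
end GenericDerivation

namespace GenericDerivation

/-! ### Extensions of derivations -/

/-- Stated for bare ring homomorphisms because it is applied to dual numbers whose `R`-algebra
structure is twisted by a derivation and is not the standard one. -/
theorem exists_ringHom_lift_of_formallySmooth {R N B C : Type*} [CommRing R] [CommRing N]
    [CommRing B] [CommRing C] [Algebra R N] [Algebra.FormallySmooth R N] (φ : R →+* B)
    (g : B →+* C) (hg : Function.Surjective g) (hker : IsNilpotent (RingHom.ker g)) (ψ : N →+* C)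
    (h : ∀ r, ψ (algebraMap R N r) = g (φ r)) :
    ∃ θ : N →+* B, (∀ r, θ (algebraMap R N r) = φ r) ∧ ∀ x, g (θ x) = ψ x := by
  let : Algebra R B := φ.toAlgebra
  let : Algebra R C := (g.comp φ).toAlgebra
  let g' : B →ₐ[R] C := { g with commutes' := fun _ => rfl }
  let ψ' : N →ₐ[R] C := { ψ with commutes' := h }
  let θ := Algebra.FormallySmooth.liftOfSurjective ψ' g' hg hker
  exact ⟨θ, fun r => θ.commutes r, fun x =>
    Algebra.FormallySmooth.liftOfSurjective_apply ψ' g' hg hker x⟩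

/-- `N` is algebraic over the field generated by a transcendence basis, and separable over it by
characteristic 0. -/
theorem formallySmooth_of_charZero (F N : Type*) [Field F] [Field N] [CharZero F] [Algebra F N] :
    Algebra.FormallySmooth F N := by
  obtain ⟨s, hs⟩ := exists_isTranscendenceBasis F N
  have : Algebra.IsAlgebraic (IntermediateField.adjoin F (Set.range ((↑) : s → N))) N :=
    hs.isAlgebraic_field
  exact .of_algebraicIndependent_of_isSeparable hs.1

/-- In characteristic zero a derivation extends to a field extension, with prescribed values at
algebraically independent elements. -/
theorem exists_derivation_extension {K N J : Type*} [Field K] [Field N] [CharZero K] [Algebra K N]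
    (X : J → N) (hX : AlgebraicIndependent K X) (D : Derivation ℤ K K) (v : J → N) :
    ∃ D' : Derivation ℤ N N, (∀ a, D' (algebraMap K N a) = algebraMap K N (D a)) ∧
      ∀ j, D' (X j) = v j := by
  -- `R` is the polynomial ring K[X] inside N. It is formally smooth below N: first localize to its
  -- fraction field, then extend a field of characteristic 0.
  let R := MvPolynomial J K
  let : Algebra R N := (MvPolynomial.aeval X).toRingHom.toAlgebra
  have hinj : Function.Injective (algebraMap R N) := hX
  have : FaithfulSMul R N := (faithfulSMul_iff_algebraMap_injective R N).2 hinj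
  let F := FractionRing R
  let : Algebra F N := FractionRing.liftAlgebra R N
  have : IsScalarTower R F N := FractionRing.isScalarTower_liftAlgebra R N
  have : CharZero F := charZero_of_injective_algebraMap (IsFractionRing.injective R F)
  have : Algebra.FormallySmooth F N := formallySmooth_of_charZero F N
  have : Algebra.FormallySmooth R F := .of_isLocalization (nonZeroDivisors R)
  have : Algebra.FormallySmooth R N := .comp R F N

  -- A derivation of N is the same as a ring section x ↦ x + D'(x)ε of N[ε] → N. Here κ is a ↦ a +
  -- D(a)ε on K, multiplicative by the Leibniz rule.
  let κ : K →+* TrivSqZeroExt N N :=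
    { toFun := fun a => TrivSqZeroExt.inl (algebraMap K N a) +
        TrivSqZeroExt.inr (algebraMap K N (D a))
      map_zero' := by simp
      map_one' := by simp
      map_add' := fun a b => by ext <;> simp [-DualNumber.inr_eq_smul_eps]
      map_mul' := fun a b => by
        ext
        · simp [-DualNumber.inr_eq_smul_eps]
        · simp [-DualNumber.inr_eq_smul_eps, mul_comm] }
  -- R is free on the X_j, so X_j ↦ X_j + v_j ε may be prescribed at will.
  let φ : R →+* TrivSqZeroExt N N := MvPolynomial.eval₂Hom κ
    (fun j => TrivSqZeroExt.inl (X j) + TrivSqZeroExt.inr (v j))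
  let g : TrivSqZeroExt N N →+* N := (TrivSqZeroExt.fstHom N N N).toRingHom
  have hφC : ∀ a, φ (MvPolynomial.C a) = κ a := fun a => MvPolynomial.eval₂_C κ _ a
  have hφX : ∀ j, φ (MvPolynomial.X j) = TrivSqZeroExt.inl (X j) + TrivSqZeroExt.inr (v j) :=
    fun j => MvPolynomial.eval₂_X κ _ j
  have hker : IsNilpotent (RingHom.ker g) := by
    refine ⟨2, (pow_two (RingHom.ker g)).trans ?_⟩
    refine (eq_bot_iff (a := RingHom.ker g * RingHom.ker g)).2 (Ideal.mul_le.2 ?_)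
    intro x hx y hy
    have hx' : x.fst = 0 := hx
    have hy' : y.fst = 0 := hy
    rw [Ideal.mem_bot]
    ext <;> simp [hx', hy']
  obtain ⟨θ, hθ, hθ'⟩ := exists_ringHom_lift_of_formallySmooth φ g
    (fun x => ⟨TrivSqZeroExt.inl x, TrivSqZeroExt.fst_inl N x⟩) hker (RingHom.id N) (by
      intro r
      have : (RingHom.id N).comp (algebraMap R N) = g.comp φ := by
        refine MvPolynomial.ringHom_ext (fun a => ?_) (fun j => ?_)
        · simp only [RingHom.comp_apply, RingHom.id_apply, hφC]
          exact (MvPolynomial.aeval_C X a).trans (by simp [κ, g])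
        · simp only [RingHom.comp_apply, RingHom.id_apply, hφX]
          exact (MvPolynomial.aeval_X X j).trans (by simp [g])
      exact RingHom.congr_fun this r)
  have hfst : ∀ x, (θ x).fst = x := hθ'
  let D' : Derivation ℤ N N := Derivation.mk'
    (AddMonoidHom.toIntLinearMap (AddMonoidHom.mk' (fun x => (θ x).snd) fun x y => by simp))
    (fun x y => by simp [hfst, mul_comm])
  refine ⟨D', fun a => ?_, fun j => ?_⟩
  · have h1 : algebraMap R N (MvPolynomial.C a) = algebraMap K N a := MvPolynomial.aeval_C X a
    have h2 := hθ (MvPolynomial.C a)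
    rw [h1] at h2
    change (θ (algebraMap K N a)).snd = _
    rw [h2, hφC]
    simp [κ, -DualNumber.inr_eq_smul_eps]
  · have h1 : algebraMap R N (MvPolynomial.X j) = X j := MvPolynomial.aeval_X X j
    have h2 := hθ (MvPolynomial.X j)
    rw [h1] at h2
    change (θ (X j)).snd = _
    rw [h2, hφX]
    simp [-DualNumber.inr_eq_smul_eps]

end GenericDerivation

namespace GenericDerivation

/-! ### Solving all requirements in one elementary extension -/

section Step

open Filter

variable {L : FieldLanguage.{u}} {Γ : List (Srt L.Aux)} {χ : Formula L (Srt.field :: Γ)}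
  {M : FieldStructure.{u, w} L}

theorem Tame.nonempty_tuple (hM : Tame χ M) : Nonempty (Tuple M Γ) :=
  ⟨(hM.exists_not_nbhd 1 one_ne_zero).choose⟩

/-- Separation and directedness shrink a neighbourhood away from any finite set of nonzero points; a
finite neighbourhood would thus contain one with no nonzero point at all. -/
theorem Tame.infinite_nbhd (hM : Tame χ M) (c : Tuple M Γ) : {a | Nbhd χ M c a}.Infinite := by
  intro hfin
  have key : ∀ S : Finset M.K, ∃ e : Tuple M Γ, ∀ a, Nbhd χ M e a →
      Nbhd χ M c a ∧ (a ≠ 0 → a ∉ S) := by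
    classical
    intro S
    induction S using Finset.induction_on with
    | empty => exact ⟨c, fun a h => ⟨h, fun _ => Finset.notMem_empty a⟩⟩
    | insert b S _ ih =>
      obtain ⟨e, he⟩ := ih
      by_cases hb : b = 0
      · refine ⟨e, fun a ha => ⟨(he a ha).1, fun h0 => ?_⟩⟩
        rw [Finset.mem_insert, not_or]
        exact ⟨fun h => h0 (h.trans hb), (he a ha).2 h0⟩
      · obtain ⟨d, hd⟩ := hM.exists_not_nbhd b hb
        obtain ⟨e', he'⟩ := hM.directed e d
        refine ⟨e', fun a ha => ⟨(he a (he' a ha).1).1, fun h0 => ?_⟩⟩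
        rw [Finset.mem_insert, not_or]
        exact ⟨fun h => hd (h ▸ (he' a ha).2), (he a (he' a ha).1).2 h0⟩
  obtain ⟨e, he⟩ := key hfin.toFinset
  obtain ⟨a, ha0, ha⟩ := hM.exists_ne_zero e
  exact (he a ha).2 ha0 (hfin.mem_toFinset.2 (he a ha).1)

/-! ### Generic infinitesimal points -/

variable (χ M) in
/-- The filter generated by the sets `χ(M, c)`. -/
def nbhdFilter : Filter M.K := ⨅ c : Tuple M Γ, 𝓟 {a | Nbhd χ M c a}

theorem eventually_nbhdFilter (c : Tuple M Γ) : ∀ᶠ a in nbhdFilter χ M, Nbhd χ M c a :=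
  mem_iInf_of_mem c (mem_principal_self _)

theorem Tame.infinite_of_mem_nbhdFilter (hM : Tame χ M) {s : Set M.K} (hs : s ∈ nbhdFilter χ M) :
    s.Infinite := by
  have := hM.nonempty_tuple
  have hdir : Directed (· ≥ ·) fun c : Tuple M Γ => 𝓟 {a | Nbhd χ M c a} := by
    intro c d
    obtain ⟨e, he⟩ := hM.directed c d
    exact ⟨e, principal_mono.2 fun a ha => (he a ha).1, principal_mono.2 fun a ha => (he a ha).2⟩
  obtain ⟨c, hc⟩ := (mem_iInf_of_directed hdir s).1 hs
  exact (hM.infinite_nbhd c).mono (mem_principal.1 hc)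

variable (χ M) in
/-- The filter of generic infinitesimal families. -/
def genericFilter (J : Type w) : Filter (J → M.K) :=
  Filter.pi (fun _ => nbhdFilter χ M) ⊓
    ⨅ p : {p : MvPolynomial J M.K // p ≠ 0}, 𝓟 {x | MvPolynomial.eval x p.1 ≠ 0}

theorem eventually_genericFilter {J : Type w} (j : J) (c : Tuple M Γ) :
    ∀ᶠ x in genericFilter χ M J, Nbhd χ M c (x j) :=
  (tendsto_eval_pi _ j |>.eventually (eventually_nbhdFilter c)).filter_mono inf_le_left

theorem eventually_genericFilter_eval {J : Type w} {p : MvPolynomial J M.K} (hp : p ≠ 0) :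
    ∀ᶠ x in genericFilter χ M J, MvPolynomial.eval x p ≠ 0 :=
  Filter.Eventually.filter_mono inf_le_right (mem_iInf_of_mem ⟨p, hp⟩ (mem_principal_self _))

/-- A nonzero polynomial over a field does not vanish identically on a box with infinite sides, and
finitely many nonvanishing conditions amount to the nonvanishing of the product. -/
theorem Tame.genericFilter_neBot (hM : Tame χ M) (J : Type w) : (genericFilter χ M J).NeBot := by
  refine inf_neBot_iff.2 fun s hs t ht => ?_
  have hdir : Directed (· ≥ ·) fun p : {p : MvPolynomial J M.K // p ≠ 0} =>
      𝓟 {x | MvPolynomial.eval x p.1 ≠ 0} := by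
    intro p q
    refine ⟨⟨p.1 * q.1, mul_ne_zero p.2 q.2⟩, principal_mono.2 fun x hx => ?_,
      principal_mono.2 fun x hx => ?_⟩
    · exact left_ne_zero_of_mul (b := MvPolynomial.eval x q.1) (by rw [← map_mul]; exact hx)
    · exact right_ne_zero_of_mul (a := MvPolynomial.eval x p.1) (by rw [← map_mul]; exact hx)
  have : Nonempty {p : MvPolynomial J M.K // p ≠ 0} := ⟨⟨1, one_ne_zero⟩⟩
  obtain ⟨p, hp⟩ := (mem_iInf_of_directed hdir t).1 ht
  obtain ⟨S, -, B, hB, hBs⟩ := mem_pi.1 hs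
  by_contra hne
  refine p.2 (MvPolynomial.funext_set B (fun j => hM.infinite_of_mem_nbhdFilter (hB j))
    fun x hx => ?_)
  rw [map_zero]
  by_contra hx'
  exact hne ⟨x, hBs fun j _ => hx j (Set.mem_univ j), mem_principal.1 hp hx'⟩

/-! ### Polynomials and neighbourhoods in an ultrapower, and the one-step extension -/

theorem ultrapower.eval_mk {I : Type w} (U : Ultrafilter I) {σ : Type*} (f : σ → I → M.K)
    (Q : MvPolynomial σ M.K) :
    MvPolynomial.eval (fun i => (ultrapower.mk M U (s := Srt.field) (f i) : (ultrapower M U).K))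
      (MvPolynomial.map (ultrapower.diag M U).ringHom Q) =
    ultrapower.mk M U (s := Srt.field) (fun x => MvPolynomial.eval (fun i => f i x) Q) := by
  let θ : (I → M.K) →+* (ultrapower M U).K := Germ.coeRingHom (U : Filter I)
  have : (MvPolynomial.eval fun i => (θ (f i))).comp
      (MvPolynomial.map (ultrapower.diag M U).ringHom) =
      θ.comp (RingHom.pi fun x => MvPolynomial.eval fun i => f i x) := by
    refine MvPolynomial.ringHom_ext (fun a => ?_) (fun j => ?_)
    · simp only [RingHom.comp_apply, MvPolynomial.map_C, MvPolynomial.eval_C]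
      exact congrArg θ (funext fun x => (MvPolynomial.eval_C a).symm)
    · simp only [RingHom.comp_apply, MvPolynomial.map_X, MvPolynomial.eval_X]
      exact congrArg θ (funext fun x => (MvPolynomial.eval_X (f := fun i => f i x) j).symm)
  exact RingHom.congr_fun this Q

theorem ultrapower.mk_add {I : Type w} (U : Ultrafilter I) (f g : I → M.K) :
    (ultrapower.mk M U (s := Srt.field) (fun x => f x + g x) : (ultrapower M U).K) =
      (ultrapower.mk M U (s := Srt.field) f + ultrapower.mk M U (s := Srt.field) g :
        (ultrapower M U).K) :=
  rfl

theorem ultrapower.nbhd_mk {I : Type w} (U : Ultrafilter I) (c : Tuple M Γ) (f : I → M.K) :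
    Nbhd χ (ultrapower M U) (fun i => (ultrapower.diag M U).toFun _ (c i))
      (ultrapower.mk M U (s := Srt.field) f) ↔ ∀ᶠ x in (U : Filter I), Nbhd χ M c (f x) := by
  have h := Formula.realize_ultrapower (U := U) χ (Fin.cons (α := fun i : Fin (Γ.length + 1) =>
    I → M.carrier ((Srt.field :: Γ).get i)) f (fun i _ => c i))
  refine Iff.trans (iff_of_eq (congrArg (χ.Realize _) (funext fun i => ?_))) (h.trans
    (iff_of_eq (congrArg (fun P => ∀ᶠ x in (U : Filter I), P x) (funext fun x =>
      congrArg (χ.Realize M) (funext fun i => ?_)))))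
  all_goals refine Fin.cases ?_ (fun j => ?_) i <;> rfl

variable (Γ M) in
/-- A regular zero to be approximated by a zero of a differential polynomial. -/
structure Requirement : Type w where
  m : ℕ
  poly : MvPolynomial (Fin (m + 1)) M.K
  pt : Fin (m + 1) → M.K
  isRegularZero : IsRegularZero poly pt
  radius : Tuple M Γ

/-- The coordinate functions on the set of assignments of increments become, modulo an ultrafilter
finer than the generic filter, infinitesimal and algebraically independent over M. The last
increment is then determined by the implicit function clause, and the values of the derivation on
the others are free to be chosen. -/
theorem Tame.exists_step (hM : Tame χ M) (δ : Derivation ℤ M.K M.K) :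
    ∃ (N : FieldStructure.{u, w} L) (e : ElementaryEmbedding M N) (δ' : Derivation ℤ N.K N.K),
      (∀ a, e.ringHom (δ a) = δ' (e.ringHom a)) ∧
      ∀ (m : ℕ) (Q : MvPolynomial (Fin (m + 1)) M.K) (y : Fin (m + 1) → M.K) (c : Tuple M Γ),
        IsRegularZero Q y → ∃ b : N.K,
          IsRegularZero (MvPolynomial.map e.ringHom Q) (fun i => δ'^[i] b) ∧
          ∀ i : Fin (m + 1),
            Nbhd χ N (fun j => e.toFun _ (c j)) (δ'^[i] b - e.ringHom (y i)) := by
  -- One independent variable for each coordinate but the last, for every requirement; distinct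
  -- requirements share no variable, so they cannot interfere.
  let J := Σ r : Requirement Γ M, Fin r.m
  have := hM.genericFilter_neBot J
  let U := Ultrafilter.of (genericFilter χ M J)
  have hU : (U : Filter (J → M.K)) ≤ genericFilter χ M J := Ultrafilter.of_le _
  let N := ultrapower M U
  let e := ultrapower.diag M U
  -- the last coordinate, by the implicit function theorem
  have hT : ∀ r : Requirement Γ M, ∃ T : (J → M.K) → M.K, ∀ᶠ x in (U : Filter (J → M.K)),
      Nbhd χ M r.radius (T x) ∧ IsRegularZero r.poly
        (fun i => r.pt i + Fin.snoc (α := fun _ => M.K) (fun i => x ⟨r, i⟩) (T x) i) := by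
    intro r
    obtain ⟨d, hd⟩ := hM.implicit r.m r.poly r.pt r.isRegularZero r.radius
    -- Where the increments are not small the value 0 is used; this happens only off a set of the
    -- ultrafilter.
    have : ∀ x : J → M.K, ∃ t : M.K, (∀ i, Nbhd χ M d (x ⟨r, i⟩)) →
        Nbhd χ M r.radius t ∧ IsRegularZero r.poly
          (fun i => r.pt i + Fin.snoc (α := fun _ => M.K) (fun i => x ⟨r, i⟩) t i) := by
      intro x
      by_cases hx : ∀ i, Nbhd χ M d (x ⟨r, i⟩)
      · obtain ⟨t, ht⟩ := hd _ hx
        exact ⟨t, fun _ => ht⟩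
      · exact ⟨0, fun h => (hx h).elim⟩
    choose T hT using this
    refine ⟨T, ?_⟩
    filter_upwards [eventually_all.2 fun i : Fin r.m =>
      (eventually_genericFilter (χ := χ) (⟨r, i⟩ : J) d).filter_mono hU] with x hx
    exact hT x hx
  choose T hT using hT
  let X : J → N.K := fun j => ultrapower.mk M U (s := Srt.field) (fun x => x j)
  let Z : ∀ r : Requirement Γ M, Fin (r.m + 1) → (J → M.K) → M.K := fun r i x =>
    Fin.snoc (α := fun _ => M.K) (fun i => x ⟨r, i⟩) (T r x) i
  let B : ∀ r : Requirement Γ M, Fin (r.m + 1) → N.K := fun r i =>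
    ultrapower.mk M U (s := Srt.field) (fun x => r.pt i + Z r i x)
  have hB : ∀ r i, B r i = e.ringHom (r.pt i) + ultrapower.mk M U (s := Srt.field) (Z r i) :=
    fun r i => ultrapower.mk_add U _ _
  have hZ : ∀ r (i : Fin r.m), Z r i.castSucc = fun x => x ⟨r, i⟩ := fun r i =>
    funext fun x => Fin.snoc_castSucc (α := fun _ => M.K) _ _ _
  let _ : Algebra M.K N.K := e.ringHom.toAlgebra
  have : CharZero M.K := charZero_of_inj_zero fun n hn => by
    cases n with
    | zero => rfl
    | succ n => exact (hM.natCast_ne_zero n hn).elim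
  -- A relation p(X) = 0 would mean p(x) = 0 for almost all x, against the nonvanishing of p built
  -- into the generic filter.
  have hX : AlgebraicIndependent M.K X := by
    refine (injective_iff_map_eq_zero _).2 fun p hp => ?_
    by_contra hp0
    have h1 : MvPolynomial.eval X (MvPolynomial.map e.ringHom p) = 0 := by
      rw [← hp, MvPolynomial.aeval_def, MvPolynomial.eval₂_eq_eval_map]
      rfl
    have h2 := (ultrapower.eval_mk U (fun j x => x j) p).symm.trans h1
    obtain ⟨x, hx, hx'⟩ := ((ultrapower.mk_eq_mk.1 h2).and
      ((eventually_genericFilter_eval (χ := χ) hp0).filter_mono hU)).exists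
    exact hx' hx
  -- With B_i = y_i + X_i, this is the value forced on X_i by δ'(B_i) = B_{i+1}. For the top index
  -- it involves the solved last increment, which is harmless since prescribed values are arbitrary
  -- elements of N.
  obtain ⟨δ', hδ', hδX⟩ := exists_derivation_extension X hX δ
    (fun j => B j.1 j.2.succ - e.ringHom (δ (j.1.pt j.2.castSucc)))
  refine ⟨N, e, δ', fun a => (hδ' a).symm, fun m Q y c hy => ?_⟩
  let r : Requirement Γ M := ⟨m, Q, y, hy, c⟩
  have hstep : ∀ i : Fin m, δ' (B r i.castSucc) = B r i.succ := by
    intro i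
    have h1 : δ' (e.ringHom (r.pt i.castSucc)) = e.ringHom (δ (r.pt i.castSucc)) := hδ' _
    have h2 : δ' (ultrapower.mk M U (s := Srt.field) (Z r i.castSucc)) =
        B r i.succ - e.ringHom (δ (r.pt i.castSucc)) := by
      rw [hZ]
      exact hδX ⟨r, i⟩
    rw [hB, map_add, h1, h2]
    abel
  have hiter : ∀ i : Fin (m + 1), δ'^[i] (B r 0) = B r i := by
    intro i
    induction i using Fin.induction with
    | zero => rfl
    | succ i ih =>
      rw [← hstep, ← ih, Fin.val_succ, Function.iterate_succ_apply']
      rfl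
  refine ⟨B r 0, ?_, fun i => ?_⟩
  · have hfun : (fun i : Fin (m + 1) => δ'^[i] (B r 0)) = B r := funext hiter
    rw [hfun]
    constructor
    · refine (ultrapower.eval_mk U (fun i x => r.pt i + Z r i x) Q).trans ?_
      exact ultrapower.mk_eq_mk.2 ((hT r).mono fun x hx => hx.2.1)
    · rw [MvPolynomial.pderiv_map]
      intro h0
      have h1 := (ultrapower.eval_mk U (fun i x => r.pt i + Z r i x) _).symm.trans h0
      obtain ⟨x, hx, hx'⟩ := ((ultrapower.mk_eq_mk.1 h1).and (hT r)).exists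
      exact hx'.2.2 hx
  · rw [hiter, hB]
    have : e.ringHom (r.pt i) + ultrapower.mk M U (s := Srt.field) (Z r i) - e.ringHom (y i) =
        (ultrapower.mk M U (s := Srt.field) (Z r i) : N.K) := add_sub_cancel_left _ _
    rw [this]
    refine (ultrapower.nbhd_mk U c _).2 ?_
    induction i using Fin.lastCases with
    | last =>
      filter_upwards [hT r] with x hx
      have : Z r (Fin.last m) x = T r x := Fin.snoc_last (α := fun _ => M.K) _ _
      rw [this]
      exact hx.1
    | cast i =>
      rw [hZ r i]
      exact (eventually_genericFilter (⟨r, i⟩ : J) c).filter_mono hU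

end Step
end GenericDerivation

namespace GenericDerivation

/-! ### Existence of generic extensions -/

theorem IsRegularZero.map_iff {K K' : Type*} [Field K] [Field K'] (f : K →+* K') {m : ℕ}
    {Q : MvPolynomial (Fin (m + 1)) K} {y : Fin (m + 1) → K} :
    IsRegularZero (MvPolynomial.map f Q) (fun i => f (y i)) ↔ IsRegularZero Q y := by
  have h : ∀ R : MvPolynomial (Fin (m + 1)) K,
      MvPolynomial.eval (fun i => f (y i)) (MvPolynomial.map f R) = f (MvPolynomial.eval y R) :=
    fun R => by rw [MvPolynomial.eval_map]; exact (MvPolynomial.eval₂_comp f y R).symm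
  rw [IsRegularZero, MvPolynomial.pderiv_map, h, h, IsRegularZero, map_eq_zero, map_ne_zero]

/-- All variables of `P` have index at most its order m, so nothing is killed by `killCompl`. -/
theorem DiffPoly.rename_star {K : Type*} [Field K] {P : DiffPoly K} {m : ℕ}
    (hP : P.ord = (m : WithBot ℕ)) : MvPolynomial.rename Fin.val (P.star m) = P := by
  have hsub : (P.vars : Set ℕ) ⊆ Set.range (Fin.val : Fin (m + 1) → ℕ) := by
    intro i hi
    have := Finset.le_max (Finset.mem_coe.1 hi)
    rw [show P.vars.max = (m : WithBot ℕ) from hP] at this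
    exact ⟨⟨i, Nat.lt_succ_of_le (WithBot.coe_le_coe.1 this)⟩, rfl⟩
  obtain ⟨q, rfl⟩ := MvPolynomial.exists_rename_eq_of_vars_subset_range P _ Fin.val_injective hsub
  rw [DiffPoly.star, MvPolynomial.killCompl_rename_app]

theorem DiffPoly.separant_eq_rename {K : Type*} [Field K] {P : DiffPoly K} {m : ℕ}
    (hP : P.ord = (m : WithBot ℕ)) :
    P.separant m = MvPolynomial.rename Fin.val (MvPolynomial.pderiv (Fin.last m) (P.star m)) := by
  rw [← MvPolynomial.pderiv_rename Fin.val_injective, DiffPoly.rename_star hP]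
  rfl

theorem DiffPoly.star_separant {K : Type*} [Field K] {P : DiffPoly K} {m : ℕ}
    (hP : P.ord = (m : WithBot ℕ)) :
    (P.separant m).star m = MvPolynomial.pderiv (Fin.last m) (P.star m) := by
  rw [DiffPoly.separant_eq_rename hP, DiffPoly.star, MvPolynomial.killCompl_rename_app]

theorem DiffPoly.regular_evalAt_iff {K : Type*} [Field K] {P : DiffPoly K} {m : ℕ}
    (hP : P.ord = (m : WithBot ℕ)) (δ : Derivation ℤ K K) (b : K) :
    P.evalAt δ b = 0 ∧ (P.separant m).evalAt δ b ≠ 0 ↔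
      IsRegularZero (P.star m) (fun i : Fin (m + 1) => δ^[i] b) := by
  have h1 : P.evalAt δ b = MvPolynomial.eval (fun i : Fin (m + 1) => δ^[i] b) (P.star m) := by
    conv_lhs => rw [← DiffPoly.rename_star hP]
    exact MvPolynomial.eval_rename _ _ _
  have h2 : (P.separant m).evalAt δ b = MvPolynomial.eval (fun i : Fin (m + 1) => δ^[i] b)
      (MvPolynomial.pderiv (Fin.last m) (P.star m)) := by
    rw [DiffPoly.separant_eq_rename hP]
    exact MvPolynomial.eval_rename _ _ _
  rw [h1, h2, IsRegularZero]

/-! ### The scheme (DL) in the limit of a chain -/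

section Limit

variable {L : FieldLanguage.{u}} (C : ElementaryChain.{u, w} L)

/-- The form "for all later stages" lets several objects be lifted to a common stage. -/
theorem ElementaryChain.exists_lift (a : C.lim.K) :
    ∃ k₀, ∀ k, k₀ ≤ k → ∃ b : (C.obj k).K, (C.toLim k).ringHom b = a := by
  obtain ⟨i, b, rfl⟩ := C.exists_rep (s := Srt.field) a
  exact ⟨i, fun k hk => ⟨(C.map hk).ringHom b, C.ι_map hk b⟩⟩

theorem ElementaryChain.exists_lift_family {n : ℕ} (y : Fin n → C.lim.K) :
    ∃ k₀, ∀ k, k₀ ≤ k → ∃ b : Fin n → (C.obj k).K, (fun i => (C.toLim k).ringHom (b i)) = y := by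
  choose k₀ hk₀ using fun i => C.exists_lift (y i)
  refine ⟨∑ i, k₀ i, fun k hk => ?_⟩
  choose b hb using fun i => hk₀ i k
    ((Finset.single_le_sum (fun _ _ => Nat.zero_le _) (Finset.mem_univ i)).trans hk)
  exact ⟨b, funext hb⟩

theorem ElementaryChain.exists_lift_mvPolynomial {σ : Type*} (Q : MvPolynomial σ C.lim.K) :
    ∃ k₀, ∀ k, k₀ ≤ k → ∃ R : MvPolynomial σ (C.obj k).K,
      MvPolynomial.map (C.toLim k).ringHom R = Q := by
  induction Q using MvPolynomial.induction_on with
  | C a =>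
    obtain ⟨k₀, h⟩ := C.exists_lift a
    refine ⟨k₀, fun k hk => ?_⟩
    obtain ⟨b, rfl⟩ := h k hk
    exact ⟨MvPolynomial.C b, MvPolynomial.map_C _ _⟩
  | add p q hp hq =>
    obtain ⟨k₁, h₁⟩ := hp
    obtain ⟨k₂, h₂⟩ := hq
    refine ⟨max k₁ k₂, fun k hk => ?_⟩
    obtain ⟨R₁, hR₁⟩ := h₁ k ((le_max_left _ _).trans hk)
    obtain ⟨R₂, hR₂⟩ := h₂ k ((le_max_right _ _).trans hk)
    exact ⟨R₁ + R₂, by rw [map_add, hR₁, hR₂]⟩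
  | mul_X p i hp =>
    obtain ⟨k₀, h⟩ := hp
    refine ⟨k₀, fun k hk => ?_⟩
    obtain ⟨R, hR⟩ := h k hk
    exact ⟨R * MvPolynomial.X i, by rw [map_mul, hR, MvPolynomial.map_X]⟩

variable {C} {Γ : List (Srt L.Aux)} {χ : Formula L (Srt.field :: Γ)}

/-- An instance of (DL) involves finitely many parameters, so it comes from some stage k; its
solution at stage k + 1 remains one in the limit. -/
theorem ElementaryChain.satisfiesDL (δ : ∀ k, Derivation ℤ (C.obj k).K (C.obj k).K)
    (h : ∀ (k m : ℕ) (Q : MvPolynomial (Fin (m + 1)) (C.obj k).K) (y : Fin (m + 1) → (C.obj k).K)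
      (c : Tuple (C.obj k) Γ), IsRegularZero Q y → ∃ b : (C.obj (k + 1)).K,
        IsRegularZero (MvPolynomial.map (C.map (Nat.le_succ k)).ringHom Q)
          (fun i => (δ (k + 1))^[i] b) ∧
        ∀ i : Fin (m + 1), Nbhd χ (C.obj (k + 1))
          (fun j => (C.map (Nat.le_succ k)).toFun _ (c j))
          ((δ (k + 1))^[i] b - (C.map (Nat.le_succ k)).ringHom (y i)))
    (D : Derivation ℤ C.lim.K C.lim.K)
    (hD : ∀ k (a : (C.obj k).K), D ((C.toLim k).ringHom a) = (C.toLim k).ringHom (δ k a)) :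
    SatisfiesDL χ C.lim D := by
  intro m P _ hP z y h1 h2
  rw [DiffPoly.star_separant hP] at h2
  obtain ⟨k₁, hk₁⟩ := C.exists_lift_mvPolynomial (P.star m)
  obtain ⟨k₂, hk₂⟩ := C.exists_lift_family y
  obtain ⟨k, hk, c, rfl⟩ := C.exists_common_rep z (max k₁ k₂)
  obtain ⟨Q, hQ⟩ := hk₁ k ((le_max_left _ _).trans hk)
  obtain ⟨y, rfl⟩ := hk₂ k ((le_max_right _ _).trans hk)
  have hreg : IsRegularZero Q y := by
    rw [← IsRegularZero.map_iff (C.toLim k).ringHom, hQ]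
    exact ⟨h1, h2⟩
  obtain ⟨b, hb, hb'⟩ := h k m Q y c hreg
  have hcomp : ∀ a, (C.toLim (k + 1)).ringHom ((C.map (Nat.le_succ k)).ringHom a) =
      (C.toLim k).ringHom a := fun a => C.ι_map (Nat.le_succ k) a
  have hiter : ∀ i : ℕ, D^[i] ((C.toLim (k + 1)).ringHom b) =
      (C.toLim (k + 1)).ringHom ((δ (k + 1))^[i] b) := by
    intro i
    induction i with
    | zero => rfl
    | succ i ih => rw [Function.iterate_succ_apply', Function.iterate_succ_apply', ih, hD]
  refine ⟨(C.toLim (k + 1)).ringHom b, ?_⟩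
  rw [← and_assoc, DiffPoly.regular_evalAt_iff hP]
  constructor
  · rw [← IsRegularZero.map_iff (C.toLim (k + 1)).ringHom, MvPolynomial.map_map] at hb
    have : (C.toLim (k + 1)).ringHom.comp (C.map (Nat.le_succ k)).ringHom =
        (C.toLim k).ringHom := RingHom.ext hcomp
    rw [this, hQ] at hb
    simpa only [hiter] using hb
  · intro i
    have := ((C.toLim (k + 1)).nbhd_iff χ _ _).2 (hb' i)
    rw [map_sub, hcomp, ← hiter] at this
    have hc : (fun j => (C.toLim (k + 1)).toFun _
        ((C.map (Nat.le_succ k)).toFun _ (c j))) = fun j => C.ι k (c j) :=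
      funext fun j => C.ι_map (Nat.le_succ k) (c j)
    rw [hc] at this
    exact this

end Limit

/-! ### Iterating the one-step extension -/

section Main

variable {L : FieldLanguage.{u}} {Γ : List (Srt L.Aux)} {χ : Formula L (Srt.field :: Γ)}

variable (χ) in
/-- Tame structures with a derivation. -/
structure DiffTame : Type (max u (w + 1)) where
  str : FieldStructure.{u, w} L
  δ : Derivation ℤ str.K str.K
  tame : Tame χ str

/-- `B` is an extension of `A` in which the requirements of `A` are met. -/
structure DiffTame.Extension (A B : DiffTame.{u, w} χ) where
  emb : ElementaryEmbedding A.str B.str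
  map_δ : ∀ a, emb.ringHom (A.δ a) = B.δ (emb.ringHom a)
  solves : ∀ (m : ℕ) (Q : MvPolynomial (Fin (m + 1)) A.str.K) (y : Fin (m + 1) → A.str.K)
    (c : Tuple A.str Γ), IsRegularZero Q y → ∃ b : B.str.K,
      IsRegularZero (MvPolynomial.map emb.ringHom Q) (fun i => B.δ^[i] b) ∧
      ∀ i : Fin (m + 1), Nbhd χ B.str (fun j => emb.toFun _ (c j))
        (B.δ^[i] b - emb.ringHom (y i))

theorem DiffTame.exists_extension (A : DiffTame.{u, w} χ) :
    ∃ B : DiffTame.{u, w} χ, Nonempty (A.Extension B) := by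
  obtain ⟨N, e, δ', h, h'⟩ := A.tame.exists_step A.δ
  exact ⟨⟨N, δ', A.tame.of_elemEquiv e.elemEquiv⟩, ⟨⟨e, h, h'⟩⟩⟩

/-- Iterated extensions. -/
noncomputable def DiffTame.iterate (A : DiffTame.{u, w} χ) : ℕ → DiffTame.{u, w} χ
  | 0 => A
  | n + 1 => (A.iterate n).exists_extension.choose

/-- The extension of each iterate by the next one. -/
noncomputable def DiffTame.iterateExtension (A : DiffTame.{u, w} χ) (n : ℕ) :
    (A.iterate n).Extension (A.iterate (n + 1)) :=
  (A.iterate n).exists_extension.choose_spec.some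

/-- Each step solves the requirements of its predecessor but creates new parameters; after ω steps
every requirement has been met. -/
theorem Tame.exists_generic_extension {M : FieldStructure.{u, w} L} (hM : Tame χ M)
    (δ : Derivation ℤ M.K M.K) : ∃ (N : FieldStructure.{u, w} L) (D : Derivation ℤ N.K N.K)
      (e : ElementaryEmbedding M N), (∀ a, e.ringHom (δ a) = D (e.ringHom a)) ∧
        SatisfiesDL χ N D := by
  let A : DiffTame χ := ⟨M, δ, hM⟩
  let C := ElementaryChain.ofSteps (fun n => (A.iterate n).str)
    (fun n => (A.iterateExtension n).emb)
  let d : ∀ k, Derivation ℤ (C.obj k).K (C.obj k).K := fun k => (A.iterate k).δ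
  have hsucc : ∀ n s a, (C.map (Nat.le_succ n)).toFun s a =
      (A.iterateExtension n).emb.toFun s a := ElementaryChain.ofSteps_map_succ _ _
  have hring : ∀ n, (C.map (Nat.le_succ n)).ringHom = (A.iterateExtension n).emb.ringHom :=
    fun n => RingHom.ext (hsucc n Srt.field)
  have hd : ∀ {i j : ℕ} (h : i ≤ j) (a : (C.obj i).K),
      (C.map h).ringHom (d i a) = d j ((C.map h).ringHom a) := by
    intro i j h a
    induction j, h using Nat.le_induction with
    | base =>
      exact (C.map_self i _ _).trans (congrArg (d i) (C.map_self i Srt.field a).symm)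
    | succ j h ih =>
      have hcomp : ∀ b, (C.map (h.trans (Nat.le_succ j))).ringHom b =
          (C.map (Nat.le_succ j)).ringHom ((C.map h).ringHom b) := fun b =>
        (C.map_map h (Nat.le_succ j) _ b).symm
      rw [hcomp, hcomp, ih, hring]
      exact (A.iterateExtension j).map_δ _
  obtain ⟨D, hD⟩ := C.exists_derivation_lim d hd
  refine ⟨C.lim, D, C.toLim 0, fun a => (hD 0 a).symm,
    ElementaryChain.satisfiesDL d (fun k m Q y c hy => ?_) D hD⟩
  obtain ⟨b, hb, hb'⟩ := (A.iterateExtension k).solves m Q y c hy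
  refine ⟨b, by rw [hring]; exact hb, fun i => ?_⟩
  rw [hring]
  have hc : (fun j => (C.map (Nat.le_succ k)).toFun _ (c j)) =
      fun j => (A.iterateExtension k).emb.toFun _ (c j) := funext fun j => hsucc k _ _
  rw [hc]
  exact hb' i

/-- The complete theory of a tame structure has generic extensions. -/
theorem Tame.hasGenericExtensions {M₀ : FieldStructure.{u, w} L} (h : Tame χ M₀) :
    HasGenericExtensions.{u, w} (Th M₀) χ := by
  intro M δ hM
  have hE := elemEquiv_of_isModel hM.1
  obtain ⟨N, D, e, hδ, hDL⟩ := (h.of_elemEquiv hE).exists_generic_extension δ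
  refine ⟨N, D, e, hδ, ⟨isModel_of_elemEquiv fun φ => (hE φ).trans (e.elemEquiv φ),
    fun c => ?_⟩, hDL⟩
  have := hδ (M.const c)
  rw [hM.2 c, map_zero] at this
  rw [← e.map_const]
  exact this.symm

/-- The zero derivation kills all constants, so it turns any model of T into a model of T_δ. -/
theorem HasGenericExtensions.isConsistent {T : Theory L} {M₀ : FieldStructure.{u, w} L}
    (h : HasGenericExtensions.{u, w} T χ) (hM₀ : IsModel T M₀) :
    IsConsistentTDeltaStar.{u, w} T χ := by
  obtain ⟨N, D, -, -, hN⟩ := h M₀ 0 ⟨hM₀, fun _ => rfl⟩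
  exact ⟨N, D, hN⟩

end Main
end GenericDerivation

namespace GenericDerivation

/-! ### The implicit function theorem for topological fields -/

/-- Simple zeros of polynomials in one variable depend continuously on the coefficients. -/
def HasStableSimpleRoots (K : Type*) [Field K] [TopologicalSpace K] : Prop :=
  ∀ (m N : ℕ) (f : (Fin m → K) → Polynomial K), (∀ x, (f x).natDegree ≤ N) →
    (∀ k, Continuous fun x => (f x).coeff k) → (f 0).coeff 0 = 0 → (f 0).coeff 1 ≠ 0 →
    ∀ U ∈ 𝓝 (0 : K), ∀ᶠ x in 𝓝 (0 : Fin m → K), ∃ t ∈ U, (f x).eval t = 0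

section Implicit

variable {K : Type*} [Field K]

/-- The chain rule; it identifies the linear coefficient of the increment polynomial with the last
partial derivative. -/
theorem derivative_aeval {σ : Type*} [Fintype σ] (g : σ → Polynomial K) (Q : MvPolynomial σ K) :
    Polynomial.derivative (MvPolynomial.aeval g Q) =
      ∑ i, MvPolynomial.aeval g (MvPolynomial.pderiv i Q) * Polynomial.derivative (g i) := by
  classical
  induction Q using MvPolynomial.induction_on with
  | C a => simp [Polynomial.algebraMap_eq]
  | add p q hp hq => simp [hp, hq, add_mul, Finset.sum_add_distrib]
  | mul_X p j hp =>
    simp only [map_mul, MvPolynomial.aeval_X, Polynomial.derivative_mul, hp, Derivation.leibniz,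
      MvPolynomial.pderiv_X, smul_eq_mul, map_add, add_mul, Finset.sum_add_distrib]
    rw [Finset.sum_eq_single (f := fun i => MvPolynomial.aeval g p *
        MvPolynomial.aeval g (Pi.single (M := fun _ => MvPolynomial σ K) i 1 j) *
          Polynomial.derivative (g i)) j
      (fun i _ hi => by rw [Pi.single_eq_of_ne hi.symm]; simp)
      (fun h => (h (Finset.mem_univ j)).elim)]
    rw [Pi.single_eq_same, Finset.sum_mul, map_one, mul_one, add_comm]
    refine congrArg₂ _ rfl (Finset.sum_congr rfl fun i _ => ?_)
    ring

/-- The polynomial in the increment of the last variable, for a given increment of the others. -/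
noncomputable def incrementPolynomial {m : ℕ} (Q : MvPolynomial (Fin (m + 1)) K)
    (y : Fin (m + 1) → K) (x : Fin m → K) : Polynomial K :=
  MvPolynomial.aeval (fun i => Polynomial.C (y i) +
    Fin.snoc (α := fun _ => Polynomial K) (fun i => Polynomial.C (x i)) Polynomial.X i) Q

theorem eval_incrementPolynomial {m : ℕ} (Q : MvPolynomial (Fin (m + 1)) K)
    (y : Fin (m + 1) → K) (x : Fin m → K) (t : K) : (incrementPolynomial Q y x).eval t =
      MvPolynomial.eval (fun i => y i + Fin.snoc (α := fun _ => K) x t i) Q := by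
  induction Q using MvPolynomial.induction_on with
  | C a => simp [incrementPolynomial]
  | add p q hp hq =>
    rw [map_add, ← hp, ← hq, incrementPolynomial, map_add, Polynomial.eval_add]
    rfl
  | mul_X p i hp =>
    rw [map_mul, ← hp, incrementPolynomial, map_mul, Polynomial.eval_mul, MvPolynomial.aeval_X,
      MvPolynomial.eval_X]
    refine congrArg₂ _ rfl ?_
    induction i using Fin.lastCases <;> simp

theorem natDegree_incrementPolynomial_le {m : ℕ} (Q : MvPolynomial (Fin (m + 1)) K)
    (y : Fin (m + 1) → K) (x : Fin m → K) :
    (incrementPolynomial Q y x).natDegree ≤ Q.totalDegree * 1 := by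
  refine MvPolynomial.aeval_natDegree_le Q le_rfl _ fun i => ?_
  induction i using Fin.lastCases with
  | last => simp
  | cast i => rw [Fin.snoc_castSucc, ← Polynomial.C_add, Polynomial.natDegree_C]; exact Nat.zero_le _

theorem continuous_coeff_incrementPolynomial [TopologicalSpace K] [IsTopologicalRing K] {m : ℕ}
    (Q : MvPolynomial (Fin (m + 1)) K) (y : Fin (m + 1) → K) (k : ℕ) :
    Continuous fun x => (incrementPolynomial Q y x).coeff k := by
  induction Q using MvPolynomial.induction_on generalizing k with
  | C a =>
    simp only [incrementPolynomial, MvPolynomial.aeval_C]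
    exact continuous_const
  | add p q hp hq =>
    simp only [incrementPolynomial, map_add, Polynomial.coeff_add]
    exact (hp k).add (hq k)
  | mul_X p i hp =>
    simp only [incrementPolynomial, map_mul, MvPolynomial.aeval_X, mul_add, Polynomial.coeff_add,
      Polynomial.coeff_mul_C]
    refine ((hp k).mul continuous_const).add ?_
    induction i using Fin.lastCases with
    | last =>
      simp only [Fin.snoc_last]
      cases k with
      | zero => simpa only [Polynomial.mul_coeff_zero, Polynomial.coeff_X_zero, mul_zero] using
          continuous_const
      | succ k => simpa only [Polynomial.coeff_mul_X, incrementPolynomial] using hp k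
    | cast i =>
      simp only [Fin.snoc_castSucc, Polynomial.coeff_mul_C]
      exact (hp k).mul (continuous_apply i)

theorem coeff_one_incrementPolynomial {m : ℕ} (Q : MvPolynomial (Fin (m + 1)) K)
    (y : Fin (m + 1) → K) : (incrementPolynomial Q y 0).coeff 1 =
      MvPolynomial.eval y (MvPolynomial.pderiv (Fin.last m) Q) := by
  have h1 : (incrementPolynomial Q y 0).coeff 1 =
      (Polynomial.derivative (incrementPolynomial Q y 0)).eval 0 := by
    rw [← Polynomial.coeff_zero_eq_eval_zero, Polynomial.coeff_derivative]
    simp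
  have h2 := eval_incrementPolynomial (MvPolynomial.pderiv (Fin.last m) Q) y 0 0
  have h3 : (fun i => y i + Fin.snoc (α := fun _ => K) (0 : Fin m → K) 0 i) = y := by
    funext i
    induction i using Fin.lastCases <;> simp
  rw [h3] at h2
  rw [h1, ← h2, incrementPolynomial, derivative_aeval, Fin.sum_univ_castSucc]
  simp [incrementPolynomial]

/-- As a polynomial in the last increment, Q has bounded degree, coefficients continuous in the
other increments, and a simple root 0 when these vanish. -/
theorem HasStableSimpleRoots.implicit [TopologicalSpace K] [IsTopologicalRing K] [T1Space K]
    (h : HasStableSimpleRoots K) {m : ℕ} {Q : MvPolynomial (Fin (m + 1)) K}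
    {y : Fin (m + 1) → K} (hy : IsRegularZero Q y) {U : Set K} (hU : U ∈ 𝓝 (0 : K)) :
    ∀ᶠ x in 𝓝 (0 : Fin m → K), ∃ t ∈ U,
      IsRegularZero Q (fun i => y i + Fin.snoc (α := fun _ => K) x t i) := by
  have h3 : (fun i => y i + Fin.snoc (α := fun _ => K) (0 : Fin m → K) 0 i) = y := by
    funext i
    induction i using Fin.lastCases <;> simp
  have hcont : Continuous fun z : (Fin m → K) × K => MvPolynomial.eval
      (fun i => y i + Fin.snoc (α := fun _ => K) z.1 z.2 i)
      (MvPolynomial.pderiv (Fin.last m) Q) := by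
    refine (MvPolynomial.continuous_eval _).comp (continuous_pi fun i => continuous_const.add ?_)
    induction i using Fin.lastCases with
    | last => simpa using continuous_snd
    | cast i =>
      simp only [Fin.snoc_castSucc]
      exact (continuous_apply i).comp continuous_fst
  have hne : ∀ᶠ z in 𝓝 ((0 : Fin m → K), (0 : K)), MvPolynomial.eval
      (fun i => y i + Fin.snoc (α := fun _ => K) z.1 z.2 i)
      (MvPolynomial.pderiv (Fin.last m) Q) ≠ 0 :=
    hcont.continuousAt.eventually_ne (by simpa only [h3] using hy.2)
  rw [nhds_prod_eq] at hne
  obtain ⟨P, hP, R, hR, hPR⟩ := Filter.eventually_prod_iff.1 hne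
  -- The root is sought in U intersected with `R`, the neighbourhood on which the separant stays
  -- nonzero, so that the new zero is again regular.
  have hroot := h m _ (incrementPolynomial Q y) (natDegree_incrementPolynomial_le Q y)
    (continuous_coeff_incrementPolynomial Q y)
    (by rw [Polynomial.coeff_zero_eq_eval_zero, eval_incrementPolynomial, h3]; exact hy.1)
    (by rw [coeff_one_incrementPolynomial]; exact hy.2) (U ∩ {t | R t})
    (Filter.inter_mem hU hR)
  filter_upwards [hroot, hP] with x hx hPx
  obtain ⟨t, ht, ht0⟩ := hx
  exact ⟨t, ht.1, (eval_incrementPolynomial Q y x t).symm.trans ht0, hPR hPx ht.2⟩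

end Implicit

/-- Non-discreteness enters through its first-order form `hnd`, which can be transferred from
another structure when it is known only there. -/
theorem tame_of_definesTopology {L : FieldLanguage.{u}} {Γ : List (Srt L.Aux)}
    {χ : Formula L (Srt.field :: Γ)} {M : FieldStructure.{u, w} L} (τ : TopologicalSpace M.K)
    [CharZero M.K] [IsTopologicalRing M.K] [T2Space M.K]
    (hnd : ∀ c : Tuple M Γ, ∃ a : M.K, a ≠ 0 ∧ Nbhd χ M c a) (hτ : DefinesTopology χ M τ)
    (hroot : HasStableSimpleRoots M.K) : Tame χ M where
  natCast_ne_zero n := Nat.cast_ne_zero.2 n.succ_ne_zero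
  exists_ne_zero := hnd
  exists_not_nbhd a ha := by
    obtain ⟨c, -, hc⟩ := hτ.mem_iff.1 (isOpen_compl_singleton.mem_nhds (show (0 : M.K) ∈ {a}ᶜ from
      fun h => ha (Eq.symm h)))
    exact ⟨c, fun h => hc h rfl⟩
  directed c d := by
    obtain ⟨e, -, he⟩ := hτ.mem_iff.1 (Filter.inter_mem (hτ.mem_of_mem (i := c) trivial)
      (hτ.mem_of_mem (i := d) trivial))
    exact ⟨e, fun a ha => he ha⟩
  implicit m Q y hy c := by
    have h := hroot.implicit hy (hτ.mem_of_mem (i := c) trivial)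
    rw [nhds_pi, Filter.eventually_iff, Filter.mem_pi] at h
    obtain ⟨S, -, t, ht, hS⟩ := h
    -- There are finitely many coordinates, so one radius serves for all.
    have : (⋂ i, t i) ∈ 𝓝 (0 : M.K) := Filter.iInter_mem.2 ht
    obtain ⟨d, -, hd⟩ := hτ.mem_iff.1 this
    exact ⟨d, fun x hx => hS fun i _ => Set.mem_iInter.1 (hd (hx i)) i⟩

/-- A basic neighbourhood with no nonzero element would isolate 0 and, by translation, every point.
-/
theorem DefinesTopology.exists_ne_zero {L : FieldLanguage.{u}} {Γ : List (Srt L.Aux)}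
    {χ : Formula L (Srt.field :: Γ)} {M : FieldStructure.{u, w} L} {τ : TopologicalSpace M.K}
    [IsTopologicalRing M.K] (hτ : DefinesTopology χ M τ) (hnd : ¬ DiscreteTopology M.K)
    (c : Tuple M Γ) : ∃ a : M.K, a ≠ 0 ∧ Nbhd χ M c a := by
  by_contra! hc
  refine hnd (discreteTopology_of_isOpen_singleton_zero ?_)
  refine isOpen_singleton_iff_nhds_eq_pure _ |>.2 (le_antisymm ?_ (pure_le_nhds _))
  refine Filter.le_pure_iff.2 (Filter.mem_of_superset (hτ.mem_of_mem (i := c) trivial) ?_)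
  intro a ha
  by_contra h0
  exact hc a h0 ha

/-- The root condition concerns the topology alone, so one verification covers every formula
defining it. -/
theorem exampleClaim_of_hasStableSimpleRoots {L : FieldLanguage.{u}} (M : FieldStructure.{u, w} L)
    (τ : TopologicalSpace M.K) [CharZero M.K] [IsTopologicalDivisionRing M.K] [T2Space M.K]
    (hnd : ¬ DiscreteTopology M.K) (hroot : HasStableSimpleRoots M.K)
    (hdef : ∃ (Γ : List (Srt L.Aux)) (χ : Formula L (Srt.field :: Γ)), DefinesTopology χ M τ) :
    ExampleClaim M τ := by
  refine ⟨hdef, fun Γ χ hχ => ?_⟩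
  have hgen := (tame_of_definesTopology τ (hχ.exists_ne_zero hnd) hχ hroot).hasGenericExtensions
  exact ⟨⟨M, τ, inferInstance, rfl, inferInstance, inferInstance, hnd, hχ⟩, hgen,
    hgen.isConsistent (M₀ := M) fun _ h => h⟩

end GenericDerivation

namespace GenericDerivation

/-! ### Henselian valuations -/

section Valuation

variable {K : Type*} [Field K] (A : ValuationSubring K)

/-- Radii in the value group are replaced by values of nonzero elements, which can serve as
parameters of a formula. -/
theorem hasBasis_nhds_zero_valuationTopology :
    (@nhds K (valuationTopology A) 0).HasBasis (fun z : K => z ≠ 0)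
      (fun z => {x | A.valuation x < A.valuation z}) := by
  let _ := Valued.mk' A.valuation
  refine ⟨fun s => ?_⟩
  refine (Valued.mem_nhds_zero (R := K)).trans ⟨?_, ?_⟩
  · rintro ⟨γ, hγ⟩
    obtain ⟨z, hz⟩ := A.valuation_surjective (MonoidWithZeroHom.ValueGroup₀.embedding γ.1)
    refine ⟨z, fun h0 => ?_, fun x hx => hγ ?_⟩
    · rw [h0, map_zero] at hz
      exact γ.ne_zero (MonoidWithZeroHom.ValueGroup₀.embedding_strictMono.injective
        (by rw [← hz, map_zero]))
    · have hx' : A.valuation x < A.valuation z := hx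
      rw [hz] at hx'
      exact (Valuation.restrict_lt_iff_lt_embedding _).2 hx'
  · rintro ⟨z, hz, hzs⟩
    refine ⟨Units.mk0 (A.valuation.restrict z) ?_, fun x hx => hzs ?_⟩
    · simpa using hz
    · exact (Valuation.restrict_lt_iff _).1 hx

theorem isTopologicalDivisionRing_valuationTopology :
    @IsTopologicalDivisionRing K _ (valuationTopology A) :=
  let _ := Valued.mk' A.valuation
  inferInstanceAs (IsTopologicalDivisionRing K)

theorem t2Space_valuationTopology : @T2Space K (valuationTopology A) := by
  let _ := Valued.mk' A.valuation
  have : T0Space K := inferInstance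
  exact inferInstance

theorem not_discreteTopology_valuationTopology (hA : A ≠ ⊤) :
    ¬ @DiscreteTopology K (valuationTopology A) := by
  intro hd
  let _ := valuationTopology A
  obtain ⟨a, ha⟩ : ∃ a, a ∉ A := by
    by_contra! h
    exact hA (eq_top_iff.2 fun x _ => h x)
  have ha0 : a ≠ 0 := fun h => ha (h ▸ A.zero_mem)
  have hmem : ({0} : Set K) ∈ 𝓝 (0 : K) := by
    rw [nhds_discrete]
    exact rfl
  obtain ⟨z, hz, hz'⟩ := (hasBasis_nhds_zero_valuationTopology A).mem_iff.1 hmem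
  have h1 : 1 < A.valuation a := lt_of_not_ge fun h => ha ((A.valuation_le_one_iff a).1 h)
  have h2 : A.valuation (z / a) < A.valuation z := by
    rw [map_div₀]
    refine (div_lt_iff₀ (zero_lt_iff.2 (by simpa using ha0))).2 ?_
    exact lt_mul_of_one_lt_right (zero_lt_iff.2 (by simpa using hz)) h1
  have h3 : z / a = 0 := hz' h2
  exact (div_ne_zero hz ha0) h3

theorem mem_maximalIdeal_iff_valuation_lt_one (a : A) :
    a ∈ IsLocalRing.maximalIdeal A ↔ A.valuation a < 1 :=
  A.valuation_lt_one_iff a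

/-- Write c_k for the coefficients of g, r = -c_0/c_1 for the Newton approximation, and t = r/s.
Then s^(n+1) g(r/s) = c_0 (s^(n+1) - s^n + Σ e_j s^(n-1-j)) with e_j = -c_(j+2) r^(j+1)/c_1. The
factor in parentheses is monic in s, and if all e_j lie in the maximal ideal then 1 is a simple root
of it modulo that ideal. The case c_0 = 0 needs no separate treatment. -/
theorem exists_root_of_henselian [HenselianLocalRing A] (n : ℕ) (g : Polynomial K)
    (hdeg : g.natDegree < n + 2) (h1 : g.coeff 1 ≠ 0)
    (hsmall : ∀ j < n, A.valuation
      (-(g.coeff (j + 2) * (-(g.coeff 0 / g.coeff 1)) ^ (j + 1) / g.coeff 1)) < 1) :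
    ∃ t, g.eval t = 0 ∧ A.valuation t = A.valuation (g.coeff 0 / g.coeff 1) := by
  set r := -(g.coeff 0 / g.coeff 1) with hr
  let e : ℕ → A := fun j => if hj : j < n then
    ⟨-(g.coeff (j + 2) * r ^ (j + 1) / g.coeff 1), (A.valuation_le_one_iff _).1 (hsmall j hj).le⟩
    else 0
  have he : ∀ j, e j ∈ IsLocalRing.maximalIdeal A := by
    intro j
    by_cases hj : j < n
    · rw [mem_maximalIdeal_iff_valuation_lt_one]
      simpa only [e, dif_pos hj] using hsmall j hj
    · simp only [e, dif_neg hj, Submodule.zero_mem]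
  have he' : ∀ j < n, g.coeff 0 * (e j : K) = g.coeff (j + 2) * r ^ (j + 2) := by
    intro j hj
    simp only [e, dif_pos hj]
    rw [pow_succ r (j + 1), hr]
    field_simp
  let q : Polynomial A := -Polynomial.X ^ n +
    ∑ j ∈ Finset.range n, Polynomial.C (e j) * Polynomial.X ^ (n - 1 - j)
  let h : Polynomial A := Polynomial.X ^ (n + 1) + q
  have hq : q.degree < ((n + 1 : ℕ) : WithBot ℕ) := by
    refine (Polynomial.degree_add_le _ _).trans_lt (max_lt ?_ ?_)
    · rw [Polynomial.degree_neg]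
      exact (Polynomial.degree_X_pow_le n).trans_lt (by exact_mod_cast n.lt_succ_self)
    · refine (Polynomial.degree_sum_le _ _).trans_lt ((Finset.sup_lt_iff ?_).2 fun j hj => ?_)
      · exact WithBot.bot_lt_coe _
      · refine (Polynomial.degree_C_mul_X_pow_le _ _).trans_lt ?_
        exact_mod_cast (by omega : n - 1 - j < n + 1)
  have hmonic : h.Monic := Polynomial.monic_X_pow_add hq
  have heval : h.eval 1 ∈ IsLocalRing.maximalIdeal A := by
    have : h.eval 1 = ∑ j ∈ Finset.range n, e j := by
      simp [h, q, Polynomial.eval_finsetSum]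
    rw [this]
    exact Ideal.sum_mem _ fun j _ => he j
  have hderiv : IsUnit (h.derivative.eval 1) := by
    have : h.derivative.eval 1 = 1 + ∑ j ∈ Finset.range n, e j * ((n - 1 - j : ℕ) : A) := by
      simp [h, q, Polynomial.eval_finsetSum, Polynomial.derivative_X_pow]
      ring
    rw [this]
    by_contra hu
    have hm : (1 + ∑ j ∈ Finset.range n, e j * ((n - 1 - j : ℕ) : A)) ∈
      IsLocalRing.maximalIdeal A := hu
    have hs : (∑ j ∈ Finset.range n, e j * ((n - 1 - j : ℕ) : A)) ∈ IsLocalRing.maximalIdeal A :=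
      Ideal.sum_mem _ fun j _ => Ideal.mul_mem_right _ _ (he j)
    exact (Ideal.ne_top_iff_one _).1 (IsLocalRing.maximalIdeal.isMaximal A).ne_top
      ((Ideal.add_mem_iff_left _ hs).1 hm)
  obtain ⟨s, hs, hs1⟩ := HenselianLocalRing.is_henselian h hmonic 1 heval hderiv
  have hvs : A.valuation (s : K) = 1 := by
    rw [← A.valuation_eq_one_iff]
    by_contra hu
    have hm : s ∈ IsLocalRing.maximalIdeal A := hu
    -- Since s ≡ 1, s is a unit, so t = r/s has the same value as r.
    exact (Ideal.ne_top_iff_one _).1 (IsLocalRing.maximalIdeal.isMaximal A).ne_top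
      (by simpa using Ideal.sub_mem _ hm hs1)
  have hs0 : (s : K) ≠ 0 := fun h0 => by
    rw [h0, map_zero] at hvs
    exact zero_ne_one hvs
  have hroot : (s : K) ^ (n + 1) - (s : K) ^ n +
      ∑ j ∈ Finset.range n, (e j : K) * (s : K) ^ (n - 1 - j) = 0 := by
    have := congrArg (algebraMap A K) (show h.eval s = 0 from hs)
    simp only [h, q, Polynomial.eval_add, Polynomial.eval_neg, Polynomial.eval_pow,
      Polynomial.eval_X, Polynomial.eval_finsetSum, Polynomial.eval_mul, Polynomial.eval_C,
      map_add, map_neg, map_pow, map_sum, map_mul, map_zero] at this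
    rw [← this]
    change _ = (s : K) ^ (n + 1) + (-(s : K) ^ n +
      ∑ j ∈ Finset.range n, (e j : K) * (s : K) ^ (n - 1 - j))
    ring
  refine ⟨r / s, ?_, ?_⟩
  · have hmul : (s : K) ^ (n + 1) * g.eval (r / s) = g.coeff 0 * ((s : K) ^ (n + 1) - (s : K) ^ n +
        ∑ j ∈ Finset.range n, (e j : K) * (s : K) ^ (n - 1 - j)) := by
      rw [Polynomial.eval_eq_sum_range' hdeg, Finset.sum_range_succ', Finset.sum_range_succ',
        mul_add, mul_add, mul_add, Finset.mul_sum, Finset.mul_sum]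
      have h0 : (s : K) ^ (n + 1) * (g.coeff (0 + 1) * (r / s) ^ (0 + 1)) =
          -(g.coeff 0 * (s : K) ^ n) := by
        rw [hr, zero_add, pow_one]
        field_simp
        ring
      have h2 : ∀ j ∈ Finset.range n, (s : K) ^ (n + 1) * (g.coeff (j + 1 + 1) *
          (r / s) ^ (j + 1 + 1)) = g.coeff 0 * ((e j : K) * (s : K) ^ (n - 1 - j)) := by
        intro j hj
        have hj' := Finset.mem_range.1 hj
        have hn : n + 1 = (n - 1 - j) + (j + 2) := by omega
        rw [← mul_assoc (g.coeff 0), he' j hj', hn, pow_add, div_pow]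
        field_simp
      rw [h0, Finset.sum_congr rfl h2]
      ring
    rw [hroot, mul_zero] at hmul
    exact (mul_eq_zero.1 hmul).resolve_left (pow_ne_zero _ hs0)
  · rw [map_div₀, hvs, div_one, hr, Valuation.map_neg]

/-- At x = 0 the constant coefficient vanishes, hence so do the Newton approximation and the
finitely many quantities that must be small; by continuity they are small nearby. -/
theorem hasStableSimpleRoots_of_henselian [HenselianLocalRing A] :
    @HasStableSimpleRoots K _ (valuationTopology A) := by
  let _ := valuationTopology A
  have := isTopologicalDivisionRing_valuationTopology A
  have := t2Space_valuationTopology A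
  have hbasis := hasBasis_nhds_zero_valuationTopology A
  intro m N f hdeg hcont h0 h1 U hU
  obtain ⟨z, hz, hzU⟩ := hbasis.mem_iff.1 hU
  have hc := fun k => (hcont k).continuousAt (x := 0)
  have hne : ∀ᶠ x in 𝓝 (0 : Fin m → K), (f x).coeff 1 ≠ 0 := (hc 1).eventually_ne h1
  have hr : ContinuousAt (fun x => (f x).coeff 0 / (f x).coeff 1) 0 := (hc 0).div₀ (hc 1) h1
  have hsmall : ∀ j, ∀ᶠ x in 𝓝 (0 : Fin m → K), A.valuation (-((f x).coeff (j + 2) *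
      (-((f x).coeff 0 / (f x).coeff 1)) ^ (j + 1) / (f x).coeff 1)) < 1 := by
    intro j
    have hlim : ContinuousAt (fun x => -((f x).coeff (j + 2) *
      (-((f x).coeff 0 / (f x).coeff 1)) ^ (j + 1) / (f x).coeff 1)) 0 :=
      (((hc (j + 2)).mul (hr.neg.pow (j + 1))).div₀ (hc 1) h1).neg
    have hval : -((f 0).coeff (j + 2) *
      (-((f 0).coeff 0 / (f 0).coeff 1)) ^ (j + 1) / (f 0).coeff 1) = 0 := by
      rw [h0]
      simp
    rw [ContinuousAt, hval] at hlim
    have := hlim (hbasis.mem_of_mem (i := (1 : K)) one_ne_zero)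
    rwa [map_one] at this
  have hball : ∀ᶠ x in 𝓝 (0 : Fin m → K),
      A.valuation ((f x).coeff 0 / (f x).coeff 1) < A.valuation z := by
    rw [ContinuousAt, h0, zero_div] at hr
    exact hr (hbasis.mem_of_mem (i := z) hz)
  filter_upwards [hne, hball, (Filter.eventually_all_finset (Finset.range N)).2
    fun j _ => hsmall j] with x hx1 hxz hxs
  obtain ⟨t, ht, ht'⟩ := exists_root_of_henselian A N (f x)
    ((hdeg x).trans_lt (by omega)) hx1 fun j hj => hxs j (Finset.mem_range.2 hj)
  exact ⟨t, hzU (by change A.valuation t < _; rwa [ht']), ht⟩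

/-- A valuation ring of an algebraically closed field is henselian. -/
theorem henselianLocalRing_of_isAlgClosed [IsAlgClosed K] : HenselianLocalRing A where
  is_henselian f hf a₀ ha₀ _ := by
    have hprod := (IsAlgClosed.splits (f.map (algebraMap A K))).eq_prod_roots_of_monic
      (hf.map _)
    -- f(a₀) is the product of the a₀ - r over the roots; its value is below 1, so some factor has
    -- value below 1.
    obtain ⟨r, hr, hlt⟩ : ∃ r ∈ (f.map (algebraMap A K)).roots, A.valuation ((a₀ : K) - r) < 1 := by
      by_contra! hall
      have h1 : 1 ≤ A.valuation ((f.map (algebraMap A K)).eval (a₀ : K)) := by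
        rw [hprod, Polynomial.eval_multiset_prod, Multiset.map_map]
        refine Multiset.prod_induction (fun x => 1 ≤ A.valuation x) _
          (fun a b ha hb => by rw [map_mul]; exact one_le_mul ha hb) (by rw [map_one]) ?_
        intro x hx
        obtain ⟨r, hr, rfl⟩ := Multiset.mem_map.1 hx
        simpa using hall r hr
      rw [mem_maximalIdeal_iff_valuation_lt_one] at ha₀
      have h2 : (f.map (algebraMap A K)).eval (a₀ : K) = ((f.eval a₀ : A) : K) :=
        Polynomial.eval_map_algebraMap f (a₀ : K) |>.trans (Polynomial.aeval_algebraMap_apply_eq_algebraMap_eval a₀ f)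
      rw [h2] at h1
      exact absurd ha₀ h1.not_gt
    have hrA : r ∈ A := by
      have : (a₀ : K) - ((a₀ : K) - r) ∈ A :=
        A.sub_mem a₀.2 ((A.valuation_le_one_iff _).1 hlt.le)
      simpa using this
    refine ⟨⟨r, hrA⟩, ?_, ?_⟩
    · have h0 := (Polynomial.mem_roots'.1 hr).2
      rw [Polynomial.IsRoot.def, Polynomial.eval_map_algebraMap] at h0
      have h3 := (Polynomial.aeval_algebraMap_apply_eq_algebraMap_eval (⟨r, hrA⟩ : A) f).symm.trans h0
      exact (IsFractionRing.injective A K) (h3.trans (map_zero _).symm)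
    · rw [mem_maximalIdeal_iff_valuation_lt_one]
      have : A.valuation (r - a₀) < 1 := by rwa [Valuation.map_sub_swap]
      exact this

end Valuation
end GenericDerivation

namespace GenericDerivation

/-! ### Real closed fields -/

section RealClosed

open Polynomial

/-- The minimal polynomial of a primitive element is irreducible of degree [E : F]; having a root,
it is linear. -/
theorem finrank_eq_one_of_exists_isRoot {F E : Type*} [Field F] [Field E] [Algebra F E]
    [FiniteDimensional F E] [Algebra.IsSeparable F E]
    (h : ∀ f : F[X], f.natDegree = Module.finrank F E → ∃ x, f.IsRoot x) :
    Module.finrank F E = 1 := by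
  obtain ⟨α, hα⟩ := Field.exists_primitive_element F E
  have hint : IsIntegral F α := Algebra.IsIntegral.isIntegral α
  have hd : (minpoly F α).natDegree = Module.finrank F E :=
    (Field.primitive_element_iff_minpoly_natDegree_eq F α).1 hα
  obtain ⟨x, hx⟩ := h _ hd
  rw [← hd]
  exact natDegree_eq_of_degree_eq_some
    (degree_eq_one_of_irreducible_of_root (minpoly.irreducible hint) hx)

variable {K : Type*} [Field K]

theorem exists_isRoot_of_natDegree_two [NeZero (2 : K)] (hsq : ∀ x : K, IsSquare x) {f : K[X]}
    (hf : f.natDegree = 2) : ∃ x, f.IsRoot x := by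
  have ha : f.coeff 2 ≠ 0 := by
    rw [← hf, coeff_natDegree]
    exact leadingCoeff_ne_zero.2 (by rintro rfl; simp at hf)
  obtain ⟨x, hx⟩ := exists_quadratic_eq_zero ha (hsq (discrim (f.coeff 2) (f.coeff 1) (f.coeff 0)))
  refine ⟨x, ?_⟩
  rw [IsRoot.def, eval_eq_sum_range, hf]
  simp only [Finset.sum_range_succ, Finset.sum_range_zero]
  linear_combination hx

/-! ### The intermediate value property for polynomials over a real closed field -/

variable [LinearOrder K] [IsStrictOrderedRing K] [IsRealClosed K]

theorem IsRealClosed.isSquare_of_mem_adjoin {E : Type*} [Field E] [Algebra K E] {i : E}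
    (hi : i * i = -1) (x : IntermediateField.adjoin K {i}) : IsSquare x := by
  have key : ∀ y ∈ IntermediateField.adjoin K {i}, ∃ a b : K,
      y = algebraMap K E a + algebraMap K E b * i := by
    intro y hy
    induction hy using IntermediateField.adjoin_induction with
    | mem y hy =>
      obtain rfl : y = i := hy
      exact ⟨0, 1, by simp⟩
    | algebraMap a => exact ⟨a, 0, by simp⟩
    | add y z _ _ hy hz =>
      obtain ⟨a, b, rfl⟩ := hy
      obtain ⟨c, d, rfl⟩ := hz
      exact ⟨a + c, b + d, by simp only [map_add]; ring⟩
    | inv y _ hy =>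
      obtain ⟨a, b, rfl⟩ := hy
      by_cases h0 : a * a + b * b = 0
      · obtain ⟨rfl, rfl⟩ := mul_self_add_mul_self_eq_zero.1 h0
        exact ⟨0, 0, by simp⟩
      · refine ⟨a / (a * a + b * b), -b / (a * a + b * b), ?_⟩
        have h1 : algebraMap K E (a * a + b * b) ≠ 0 := by
          rwa [Ne, map_eq_zero]
        rw [map_add, map_mul, map_mul, ← pow_two, ← pow_two] at h1
        refine inv_eq_of_mul_eq_one_left ?_
        simp only [map_div₀, map_neg, map_add, map_pow, ← pow_two]
        field_simp
        linear_combination (-(algebraMap K E b) ^ 2) * hi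
    | mul y z _ _ hy hz =>
      obtain ⟨a, b, rfl⟩ := hy
      obtain ⟨c, d, rfl⟩ := hz
      refine ⟨a * c - b * d, a * d + b * c, ?_⟩
      simp only [map_add, map_sub, map_mul]
      linear_combination (algebraMap K E b * algebraMap K E d) * hi
  obtain ⟨y, hy⟩ := x
  obtain ⟨a, b, rfl⟩ := key y hy
  suffices h : ∃ c d : K, c * c - d * d = a ∧ 2 * (c * d) = b by
    obtain ⟨c, d, rfl, rfl⟩ := h
    have hmem : algebraMap K E c + algebraMap K E d * i ∈ IntermediateField.adjoin K {i} :=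
      add_mem (IntermediateField.algebraMap_mem _ _)
        (mul_mem (IntermediateField.algebraMap_mem _ _) (IntermediateField.mem_adjoin_simple_self K i))
    refine ⟨⟨_, hmem⟩, Subtype.ext ?_⟩
    simp only [map_sub, map_mul, map_ofNat, MulMemClass.mk_mul_mk]
    linear_combination (-(algebraMap K E d * algebraMap K E d)) * hi
  -- With r = |a + bi|, the square root is c + di for c² = (r + a)/2 and d² = (r - a)/2; the sign of
  -- d is adjusted to that of b.
  obtain ⟨r, hr0, hr⟩ : ∃ r : K, 0 ≤ r ∧ a * a + b * b = r * r := by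
    obtain ⟨r, hr⟩ := IsSquare.of_nonneg (add_nonneg (mul_self_nonneg a) (mul_self_nonneg b))
    exact ⟨|r|, abs_nonneg r, by rw [abs_mul_abs_self, hr]⟩
  have har : |a| ≤ r := abs_le_of_sq_le_sq (by nlinarith [mul_self_nonneg b]) hr0
  obtain ⟨har1, har2⟩ := abs_le.1 har
  obtain ⟨c, hc⟩ := IsSquare.of_nonneg (show 0 ≤ (r + a) / 2 by linarith)
  obtain ⟨d, hd⟩ := IsSquare.of_nonneg (show 0 ≤ (r - a) / 2 by linarith)
  have h1 : (2 * (c * d)) * (2 * (c * d)) = b * b := by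
    calc (2 * (c * d)) * (2 * (c * d)) = 4 * ((c * c) * (d * d)) := by ring
      _ = b * b := by rw [← hc, ← hd]; linear_combination -hr
  rcases mul_self_eq_mul_self_iff.1 h1 with h | h
  · exact ⟨c, d, by linear_combination hd - hc, h⟩
  · exact ⟨c, -d, by linear_combination hd - hc, by linear_combination -h⟩

/-- The fixed field of a Sylow 2-subgroup has odd degree over K, hence is K, so [E : K] is a power
of 2. If E were larger than K(i), a subgroup of index 2 would give a quadratic extension of K(i),
where every element is a square. -/
theorem IsRealClosed.finrank_adjoin_eq_one {E : Type*} [Field E] [Algebra K E]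
    [FiniteDimensional K E] [IsGalois K E] {i : E} (hi : i * i = -1) :
    Module.finrank (IntermediateField.adjoin K {i}) E = 1 := by
  have : Fact (Nat.Prime 2) := ⟨Nat.prime_two⟩
  obtain ⟨n, hn⟩ : ∃ n, Module.finrank K E = 2 ^ n := by
    let P : Sylow 2 Gal(E/K) := default
    have hodd : Odd (Module.finrank K (IntermediateField.fixedField (P : Subgroup Gal(E/K)))) := by
      rw [IntermediateField.finrank_eq_fixingSubgroup_index,
        IntermediateField.fixingSubgroup_fixedField]
      exact Nat.not_even_iff_odd.1 fun h => P.not_dvd_index h.two_dvd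
    have h1 : Module.finrank K (IntermediateField.fixedField (P : Subgroup Gal(E/K))) = 1 :=
      finrank_eq_one_of_exists_isRoot fun f hf =>
        IsRealClosed.exists_isRoot_of_odd_natDegree (by rwa [hf])
    obtain ⟨n, hn⟩ := P.isPGroup'.exists_card_eq
    refine ⟨n, ?_⟩
    rw [← Module.finrank_mul_finrank K (IntermediateField.fixedField (P : Subgroup Gal(E/K))) E,
      h1, one_mul, IntermediateField.finrank_fixedField_eq_card, hn]
  set F := IntermediateField.adjoin K {i}
  obtain ⟨k, -, hk⟩ : ∃ k ≤ n, Module.finrank F E = 2 ^ k := by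
    rw [← Nat.dvd_prime_pow Nat.prime_two, ← hn]
    exact Dvd.intro_left _ (Module.finrank_mul_finrank K F E)
  rcases k with _ | k
  · simpa using hk
  · exfalso
    obtain ⟨H, hH⟩ := Sylow.exists_subgroup_card_pow_prime (G := Gal(E/F)) 2 (n := k)
      (by rw [IsGalois.card_aut_eq_finrank, hk]; exact pow_dvd_pow 2 k.le_succ)
    have h1 : Module.finrank F (IntermediateField.fixedField H) = 2 := by
      have h2 := Module.finrank_mul_finrank F (IntermediateField.fixedField H) E
      rw [IntermediateField.finrank_fixedField_eq_card, hH, hk, pow_succ'] at h2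
      exact Nat.eq_of_mul_eq_mul_right (pow_pos two_pos k) h2
    have h3 : Module.finrank F (IntermediateField.fixedField H) = 1 :=
      finrank_eq_one_of_exists_isRoot fun f hf =>
        exists_isRoot_of_natDegree_two (IsRealClosed.isSquare_of_mem_adjoin hi) (hf.trans h1)
    omega

theorem IsRealClosed.natDegree_le_two_of_irreducible {f : K[X]} (hf : Irreducible f) :
    f.natDegree ≤ 2 := by
  have hX : (X ^ 2 + 1 : K[X]).natDegree = 2 := by compute_degree!
  have hX0 : (X ^ 2 + 1 : K[X]) ≠ 0 := by
    intro h
    rw [h] at hX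
    simp at hX
  -- The factor X² + 1 puts a square root of -1 into the splitting field.
  let g : K[X] := f * (X ^ 2 + 1)
  have hg0 : g ≠ 0 := mul_ne_zero hf.ne_zero hX0
  let E := g.SplittingField
  have : IsGalois K E := ⟨⟩
  have hs : (g.map (algebraMap K E)).Splits := SplittingField.splits g
  have hsf : (f.map (algebraMap K E)).Splits :=
    hs.of_dvd (map_ne_zero hg0) (Polynomial.map_dvd _ (dvd_mul_right _ _))
  have hsX : ((X ^ 2 + 1 : K[X]).map (algebraMap K E)).Splits :=
    hs.of_dvd (map_ne_zero hg0) (Polynomial.map_dvd _ (dvd_mul_left _ _))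
  obtain ⟨i, hi⟩ := hsX.exists_eval_eq_zero (by
    rw [degree_map, degree_eq_natDegree hX0, hX]; norm_num)
  obtain ⟨α, hα⟩ := hsf.exists_eval_eq_zero (by
    rw [degree_map]; exact (degree_pos_of_irreducible hf).ne')
  have hi' : i * i = -1 := by
    have : i ^ 2 + 1 = 0 := by simpa using hi
    linear_combination this
  have h1 := IsRealClosed.finrank_adjoin_eq_one (K := K) hi'
  have h2 : Module.finrank K E ≤ 2 := by
    rw [← Module.finrank_mul_finrank K (IntermediateField.adjoin K {i}) E, h1, mul_one,
      IntermediateField.adjoin.finrank (Algebra.IsIntegral.isIntegral i), ← hX]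
    exact natDegree_le_of_dvd (minpoly.dvd K i (by simpa using hi)) hX0
  have h3 : f.natDegree = (minpoly K α).natDegree := by
    have hα' : aeval α f = 0 := by rwa [← eval_map_algebraMap]
    rw [← minpoly.eq_of_irreducible hf hα', natDegree_mul_C]
    exact inv_ne_zero (leadingCoeff_ne_zero.2 hf.ne_zero)
  rw [h3]
  exact (minpoly.natDegree_le α).trans h2

/-- Irreducible factors are linear, with root outside [a, b], or quadratic with negative
discriminant and hence of constant sign; signs multiply. -/
theorem IsRealClosed.eval_mul_eval_pos (a b : K) (hab : a ≤ b) (f : K[X]) :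
    (∀ x, a ≤ x → x ≤ b → f.eval x ≠ 0) → 0 < f.eval a * f.eval b := by
  induction f using WfDvdMonoid.induction_on_irreducible with
  | zero => exact fun h => absurd eval_zero (h a le_rfl hab)
  | unit u hu =>
    intro h
    obtain ⟨c, hc, rfl⟩ := Polynomial.isUnit_iff.1 hu
    simpa using mul_self_pos.2 hc.ne_zero
  | mul f p hf hp ih =>
    intro h
    have hp' : 0 < p.eval a * p.eval b := by
      have hpr : ∀ x, a ≤ x → x ≤ b → p.eval x ≠ 0 := fun x h1 h2 h3 =>
        h x h1 h2 (by rw [eval_mul, h3, zero_mul])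
      have hle := IsRealClosed.natDegree_le_two_of_irreducible hp
      have hpos := hp.natDegree_pos
      obtain hd | hd : p.natDegree = 1 ∨ p.natDegree = 2 := by omega
      · have hev : ∀ x, p.eval x = p.coeff 1 * x + p.coeff 0 := fun x => by
          rw [eval_eq_sum_range, hd]; simp [Finset.sum_range_succ]; ring
        have hc : p.coeff 1 ≠ 0 := by
          rw [← hd, coeff_natDegree]; exact leadingCoeff_ne_zero.2 hp.ne_zero
        by_contra hneg
        obtain ⟨r, hr⟩ : ∃ r, p.coeff 0 = - (p.coeff 1 * r) :=
          ⟨-(p.coeff 0 / p.coeff 1), by field_simp⟩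
        have h1 : p.eval a * p.eval b = (p.coeff 1) ^ 2 * ((a - r) * (b - r)) := by
          rw [hev, hev, hr]; ring
        rw [h1] at hneg
        have h2 : (a - r) * (b - r) ≤ 0 := by
          by_contra h3
          exact hneg (mul_pos (by positivity) (not_le.1 h3))
        have h3 : a ≤ r ∧ r ≤ b := by
          rcases mul_nonpos_iff.1 h2 with ⟨h3, h4⟩ | ⟨h3, h4⟩ <;> constructor <;> linarith
        exact hpr r h3.1 h3.2 (by rw [hev, hr]; ring)
      · have hev : ∀ x, p.eval x = p.coeff 2 * (x * x) + p.coeff 1 * x + p.coeff 0 := fun x => by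
          rw [eval_eq_sum_range, hd]; simp [Finset.sum_range_succ]; ring
        have hc : p.coeff 2 ≠ 0 := by
          rw [← hd, coeff_natDegree]; exact leadingCoeff_ne_zero.2 hp.ne_zero
        have hdisc : discrim (p.coeff 2) (p.coeff 1) (p.coeff 0) < 0 := by
          by_contra hneg
          obtain ⟨x, hx⟩ := exists_quadratic_eq_zero hc (IsSquare.of_nonneg (not_lt.1 hneg))
          have h1 : p.IsRoot x := by rw [IsRoot.def, hev, hx]
          have h2 : p.natDegree = 1 :=
            natDegree_eq_of_degree_eq_some (degree_eq_one_of_irreducible_of_root hp h1)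
          omega
        have h4 : ∀ x, 0 < 4 * p.coeff 2 * p.eval x := fun x => by
          have : 4 * p.coeff 2 * p.eval x = (2 * p.coeff 2 * x + p.coeff 1) ^ 2 -
              discrim (p.coeff 2) (p.coeff 1) (p.coeff 0) := by
            rw [hev, discrim]; ring
          rw [this]
          linarith [sq_nonneg (2 * p.coeff 2 * x + p.coeff 1)]
        have h5 := mul_pos (h4 a) (h4 b)
        have h6 : 0 < (4 * p.coeff 2) ^ 2 := by positivity
        refine (mul_pos_iff_of_pos_left h6).1 ?_
        linarith [h5]
    have := mul_pos hp' (ih fun x h1 h2 h3 => h x h1 h2 (by rw [eval_mul, h3, mul_zero]))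
    rw [eval_mul, eval_mul]
    linarith

theorem IsRealClosed.exists_root_of_sign_change {a b : K} (hab : a ≤ b) {f : K[X]}
    (h : f.eval a * f.eval b ≤ 0) : ∃ x, a ≤ x ∧ x ≤ b ∧ f.eval x = 0 := by
  by_contra hne
  push Not at hne
  exact (IsRealClosed.eval_mul_eval_pos a b hab f hne).not_ge h

/-- Near 0 the polynomial f 0 is t times a function of constant sign, so it changes sign between -ε
and ε. Only the values at these two points matter, and they depend continuously on x. -/
theorem hasStableSimpleRoots_of_isRealClosed [TopologicalSpace K] [OrderTopology K] :
    HasStableSimpleRoots K := by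
  intro m N f hN hf h0 h1 U hU
  obtain ⟨ε, hε, hεU, hsign⟩ : ∃ ε > 0, (∀ x, |x| ≤ ε → x ∈ U) ∧
      (f 0).eval ε * (f 0).eval (-ε) < 0 := by
    have hdiv : ∀ t, (f 0).eval t = t * (f 0).divX.eval t := fun t => by
      conv_lhs => rw [← divX_mul_X_add (f 0), h0]
      simp [mul_comm]
    have hc : Continuous fun t : K => (f 0).divX.eval t * (f 0).divX.eval (-t) :=
      (f 0).divX.continuous.mul ((f 0).divX.continuous.comp continuous_neg)
    have hev : ∀ᶠ t in 𝓝 (0 : K), 0 < (f 0).divX.eval t * (f 0).divX.eval (-t) := by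
      refine hc.continuousAt.eventually (lt_mem_nhds ?_)
      simp only [neg_zero]
      rw [← coeff_zero_eq_eval_zero, coeff_divX]
      exact mul_self_pos.2 h1
    obtain ⟨η, hη, hηU⟩ := (nhds_basis_zero_abs_lt K).mem_iff.1 (Filter.inter_mem hU hev)
    have hlt : η / 2 < η := half_lt_self hη
    have hmem : ∀ x, |x| ≤ η / 2 → x ∈ _ := fun x hx => hηU (lt_of_le_of_lt hx hlt)
    refine ⟨η / 2, half_pos hη, fun x hx => (hmem x hx).1, ?_⟩
    have h2 := (hmem (η / 2) (abs_of_pos (half_pos hη)).le).2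
    simp only [Set.mem_ofPred_eq] at h2
    rw [hdiv, hdiv]
    nlinarith [mul_pos (mul_pos (half_pos hη) (half_pos hη)) h2]
  have hcont : ∀ t : K, Continuous fun x => (f x).eval t := fun t => by
    have : (fun x => (f x).eval t) = fun x => ∑ k ∈ Finset.range (N + 1), (f x).coeff k * t ^ k := by
      funext x
      exact eval_eq_sum_range' (Nat.lt_succ_of_le (hN x)) t
    rw [this]
    exact continuous_finsetSum _ fun k _ => (hf k).mul continuous_const
  filter_upwards [((hcont ε).mul (hcont (-ε))).continuousAt.eventually (gt_mem_nhds hsign)] with x hx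
  obtain ⟨t, h2, h3, h4⟩ := IsRealClosed.exists_root_of_sign_change (neg_le_self hε.le)
    (f := f x) (by rw [mul_comm]; exact hx.le)
  exact ⟨t, hεU t (abs_le.2 ⟨h2, h3⟩), h4⟩

end RealClosed
end GenericDerivation

namespace GenericDerivation

/-! ### `p`-adically closed fields -/

section PAdic

open Polynomial

/-- Traces of integral elements lie in A, so c belongs to the trace dual of A[x]; by Euler's formula
this dual is A[x] divided by the derivative of the minimal polynomial at x. -/
theorem derivative_minpoly_mul_mem_adjoin {A K E : Type*} [CommRing A] [IsDomain A] [Field K]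
    [Field E] [Algebra A K] [Algebra K E] [Algebra A E] [IsScalarTower A K E] [IsFractionRing A K]
    [FiniteDimensional K E] [Algebra.IsSeparable K E] [IsIntegrallyClosed A] {x c : E}
    (hx : Algebra.adjoin K {x} = ⊤) (hAx : IsIntegral A x) (hc : IsIntegral A c) :
    aeval x (derivative (minpoly K x)) * c ∈ Algebra.adjoin A {x} := by
  have hmem : c ∈ (Algebra.traceForm K E).dualSubmodule
      (Subalgebra.toSubmodule (Algebra.adjoin A {x})) := by
    rw [LinearMap.BilinForm.mem_dualSubmodule]
    intro y hy
    have hle : Algebra.adjoin A {x} ≤ integralClosure A E :=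
      Algebra.adjoin_le (Set.singleton_subset_iff.2 hAx)
    have hy' : IsIntegral A y := hle hy
    obtain ⟨a, ha⟩ := IsIntegrallyClosed.isIntegral_iff.1
      (Algebra.isIntegral_trace (L := K) (hc.mul hy'))
    rw [Algebra.traceForm_apply, Submodule.mem_one]
    exact ⟨a, ha⟩
  rw [traceForm_dualSubmodule_adjoin A K hx hAx, Submodule.mem_smul_pointwise_iff_exists] at hmem
  obtain ⟨s, hs, rfl⟩ := hmem
  by_cases h0 : aeval x (derivative (minpoly K x)) = 0
  · rw [h0, zero_mul]
    exact zero_mem _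
  · rw [smul_eq_mul, mul_inv_cancel_left₀ h0]
    exact hs

/-! ### Valuation rings in algebraic extensions -/

section Extension

variable {K E : Type*} [Field K] [Field E] [Algebra K E] {A : ValuationSubring K}
  {B : ValuationSubring E}

theorem valuation_algebraMap_le_one_iff (hB : B.comap (algebraMap K E) = A) (x : K) :
    B.valuation (algebraMap K E x) ≤ 1 ↔ A.valuation x ≤ 1 := by
  subst hB
  rw [ValuationSubring.valuation_le_one_iff, ValuationSubring.valuation_le_one_iff]
  rfl

theorem valuation_algebraMap_lt_one_iff (hB : B.comap (algebraMap K E) = A) (x : K) :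
    B.valuation (algebraMap K E x) < 1 ↔ A.valuation x < 1 := by
  rcases eq_or_ne x 0 with rfl | hx
  · simp
  · have h := valuation_algebraMap_le_one_iff hB x⁻¹
    rw [map_inv₀, map_inv₀, map_inv₀, inv_le_one₀, inv_le_one₀] at h
    · exact not_le.symm.trans ((not_congr h).trans not_le)
    · rwa [zero_lt_iff, Valuation.ne_zero_iff]
    · rwa [zero_lt_iff, Valuation.ne_zero_iff, Ne, map_eq_zero]

theorem valuation_algebraMap_eq_one_iff (hB : B.comap (algebraMap K E) = A) (x : K) :
    B.valuation (algebraMap K E x) = 1 ↔ A.valuation x = 1 := by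
  have h1 := valuation_algebraMap_le_one_iff hB x
  have h2 := valuation_algebraMap_lt_one_iff hB x
  constructor
  · intro h
    exact le_antisymm (h1.1 h.le) (not_lt.1 fun h3 => (h2.2 h3).ne h)
  · intro h
    exact le_antisymm (h1.2 h.le) (not_lt.1 fun h3 => (h2.1 h3).ne h)

/-- The integral closure is the intersection of the valuation rings containing A. -/
theorem isIntegral_of_forall_valuationSubring (x : E)
    (h : ∀ W : ValuationSubring E, (∀ a : A, algebraMap K E a ∈ W) → x ∈ W) : IsIntegral A x := by
  by_contra hx
  obtain ⟨W, hW, hxW⟩ := Subring.exists_le_valuationSubring_of_isIntegrallyClosedIn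
    (R := (integralClosure A E).toSubring) (x := x) hx
  exact hxW (h W fun a => hW (isIntegral_algebraMap (R := A) (A := E) (x := a)))

/-- Every element of B is a quotient of elements integral over A with denominator a unit of B. The
denominator is the tail of a normalized algebraic relation of b, starting at its last unit
coefficient. -/
theorem exists_isIntegral_mul_eq [Algebra.IsAlgebraic K E] (hB : B.comap (algebraMap K E) = A)
    {b : E} (hb : b ∈ B) :
    ∃ c u : E, IsIntegral A c ∧ IsIntegral A u ∧ B.valuation u = 1 ∧ b * u = c := by
  obtain ⟨n, a, j, hj, hle, haj, hlt, hsum⟩ : ∃ (n : ℕ) (a : ℕ → K) (j : ℕ), j < n ∧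
      (∀ i, A.valuation (a i) ≤ 1) ∧ A.valuation (a j) = 1 ∧
      (∀ i, j < i → A.valuation (a i) < 1) ∧
      ∑ i ∈ Finset.range n, algebraMap K E (a i) * b ^ i = 0 := by
    obtain ⟨q, hq0, hq⟩ := Algebra.IsAlgebraic.isAlgebraic (R := K) b
    obtain ⟨i₀, hi₀, hmax⟩ := q.support.exists_max_image (fun i => A.valuation (q.coeff i))
      (nonempty_support_iff.2 hq0)
    have hc0 : q.coeff i₀ ≠ 0 := mem_support_iff.1 hi₀
    have hle : ∀ i, A.valuation (q.coeff i / q.coeff i₀) ≤ 1 := by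
      intro i
      rw [map_div₀]
      refine div_le_one_of_le₀ ?_ zero_le
      by_cases hi : i ∈ q.support
      · exact hmax i hi
      · rw [notMem_support_iff.1 hi, map_zero]
        exact zero_le
    classical
    let S := q.support.filter fun i => A.valuation (q.coeff i / q.coeff i₀) = 1
    have hS : S.Nonempty := ⟨i₀, Finset.mem_filter.2 ⟨hi₀, by rw [div_self hc0, map_one]⟩⟩
    have hmem := Finset.mem_filter.1 (S.max'_mem hS)
    refine ⟨q.natDegree + 1, fun i => q.coeff i / q.coeff i₀, S.max' hS,
      Nat.lt_succ_of_le (le_natDegree_of_mem_supp _ hmem.1), hle, hmem.2, ?_, ?_⟩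
    · intro i hi
      refine (hle i).lt_of_ne fun h1 => ?_
      have : i ∈ S := by
        refine Finset.mem_filter.2 ⟨mem_support_iff.2 fun h0 => ?_, h1⟩
        rw [h0, zero_div, map_zero] at h1
        exact zero_ne_one h1
      exact (S.le_max' i this).not_gt hi
    · rw [aeval_eq_sum_range] at hq
      have : ∑ i ∈ Finset.range (q.natDegree + 1), algebraMap K E (q.coeff i / q.coeff i₀) * b ^ i =
          algebraMap K E (q.coeff i₀)⁻¹ *
            ∑ i ∈ Finset.range (q.natDegree + 1), q.coeff i • b ^ i := by
        rw [Finset.mul_sum]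
        refine Finset.sum_congr rfl fun i _ => ?_
        rw [Algebra.smul_def, div_eq_inv_mul, map_mul, mul_assoc]
      rw [this, hq, mul_zero]
  have hvb : B.valuation b ≤ 1 := (B.valuation_le_one_iff b).2 hb
  -- A valuation ring W over A that contains b visibly contains u and bu; if instead it contains
  -- b⁻¹, the relation rewrites u and bu in terms of b⁻¹. In B itself u is a unit, because all its
  -- coefficients after the first have value below 1.
  let u := ∑ i ∈ Finset.Ico j n, algebraMap K E (a i) * b ^ (i - j)
  have hu : b ^ j * u = -∑ i ∈ Finset.range j, algebraMap K E (a i) * b ^ i := by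
    rw [eq_neg_iff_add_eq_zero, ← hsum, add_comm, ← Finset.sum_range_add_sum_Ico _ hj.le,
      Finset.mul_sum]
    congr 1
    refine Finset.sum_congr rfl fun i hi => ?_
    rw [mul_left_comm, ← pow_add, Nat.add_sub_cancel' (Finset.mem_Ico.1 hi).1]
  have hcoef : ∀ W : ValuationSubring E, (∀ x : A, algebraMap K E x ∈ W) →
      ∀ i, algebraMap K E (a i) ∈ W := fun W hW i =>
    hW ⟨a i, (A.valuation_le_one_iff _).1 (hle i)⟩
  have key : ∀ W : ValuationSubring E, (∀ x : A, algebraMap K E x ∈ W) → u ∈ W ∧ b * u ∈ W := by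
    intro W hW
    by_cases hbW : b ∈ W
    · have : u ∈ W := sum_mem fun i _ => mul_mem (hcoef W hW i) (pow_mem hbW _)
      exact ⟨this, mul_mem hbW this⟩
    · have hb0 : b ≠ 0 := fun h => hbW (h ▸ W.zero_mem)
      have hbi : b⁻¹ ∈ W := (W.mem_or_inv_mem b).resolve_left hbW
      have h1 : u = -∑ i ∈ Finset.range j, algebraMap K E (a i) * b⁻¹ ^ (j - i) := by
        rw [← mul_right_inj' (pow_ne_zero j hb0), hu, mul_neg, Finset.mul_sum]
        refine congrArg Neg.neg (Finset.sum_congr rfl fun i hi => ?_)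
        have hij := (Finset.mem_range.1 hi).le
        rw [mul_left_comm, inv_pow, ← pow_sub_mul_pow b hij, mul_right_comm,
          mul_inv_cancel₀ (pow_ne_zero _ hb0), one_mul]
      have h2 : b * u = -∑ i ∈ Finset.range j, algebraMap K E (a i) * b⁻¹ ^ (j - i - 1) := by
        rw [h1, mul_neg, Finset.mul_sum]
        refine congrArg Neg.neg (Finset.sum_congr rfl fun i hi => ?_)
        obtain ⟨k, hk⟩ := Nat.exists_eq_succ_of_ne_zero
          (Nat.sub_ne_zero_of_lt (Finset.mem_range.1 hi))
        rw [hk, Nat.succ_sub_one, mul_left_comm, pow_succ', mul_inv_cancel_left₀ hb0]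
      exact ⟨h1 ▸ neg_mem (sum_mem fun i _ => mul_mem (hcoef W hW i) (pow_mem hbi _)),
        h2 ▸ neg_mem (sum_mem fun i _ => mul_mem (hcoef W hW i) (pow_mem hbi _))⟩
  refine ⟨b * u, u, isIntegral_of_forall_valuationSubring _ fun W hW => (key W hW).2,
    isIntegral_of_forall_valuationSubring _ fun W hW => (key W hW).1, ?_, rfl⟩
  have hsplit : u = algebraMap K E (a j) +
      ∑ i ∈ Finset.Ico (j + 1) n, algebraMap K E (a i) * b ^ (i - j) := by
    rw [show u = _ from Finset.sum_eq_sum_Ico_succ_bot hj _, Nat.sub_self, pow_zero, mul_one]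
  have hone := (valuation_algebraMap_eq_one_iff hB (a j)).2 haj
  rw [hsplit, Valuation.map_add_eq_of_lt_left, hone]
  rw [hone]
  refine Valuation.map_sum_lt _ one_ne_zero fun i hi => ?_
  rw [map_mul, map_pow]
  exact mul_lt_one_of_lt_of_le
    ((valuation_algebraMap_lt_one_iff hB _).2 (hlt i (Finset.mem_Ico.1 hi).1))
    (pow_le_one' hvb _)

variable {α : E}

theorem algebraMap_mem_of_comap_eq (hB : B.comap (algebraMap K E) = A) (x : A) :
    algebraMap K E x ∈ B := by
  have : (x : K) ∈ B.comap (algebraMap K E) := hB ▸ x.2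
  exact this

/-- q(α) - q(a) is α - a times a polynomial in α over A. -/
theorem valuation_aeval_sub_le (hB : B.comap (algebraMap K E) = A) {a : A}
    (hα : B.valuation (α - algebraMap K E a) ≤ 1) (q : A[X]) :
    B.valuation (aeval α q - algebraMap K E ((q.eval a : A) : K)) ≤
      B.valuation (α - algebraMap K E a) := by
  have hA := algebraMap_mem_of_comap_eq hB
  have hαB : α ∈ B := by
    have := add_mem ((B.valuation_le_one_iff _).1 hα) (hA a)
    rwa [sub_add_cancel] at this
  obtain ⟨r, hr⟩ := X_sub_C_dvd_sub_C_eval (a := a) (p := q)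
  have h1 : aeval α q - algebraMap K E ((q.eval a : A) : K) =
      (α - algebraMap K E a) * aeval α r := by
    have h2 := congrArg (aeval α) hr
    simp only [map_sub, map_mul, aeval_X, aeval_C] at h2
    exact h2
  have h3 : aeval α r ∈ B := by
    rw [aeval_eq_sum_range]
    refine sum_mem fun i _ => ?_
    rw [Algebra.smul_def]
    exact mul_mem (hA _) (pow_mem hαB _)
  rw [h1, map_mul]
  exact mul_le_of_le_one_right' ((B.valuation_le_one_iff _).2 h3)

theorem valuation_aeval_eq_one_iff (hB : B.comap (algebraMap K E) = A) {a : A}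
    (hα : B.valuation (α - algebraMap K E a) < 1) (q : A[X]) :
    B.valuation (aeval α q) = 1 ↔ IsUnit (q.eval a) := by
  have h := (valuation_aeval_sub_le hB hα.le q).trans_lt hα
  rw [ValuationSubring.valuation_eq_one_iff, ← valuation_algebraMap_eq_one_iff hB]
  constructor
  · intro h1
    have := Valuation.map_sub_eq_of_lt_right (v := B.valuation) (h.trans_eq h1.symm)
    rw [sub_sub_cancel_left, Valuation.map_neg] at this
    exact this.trans h1
  · intro h1
    have := Valuation.map_add_eq_of_lt_left (v := B.valuation) (h.trans_eq h1.symm)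
    rw [add_sub_cancel] at this
    exact this.trans h1

/-- Write b = c/u with c and u integral and u a unit of B. Multiplying both by g'(α) brings them
into A[α], and the new denominator is still a unit of B because g'(a) is a unit. -/
theorem exists_aeval_mul_eq [CharZero K] [FiniteDimensional K E]
    (hB : B.comap (algebraMap K E) = A) {a : A} (hα : B.valuation (α - algebraMap K E a) < 1)
    (htop : Algebra.adjoin K {α} = ⊤) {g : A[X]} (hg : g.Monic) (hgα : aeval α g = 0)
    (hmin : minpoly K α = g.map (algebraMap A K)) (hder : IsUnit (g.derivative.eval a))
    {b : E} (hb : b ∈ B) :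
    ∃ q h : A[X], IsUnit (h.eval a) ∧ b * aeval α h = aeval α q := by
  obtain ⟨c, u, hc, hu, hu1, rfl⟩ := exists_isIntegral_mul_eq hB hb
  have hint : IsIntegral A α := ⟨g, hg, hgα⟩
  have hd : aeval α (derivative (minpoly K α)) = aeval α (derivative g) := by
    rw [hmin, derivative_map, aeval_map_algebraMap]
  have hq := derivative_minpoly_mul_mem_adjoin htop hint hc
  have hh := derivative_minpoly_mul_mem_adjoin htop hint hu
  rw [Algebra.adjoin_singleton_eq_range_aeval, hd] at hq hh
  obtain ⟨q, hq⟩ := hq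
  obtain ⟨h, hh⟩ := hh
  have hq' : aeval α q = aeval α (derivative g) * (b * u) := hq
  have hh' : aeval α h = aeval α (derivative g) * u := hh
  refine ⟨q, h, ?_, by rw [hq', hh']; ring⟩
  rw [← valuation_aeval_eq_one_iff hB hα, hh', map_mul, hu1, mul_one,
    valuation_aeval_eq_one_iff hB hα]
  exact hder

/-- The elements q(α) with q(a) in the maximal ideal form an ideal of A[α]. It is proper: all
relations are multiples of g, and g(a) is in the maximal ideal. By Chevalley's theorem some
valuation ring contains A[α] and has this ideal among its nonunits. -/
theorem exists_valuationSubring_root {g : A[X]} (hint : IsIntegral A α)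
    (hmin : minpoly A α = g) {a : A} (ha : g.eval a ∈ IsLocalRing.maximalIdeal A) :
    ∃ B : ValuationSubring E, B.comap (algebraMap K E) = A ∧
      B.valuation (α - algebraMap K E a) < 1 := by
  let R : Subring E := (aeval (R := A) α).toRingHom.range
  let φ : A[X] →+* R := (aeval (R := A) α).toRingHom.rangeRestrict
  have hφ : Function.Surjective φ := RingHom.rangeRestrict_surjective _
  let I : Ideal R := ((IsLocalRing.maximalIdeal A).comap (evalRingHom a)).map φ
  have hI : I ≠ ⊤ := by
    intro h
    obtain ⟨q, hq, hq1⟩ := (Ideal.mem_map_iff_of_surjective φ hφ).1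
      ((Ideal.eq_top_iff_one I).1 h)
    have h1 : aeval α (q - 1) = 0 := by
      have : aeval α q = 1 := congrArg Subtype.val hq1
      rw [map_sub, this, map_one, sub_self]
    obtain ⟨r, hr⟩ := minpoly.isIntegrallyClosed_dvd hint h1
    have h2 := congrArg (eval a) hr
    rw [hmin, eval_mul, eval_sub, eval_one] at h2
    have h3 : (1 : A) ∈ IsLocalRing.maximalIdeal A := by
      have h4 : (1 : A) = q.eval a - g.eval a * r.eval a := by rw [← h2]; ring
      rw [h4]
      exact sub_mem hq (Ideal.mul_mem_right _ _ ha)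
    exact (Ideal.ne_top_iff_one _).1 (IsLocalRing.maximalIdeal.isMaximal A).ne_top h3
  obtain ⟨B, hRB, hIB⟩ := Ideal.image_subset_nonunits_valuationSubring I hI
  have hnon : ∀ q : A[X], q.eval a ∈ IsLocalRing.maximalIdeal A → B.valuation (aeval α q) < 1 :=
    fun q hq => B.mem_nonunits_iff.1 (hIB ⟨φ q, Ideal.mem_map_of_mem φ hq, rfl⟩)
  have hAB : ∀ x : A, algebraMap K E x ∈ B := fun x => hRB ⟨C x, aeval_C α x⟩
  refine ⟨B, ?_, ?_⟩
  · ext x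
    refine ⟨fun hx => ?_, fun hx => hAB ⟨x, hx⟩⟩
    -- If x is not in A, then x⁻¹ is in the maximal ideal of A, so it has value below 1 in B and x
    -- cannot lie in B.
    by_contra hxA
    have hx0 : x ≠ 0 := fun h => hxA (h ▸ A.zero_mem)
    have hxi : x⁻¹ ∈ A := (A.mem_or_inv_mem x).resolve_left hxA
    have h1 : (⟨x⁻¹, hxi⟩ : A) ∈ IsLocalRing.maximalIdeal A := by
      rw [ValuationSubring.valuation_lt_one_iff]
      change A.valuation x⁻¹ < 1
      rw [map_inv₀]
      refine inv_lt_one_of_one_lt₀ (not_le.1 fun h => hxA ((A.valuation_le_one_iff x).1 h))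
    have h2 := hnon (C ⟨x⁻¹, hxi⟩) (by rwa [eval_C])
    rw [aeval_C] at h2
    have h3 : B.valuation (algebraMap K E x⁻¹) < 1 := h2
    rw [map_inv₀, map_inv₀] at h3
    have h4 : B.valuation (algebraMap K E x) ≤ 1 := (B.valuation_le_one_iff _).2 hx
    have h5 : 0 < B.valuation (algebraMap K E x) := by
      rwa [zero_lt_iff, Valuation.ne_zero_iff, Ne, map_eq_zero]
    exact ((inv_lt_one₀ h5).1 h3).not_ge h4
  · have h1 := hnon (X - C a) (by simp)
    rw [map_sub, aeval_X, aeval_C] at h1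
    exact h1

/-! ### Adjoining a simple residue root does not change the valuation ring modulo p -/

theorem mem_span_natCast_iff (A : ValuationSubring K) {p : ℕ} (hp : (p : K) ≠ 0) (x : A) :
    x ∈ Ideal.span {(p : A)} ↔ A.valuation (x : K) ≤ A.valuation (p : K) := by
  rw [Ideal.mem_span_singleton]
  constructor
  · rintro ⟨y, rfl⟩
    have : ((p * y : A) : K) = (p : K) * y := by push_cast; rfl
    rw [this, map_mul]
    exact mul_le_of_le_one_right' (A.valuation_le_one y)
  · intro h
    have hy : (x : K) / p ∈ A := by
      rw [← A.valuation_le_one_iff, map_div₀]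
      exact div_le_one_of_le₀ h zero_le
    refine ⟨⟨_, hy⟩, Subtype.ext ?_⟩
    have : ((p * ⟨(x : K) / p, hy⟩ : A) : K) = (p : K) * ((x : K) / p) := by push_cast; rfl
    rw [this, mul_div_cancel₀ _ hp]

/-- By finiteness x^i ≡ x^j for some i < j, and 1 - x^(j-i) is a unit. -/
theorem isNilpotent_mk_of_mem_maximalIdeal {R : Type*} [CommRing R] [IsLocalRing R] {I : Ideal R}
    [Finite (R ⧸ I)] {x : R} (hx : x ∈ IsLocalRing.maximalIdeal R) :
    IsNilpotent (Ideal.Quotient.mk I x) := by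
  obtain ⟨i, j, hij, h⟩ :=
    Finite.exists_ne_map_eq_of_infinite fun n : ℕ => Ideal.Quotient.mk I (x ^ n)
  wlog hlt : i < j generalizing i j
  · exact this j i hij.symm h.symm (lt_of_le_of_ne (not_lt.1 hlt) hij.symm)
  have hu : IsUnit (1 - x ^ (j - i)) := by
    by_contra hn
    have h1 : x ^ (j - i) ∈ IsLocalRing.maximalIdeal R :=
      Ideal.pow_mem_of_mem _ hx _ (Nat.sub_pos_of_lt hlt)
    have h2 := add_mem ((IsLocalRing.mem_maximalIdeal _).2 hn) h1
    rw [sub_add_cancel] at h2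
    exact (Ideal.ne_top_iff_one _).1 (IsLocalRing.maximalIdeal.isMaximal R).ne_top h2
  refine ⟨i, ?_⟩
  rw [← map_pow, ← (hu.map (Ideal.Quotient.mk I)).mul_left_eq_zero, ← map_mul, mul_sub, mul_one,
    ← pow_add, Nat.add_sub_cancel' hlt.le, map_sub, sub_eq_zero]
  exact h

/-- Newton's method in R/I, where g(a) is nilpotent, improves a root modulo the maximal ideal to a
root modulo I. -/
theorem exists_sub_mem_maximalIdeal_and_eval_mem {R : Type*} [CommRing R] [IsLocalRing R]
    {I : Ideal R} (hI : I ≤ IsLocalRing.maximalIdeal R) [Finite (R ⧸ I)] {g : R[X]} {a : R}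
    (ha : g.eval a ∈ IsLocalRing.maximalIdeal R) (hder : IsUnit (g.derivative.eval a)) :
    ∃ a' : R, a - a' ∈ IsLocalRing.maximalIdeal R ∧ g.eval a' ∈ I := by
  have hev : ∀ (q : R[X]) (x : R),
      aeval (Ideal.Quotient.mk I x) q = Ideal.Quotient.mk I (q.eval x) := fun q x =>
    aeval_algebraMap_apply_eq_algebraMap_eval x q
  obtain ⟨r, ⟨hr1, hr2⟩, -⟩ := existsUnique_nilpotent_sub_and_aeval_eq_zero (P := g)
    (x := Ideal.Quotient.mk I a) (by rw [hev]; exact isNilpotent_mk_of_mem_maximalIdeal ha)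
    (by rw [hev]; exact hder.map _)
  obtain ⟨a', rfl⟩ := Ideal.Quotient.mk_surjective r
  refine ⟨a', ?_, by rwa [hev, Ideal.Quotient.eq_zero_iff_mem] at hr2⟩
  obtain ⟨n, hn⟩ := hr1
  rw [← map_sub, ← map_pow, Ideal.Quotient.eq_zero_iff_mem] at hn
  exact (IsLocalRing.maximalIdeal.isMaximal R).isPrime.mem_of_pow_mem n (hI hn)

/-- The inclusion of A in B induces an isomorphism A/pA → B/pB, so a basis of the first is one of
the second. Surjectivity holds because α is congruent modulo p to an element of A and every element
of B is a fraction q(α)/h(α) with h(a) a unit. -/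
theorem IsPValued.of_simple_root {p d : ℕ} (hp0 : p ≠ 0) (hA : IsPValued p d K A) [FiniteDimensional K E]
    (hB : B.comap (algebraMap K E) = A) {a : A} (hα : B.valuation (α - algebraMap K E a) < 1)
    (htop : Algebra.adjoin K {α} = ⊤) {g : A[X]} (hg : g.Monic) (hgα : aeval α g = 0)
    (hmin : minpoly K α = g.map (algebraMap A K))
    (ha : g.eval a ∈ IsLocalRing.maximalIdeal A) (hder : IsUnit (g.derivative.eval a)) :
    IsPValued p d E B := by
  obtain ⟨hchar, hpu, c, hc⟩ := hA
  have hcharE : CharZero E := charZero_of_injective_algebraMap (algebraMap K E).injective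
  have hpK : (p : K) ≠ 0 := Nat.cast_ne_zero.2 hp0
  have hpE : (p : E) ≠ 0 := Nat.cast_ne_zero.2 hp0
  have hpm : (p : A) ∈ IsLocalRing.maximalIdeal A := (IsLocalRing.mem_maximalIdeal _).2 hpu
  have hpA : A.valuation (p : K) < 1 := (A.valuation_lt_one_iff (p : A)).1 hpm
  have hpB : B.valuation (p : E) < 1 := by
    rw [← map_natCast (algebraMap K E), valuation_algebraMap_lt_one_iff hB]
    exact hpA
  have : Finite (A ⧸ Ideal.span {(p : A)}) := Finite.of_surjective _ hc.2
  obtain ⟨a', haa', hga'⟩ := exists_sub_mem_maximalIdeal_and_eval_mem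
    (I := Ideal.span {(p : A)}) ((Ideal.span_singleton_le_iff_mem _).2 hpm) ha hder
  have hα1 : B.valuation (α - algebraMap K E a') < 1 := by
    have h1 : α - algebraMap K E a' =
        (α - algebraMap K E a) + algebraMap K E ((a - a' : A) : K) := by
      have h2 : ((a - a' : A) : K) = a - a' := rfl
      rw [h2, map_sub]
      ring
    rw [h1]
    refine Valuation.map_add_lt _ hα ?_
    rw [valuation_algebraMap_lt_one_iff hB]
    exact (A.valuation_lt_one_iff _).1 haa'
  have hunit : ∀ q : A[X], IsUnit (q.eval a) → IsUnit (q.eval a') := fun q hq => by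
    rwa [← valuation_aeval_eq_one_iff hB hα1, valuation_aeval_eq_one_iff hB hα]
  -- Write g(X) - g(a') = (X - a') r(X). Here r(a') = g'(a') is a unit, so α - a' has the value of
  -- g(a'), which is divisible by p.
  have hα2 : B.valuation (α - algebraMap K E a') ≤ B.valuation (p : E) := by
    obtain ⟨r, hr⟩ := X_sub_C_dvd_sub_C_eval (a := a') (p := g)
    have hra : r.eval a' = g.derivative.eval a' := by
      have h1 := congrArg (fun q => (derivative q).eval a') hr
      simpa using h1.symm
    have h1 : B.valuation (aeval α r) = 1 := by
      rw [valuation_aeval_eq_one_iff hB hα1, hra]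
      exact hunit _ hder
    have h2 := congrArg (aeval α) hr
    simp only [map_sub, map_mul, aeval_X, aeval_C, hgα, zero_sub] at h2
    have h3 : -(algebraMap K E ((g.eval a' : A) : K)) = (α - algebraMap K E a') * aeval α r := h2
    have h4 := congrArg B.valuation h3
    rw [Valuation.map_neg, map_mul, h1, mul_one] at h4
    rw [← h4]
    obtain ⟨y, hy⟩ := Ideal.mem_span_singleton.1 hga'
    have h5 : algebraMap K E ((g.eval a' : A) : K) = p * algebraMap K E y := by
      have h6 : ((p * y : A) : K) = (p : K) * y := by push_cast; rfl
      rw [hy, h6, map_mul, map_natCast]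
    rw [h5, map_mul]
    exact mul_le_of_le_one_right'
      ((B.valuation_le_one_iff _).2 (algebraMap_mem_of_comap_eq hB y))
  have happrox : ∀ b ∈ B, ∃ x : A, B.valuation (b - algebraMap K E x) ≤ B.valuation (p : E) := by
    intro b hb
    obtain ⟨q, h, hh, hq⟩ := exists_aeval_mul_eq hB hα htop hg hgα hmin hder hb
    obtain ⟨y, hy⟩ := (hunit h hh).exists_right_inv
    have hy1 : algebraMap K E ((h.eval a' : A) : K) * algebraMap K E y = 1 := by
      rw [← map_mul]
      have : ((h.eval a' : A) : K) * y = 1 := congrArg (algebraMap A K) hy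
      rw [this, map_one]
    have hy2 : B.valuation (algebraMap K E y) ≤ 1 :=
      (B.valuation_le_one_iff _).2 (algebraMap_mem_of_comap_eq hB y)
    -- b = q(α)/h(α) is approximated by q(a')/h(a'), where y = 1/h(a').
    refine ⟨q.eval a' * y, ?_⟩
    have h1 : b - algebraMap K E ((q.eval a' * y : A) : K) =
        ((aeval α q - algebraMap K E ((q.eval a' : A) : K)) -
          b * (aeval α h - algebraMap K E ((h.eval a' : A) : K))) * algebraMap K E y := by
      have h2 : ((q.eval a' * y : A) : K) = (q.eval a' : A) * y := rfl
      rw [h2, map_mul]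
      linear_combination (-b) * hy1 + algebraMap K E y * hq
    rw [h1, map_mul]
    refine (mul_le_of_le_one_right' hy2).trans (Valuation.map_sub_le _ ?_ ?_)
    · exact (valuation_aeval_sub_le hB hα1.le q).trans hα2
    · rw [map_mul]
      exact (mul_le_of_le_one_left' ((B.valuation_le_one_iff _).2 hb)).trans
        ((valuation_aeval_sub_le hB hα1.le h).trans hα2)
  let ψ : A →+* B := ((algebraMap K E).comp A.subtype).codRestrict B
    (algebraMap_mem_of_comap_eq hB)
  have hψ : ∀ x : A, ((ψ x : B) : E) = algebraMap K E x := fun _ => rfl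
  have hmem : ∀ x : A, ψ x ∈ Ideal.span {(p : B)} ↔ x ∈ Ideal.span {(p : A)} := by
    intro x
    rw [mem_span_natCast_iff B hpE, mem_span_natCast_iff A hpK, hψ,
      ← div_le_one₀ (zero_lt_iff.2 ((B.valuation.ne_zero_iff).2 hpE)),
      ← div_le_one₀ (zero_lt_iff.2 ((A.valuation.ne_zero_iff).2 hpK)), ← map_div₀, ← map_div₀,
      ← map_natCast (algebraMap K E) p, ← map_div₀, valuation_algebraMap_le_one_iff hB]
  refine ⟨hcharE, ?_, fun i => ψ (c i), ?_⟩
  · rw [← mem_nonunits_iff, ← IsLocalRing.mem_maximalIdeal, ValuationSubring.valuation_lt_one_iff]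
    exact hpB
  · have hsum : ∀ n : Fin d → Fin p,
        ∑ i, (n i : ℕ) • ψ (c i) = ψ (∑ i, (n i : ℕ) • c i) := fun n => by
      rw [map_sum]
      exact Finset.sum_congr rfl fun i _ => (map_nsmul ψ _ _).symm
    constructor
    · intro m n hmn
      refine hc.1 ?_
      simp only [hsum] at hmn
      rw [Ideal.Quotient.eq, ← map_sub, hmem] at hmn
      exact Ideal.Quotient.eq.2 hmn
    · intro y
      obtain ⟨b, rfl⟩ := Ideal.Quotient.mk_surjective y
      obtain ⟨x, hx⟩ := happrox b b.2
      obtain ⟨n, hn⟩ := hc.2 (Ideal.Quotient.mk _ x)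
      refine ⟨n, ?_⟩
      simp only [hsum]
      rw [Ideal.Quotient.eq] at hn ⊢
      have h1 : ψ x - b ∈ Ideal.span {(p : B)} := by
        rw [mem_span_natCast_iff B hpE]
        rw [Valuation.map_sub_swap] at hx
        exact hx
      have h2 := add_mem ((hmem _).2 hn) h1
      rwa [map_sub, sub_add_sub_cancel] at h2

end Extension

/-- In a factorization f = qr some factor, say q, vanishes at a in the residue field, and the
product rule makes q'(a) a unit; induction on the degree finishes. -/
theorem exists_irreducible_factor_simple_root {R : Type*} [CommRing R] [IsDomain R] [IsLocalRing R]
    (a : R) (n : ℕ) : ∀ f : R[X], f.natDegree = n → f.Monic →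
      f.eval a ∈ IsLocalRing.maximalIdeal R → IsUnit (f.derivative.eval a) →
      ∃ g : R[X], g.Monic ∧ Irreducible g ∧ g ∣ f ∧
        g.eval a ∈ IsLocalRing.maximalIdeal R ∧ IsUnit (g.derivative.eval a) := by
  induction n using Nat.strong_induction_on with
  | _ n ih =>
    intro f hn hf ha hder
    by_cases hirr : Irreducible f
    · exact ⟨f, hf, hirr, dvd_rfl, ha, hder⟩
    rw [hf.irreducible_iff_natDegree] at hirr
    push Not at hirr
    have hf1 : f ≠ 1 := by
      rintro rfl
      rw [eval_one] at ha
      exact (Ideal.ne_top_iff_one _).1 (IsLocalRing.maximalIdeal.isMaximal R).ne_top ha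
    obtain ⟨q, r, hq, hr, hqr, hq0, hr0⟩ := hirr hf1
    wlog hqa : q.eval a ∈ IsLocalRing.maximalIdeal R generalizing q r
    · refine this r q hr hq (by rw [mul_comm, hqr]) hr0 hq0 ?_
      rw [← hqr, eval_mul] at ha
      exact ((IsLocalRing.maximalIdeal.isMaximal R).isPrime.mem_or_mem ha).resolve_left hqa
    have hdeg : q.natDegree + r.natDegree = n := by rw [← hn, ← hqr, hq.natDegree_mul hr]
    have hqder : IsUnit (q.derivative.eval a) := by
      by_contra hnu
      rw [← hqr, derivative_mul, eval_add, eval_mul, eval_mul] at hder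
      refine (IsLocalRing.mem_maximalIdeal _).1 (add_mem ?_ ?_) hder
      · exact Ideal.mul_mem_right _ _ ((IsLocalRing.mem_maximalIdeal _).2 hnu)
      · exact Ideal.mul_mem_right _ _ hqa
    obtain ⟨g, h1, h2, h3, h4⟩ := ih q.natDegree (by omega) q rfl hq hqa hqder
    exact ⟨g, h1, h2, h3.trans (hqr ▸ dvd_mul_right q r), h4⟩

/-- A root α of a suitable irreducible factor generates an algebraic extension that is p-valued of
the same rank, with α congruent to a. Maximality puts α into K. -/
theorem henselianLocalRing_of_isPAdicallyClosed {p d : ℕ} (hp : p ≠ 0) {K : Type w} [Field K]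
    {A : ValuationSubring K} (hA : IsPAdicallyClosed p d K A) : HenselianLocalRing A := by
  refine ⟨fun f hf a ha hder => ?_⟩
  obtain ⟨g, hg, hirr, hgf, hga, hgder⟩ :=
    exists_irreducible_factor_simple_root a f.natDegree f rfl hf ha hder
  -- Gauss's lemma for the integrally closed domain A.
  have hirrK : Irreducible (g.map (algebraMap A K)) :=
    (hg.irreducible_iff_irreducible_map_fraction_map).1 hirr
  have : Fact (Irreducible (g.map (algebraMap A K))) := ⟨hirrK⟩
  have hgK : (g.map (algebraMap A K)).Monic := hg.map _
  let E := AdjoinRoot (g.map (algebraMap A K))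
  let α : E := AdjoinRoot.root (g.map (algebraMap A K))
  have : FiniteDimensional K E := (AdjoinRoot.powerBasis hgK.ne_zero).finite
  have htop : Algebra.adjoin K {α} = ⊤ := AdjoinRoot.adjoinRoot_eq_top
  have hmin : minpoly K α = g.map (algebraMap A K) := by
    rw [AdjoinRoot.minpoly_root hgK.ne_zero, hgK.leadingCoeff, inv_one, C_1, mul_one]
  have hgα : aeval α g = 0 := by
    have h := minpoly.aeval K α
    rwa [hmin, aeval_map_algebraMap] at h
  have hint : IsIntegral A α := ⟨g, hg, hgα⟩
  have hminA : minpoly A α = g := by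
    refine map_injective _ (IsFractionRing.injective A K) ?_
    rw [← minpoly.isIntegrallyClosed_eq_field_fractions' K hint, hmin]
  obtain ⟨B, hB, hα⟩ := exists_valuationSubring_root hint hminA hga
  obtain ⟨x, hx⟩ := hA.2 E B hB
    (hA.1.of_simple_root hp hB hα htop hg hgα hmin hga hgder) α
  have hxa : A.valuation (x - a) < 1 := by
    rw [← valuation_algebraMap_lt_one_iff hB, map_sub, hx]
    exact hα
  have hxA : x ∈ A := by
    have := add_mem ((A.valuation_le_one_iff _).1 hxa.le) a.2
    rwa [sub_add_cancel] at this
  refine ⟨⟨x, hxA⟩, ?_, (A.valuation_lt_one_iff _).2 hxa⟩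
  refine IsRoot.dvd ?_ hgf
  rw [IsRoot.def]
  refine IsFractionRing.injective A K ?_
  refine (algebraMap K E).injective ?_
  have h1 : aeval (algebraMap A E ⟨x, hxA⟩) g = algebraMap A E (g.eval ⟨x, hxA⟩) :=
    aeval_algebraMap_apply_eq_algebraMap_eval _ _
  have h2 : algebraMap A E ⟨x, hxA⟩ = α := hx
  rw [h2, hgα] at h1
  rw [map_zero, map_zero]
  exact h1.symm

end PAdic
end GenericDerivation

namespace GenericDerivation

/-! ### Fields whose topology is given by a definable henselian valuation -/

/-- The first entry of a tuple that begins with a field element. -/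
def Tuple.head {L : FieldLanguage.{u}} {M : FieldStructure.{u, w} L} {Γ : List (Srt L.Aux)}
    (a : Tuple M (Srt.field :: Γ)) : M.K :=
  a (0 : Fin (Γ.length + 1))

/-- The premise z ≠ 0 makes the parameter 0 define the whole field, so that every parameter gives a
neighbourhood of 0. -/
theorem definesTopology_valuationTopology {L : FieldLanguage.{u}} {M : FieldStructure.{u, w} L}
    {χ : Formula L [Srt.field, Srt.field]} (A : ValuationSubring M.K)
    (h : ∀ (x : M.K) (a : Tuple M [Srt.field]), χ.Realize M (Tuple.cons (s := Srt.field) x a) ↔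
      (Tuple.head a ≠ 0 → A.valuation x < A.valuation (Tuple.head a))) :
    DefinesTopology χ M (valuationTopology A) := by
  refine ⟨fun s => (hasBasis_nhds_zero_valuationTopology A).mem_iff.trans ⟨?_, ?_⟩⟩
  · rintro ⟨z, hz, hs⟩
    refine ⟨Tuple.cons (s := Srt.field) z (Tuple.nil M), trivial, fun x hx => hs ?_⟩
    exact (h x _).1 hx hz
  · rintro ⟨a, -, hs⟩
    by_cases h0 : Tuple.head a = 0
    · exact ⟨1, one_ne_zero, fun x _ => hs ((h x a).2 fun h1 => absurd h0 h1)⟩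
    · exact ⟨Tuple.head a, h0, fun x hx => hs ((h x a).2 fun _ => hx)⟩

theorem IsDivOf.realize_valuationFormula {L : FieldLanguage.{u}} {M : FieldStructure.{u, w} L}
    {div : L.Rel [Srt.field, Srt.field]} {A : ValuationSubring M.K} (h : IsDivOf div M A)
    (x : M.K) (a : Tuple M [Srt.field]) :
    (valuationFormula div).Realize M (Tuple.cons (s := Srt.field) x a) ↔
      (Tuple.head a ≠ 0 → A.valuation x < A.valuation (Tuple.head a)) := by
  have ha : a = Tuple.cons (s := Srt.field) (Tuple.head a) (Tuple.nil M) :=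
    funext fun i => Fin.cases rfl (fun j => j.elim0) i
  rw [← not_le, ← h x (Tuple.head a), ← ha]
  rfl

theorem tame_of_henselian {L : FieldLanguage.{u}} {Γ : List (Srt L.Aux)}
    {χ : Formula L (Srt.field :: Γ)} {M : FieldStructure.{u, w} L} [CharZero M.K]
    (hnd : ∀ c : Tuple M Γ, ∃ a : M.K, a ≠ 0 ∧ Nbhd χ M c a) (A : ValuationSubring M.K)
    (hA : HenselianLocalRing A) (hχ : DefinesTopology χ M (valuationTopology A)) : Tame χ M := by
  let _ := valuationTopology A
  have := isTopologicalDivisionRing_valuationTopology A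
  have := t2Space_valuationTopology A
  exact tame_of_definesTopology _ hnd hχ (hasStableSimpleRoots_of_henselian A)

/-- Tameness is proved in an elementary extension F of the model M defining T and pulled back to M.
Non-discreteness of F is transferred from M by elementarity. -/
theorem hasGenericExtensions_of_henselian {L : FieldLanguage.{u}} {T : Theory L}
    {Γ : List (Srt L.Aux)} {χ : Formula L (Srt.field :: Γ)}
    (hT : IsTopologicalFieldTheory.{u, w} T χ)
    (h : ∀ M : FieldStructure.{u, w} L, IsModel T M →
      ∃ (F : FieldStructure.{u, w} L) (_ : ElementaryEmbedding M F) (A : ValuationSubring F.K),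
        HenselianLocalRing A ∧ DefinesTopology χ F (valuationTopology A)) :
    HasGenericExtensions.{u, w} T χ ∧ IsConsistentTDeltaStar.{u, w} T χ := by
  obtain ⟨M, τ, hchar, rfl, hτ, -, hnd, hχ⟩ := hT
  obtain ⟨F, e, A, hA, hF⟩ := h M fun _ hφ => hφ
  have hcharF : CharZero F.K := charZero_of_injective_ringHom e.ringHom.injective
  have hndF := (e.elemEquiv.iff (tame_exists_ne_zero_definable χ)).1 (hχ.exists_ne_zero hnd)
  have hM : Tame χ M := (tame_of_henselian hndF A hA hF).of_elemEquiv e.elemEquiv.symm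
  exact ⟨hM.hasGenericExtensions, hM.hasGenericExtensions.isConsistent (M₀ := M) fun _ hφ => hφ⟩

theorem exampleClaim_valuationTopology {L : FieldLanguage.{u}} (M : FieldStructure.{u, w} L)
    (hchar : CharZero M.K) (A : ValuationSubring M.K) (hA : A ≠ ⊤)
    (hroot : @HasStableSimpleRoots M.K _ (valuationTopology A))
    (χ : Formula L [Srt.field, Srt.field])
    (h : ∀ (x : M.K) (a : Tuple M [Srt.field]), χ.Realize M (Tuple.cons (s := Srt.field) x a) ↔
      (Tuple.head a ≠ 0 → A.valuation x < A.valuation (Tuple.head a))) :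
    ExampleClaim M (valuationTopology A) := by
  let _ := valuationTopology A
  have := isTopologicalDivisionRing_valuationTopology A
  have := t2Space_valuationTopology A
  exact exampleClaim_of_hasStableSimpleRoots M _ (not_discreteTopology_valuationTopology A hA)
    hroot ⟨_, χ, definesTopology_valuationTopology A h⟩

/-! ### Real closed fields as structures -/

section Ordered

variable (K : Type w) [Field K] [LinearOrder K]

/-- The formula `z ≠ 0 → x * x < z * z` of the language of ordered fields. -/
def orderFormula : Formula (oneSortedLanguage Empty OrderRel) [Srt.field, Srt.field] :=
  Formula.imp
    (Formula.not (Formula.eq (s := Srt.field)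
      (Term.var (Γ := [Srt.field, Srt.field]) (1 : Fin 2)) Term.zero))
    (Formula.rel (L := oneSortedLanguage Empty OrderRel) (σ := [Srt.field, Srt.field])
      OrderRel.lt fun i =>
        match i with
        | (0 : Fin 2) => Term.mul (Term.var (Γ := [Srt.field, Srt.field]) (0 : Fin 2))
            (Term.var (Γ := [Srt.field, Srt.field]) (0 : Fin 2))
        | (1 : Fin 2) => Term.mul (Term.var (Γ := [Srt.field, Srt.field]) (1 : Fin 2))
            (Term.var (Γ := [Srt.field, Srt.field]) (1 : Fin 2)))

theorem realize_orderFormula (x : K) (a : Tuple (orderedFieldStructure K) [Srt.field]) :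
    orderFormula.Realize (orderedFieldStructure K) (Tuple.cons (s := Srt.field) x a) ↔
      ((show K from a (0 : Fin 1)) ≠ 0 →
        x * x < (show K from a (0 : Fin 1)) * (show K from a (0 : Fin 1))) :=
  Iff.rfl

variable [IsStrictOrderedRing K]

/-- Comparing squares expresses |x| < |z| without an absolute value. -/
theorem definesTopology_orderFormula :
    DefinesTopology orderFormula (orderedFieldStructure K) (Preorder.topology K) := by
  let _ := Preorder.topology K
  have : OrderTopology K := ⟨rfl⟩
  have key : ∀ x z : K, x * x < z * z ↔ |x| < |z| := fun x z => by
    rw [← pow_two, ← pow_two, sq_lt_sq]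
  refine ⟨fun s => (nhds_basis_zero_abs_lt K).mem_iff.trans ⟨?_, ?_⟩⟩
  · rintro ⟨ε, hε, hs⟩
    refine ⟨Tuple.cons (s := Srt.field) (M := orderedFieldStructure K) (show K from ε)
      (Tuple.nil _), trivial, fun x hx => hs ?_⟩
    have h := (key x ε).1 ((realize_orderFormula K x _).1 hx hε.ne')
    rwa [abs_of_pos hε] at h
  · rintro ⟨a, -, hs⟩
    by_cases h0 : (show K from a (0 : Fin 1)) = 0
    · exact ⟨1, one_pos, fun x _ => hs ((realize_orderFormula K x a).2 fun h1 => absurd h0 h1)⟩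
    · exact ⟨|(show K from a (0 : Fin 1))|, abs_pos.2 h0, fun x hx =>
        hs ((realize_orderFormula K x a).2 fun _ => (key _ _).2 hx)⟩

theorem exampleClaim_orderedFieldStructure [IsRealClosed K] :
    ExampleClaim (orderedFieldStructure K) (Preorder.topology K) := by
  let _ := Preorder.topology K
  have : OrderTopology K := ⟨rfl⟩
  have hnd : ¬ DiscreteTopology K := fun h => by
    have h1 : ({0} : Set K) ∈ 𝓝 (0 : K) := (isOpen_discrete _).mem_nhds rfl
    obtain ⟨ε, hε, hs⟩ := (nhds_basis_zero_abs_lt K).mem_iff.1 h1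
    have h2 : |ε / 2| < ε := by
      rw [abs_of_pos (half_pos hε)]
      exact half_lt_self hε
    exact (half_pos hε).ne' (hs h2)
  exact @exampleClaim_of_hasStableSimpleRoots _ (orderedFieldStructure K) (Preorder.topology K)
    (inferInstanceAs (CharZero K)) (inferInstanceAs (IsTopologicalDivisionRing K))
    (inferInstanceAs (T2Space K)) hnd (hasStableSimpleRoots_of_isRealClosed (K := K))
    ⟨_, orderFormula, definesTopology_orderFormula K⟩

/-- Convexity makes the (multiplicative) valuation monotone in |x|, so balls and intervals around 0
are cofinal in each other. -/
theorem valuationTopology_eq_preorderTopology (A : ValuationSubring K) (hA : A ≠ ⊤)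
    (hconv : ∀ x y : K, 0 ≤ x → x ≤ y → y ∈ A → x ∈ A) :
    valuationTopology A = Preorder.topology K := by
  have habs : ∀ x y : K, |x| ≤ |y| → A.valuation x ≤ A.valuation y := by
    intro x y hxy
    rcases eq_or_ne y 0 with rfl | hy
    · rw [abs_zero, abs_nonpos_iff] at hxy
      rw [hxy]
    · have h1 : |x / y| ∈ A := hconv _ 1 (abs_nonneg _)
        (by rw [abs_div]; exact div_le_one_of_le₀ hxy (abs_nonneg _)) A.one_mem
      have h2 : x / y ∈ A := by
        rcases abs_choice (x / y) with h | h
        · rwa [h] at h1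
        · rw [h] at h1
          simpa using neg_mem h1
      rw [← A.valuation_le_one_iff, map_div₀] at h2
      exact (div_le_one₀ (zero_lt_iff.2 ((A.valuation.ne_zero_iff).2 hy))).1 h2
  obtain ⟨t, ht⟩ : ∃ t, t ∉ A := by
    by_contra! h
    exact hA (top_le_iff.1 fun x _ => h x)
  have ht0 : t ≠ 0 := fun h => ht (h ▸ A.zero_mem)
  refine IsTopologicalAddGroup.ext
    (@IsTopologicalRing.to_topologicalAddGroup K _ (valuationTopology A)
      (isTopologicalDivisionRing_valuationTopology A).toIsTopologicalRing) ?_ ?_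
  · let _ := Preorder.topology K
    have : OrderTopology K := ⟨rfl⟩
    infer_instance
  · let _ := Preorder.topology K
    have : OrderTopology K := ⟨rfl⟩
    refine (hasBasis_nhds_zero_valuationTopology A).ext (nhds_basis_zero_abs_lt K) ?_ ?_
    · intro z hz
      -- Monotonicity gives only weak inequalities; dividing by t outside A makes the value of z/t
      -- strictly smaller than that of z.
      have hzt : z / t ≠ 0 := div_ne_zero hz ht0
      refine ⟨|z / t|, abs_pos.2 hzt, fun x hx => (habs x (z / t) (le_of_lt hx)).trans_lt ?_⟩
      rw [map_div₀]
      rw [div_lt_iff₀ (zero_lt_iff.2 ((A.valuation.ne_zero_iff).2 ht0))]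
      refine lt_mul_of_one_lt_right (zero_lt_iff.2 ((A.valuation.ne_zero_iff).2 hz)) ?_
      rw [← not_le, A.valuation_le_one_iff]
      exact ht
    · intro ε hε
      refine ⟨ε, hε.ne', fun x hx => ?_⟩
      by_contra h
      refine (habs ε x ?_).not_gt hx
      rw [abs_of_pos hε]
      exact not_lt.1 h

theorem exampleClaim_orderedValuedFieldStructure [IsRealClosed K] (A : ValuationSubring K)
    (hA : A ≠ ⊤) (hconv : ∀ x y : K, 0 ≤ x → x ≤ y → y ∈ A → x ∈ A) :
    ExampleClaim (orderedValuedFieldStructure K A) (valuationTopology A) := by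
  refine exampleClaim_valuationTopology (orderedValuedFieldStructure K A)
    (inferInstanceAs (CharZero K)) A hA ?_
    (valuationFormula (L := oneSortedLanguage Empty OrderDivRel) OrderDivRel.div)
    (IsDivOf.realize_valuationFormula fun _ _ => Iff.rfl)
  have h : @HasStableSimpleRoots K _ (valuationTopology A) := by
    rw [valuationTopology_eq_preorderTopology K A hA hconv]
    let _ := Preorder.topology K
    have : OrderTopology K := ⟨rfl⟩
    exact hasStableSimpleRoots_of_isRealClosed
  exact h

end Ordered

/-! ### Valued fields as structures -/

section Valued

variable (K : Type w) [Field K] (A : ValuationSubring K)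

theorem exampleClaim_valuedFieldStructure [CharZero K] (hA : A ≠ ⊤) [HenselianLocalRing A] :
    ExampleClaim (valuedFieldStructure K A) (valuationTopology A) :=
  exampleClaim_valuationTopology (valuedFieldStructure K A) (inferInstanceAs (CharZero K)) A hA
    (hasStableSimpleRoots_of_henselian A)
    (valuationFormula (L := oneSortedLanguage Empty DivRel) DivRel.div)
    (IsDivOf.realize_valuationFormula fun _ _ => Iff.rfl)

theorem exampleClaim_pAdicFieldStructure {p d : ℕ} (hp : p ≠ 0) (c : Fin d → A)
    (h : IsPAdicallyClosed p d K A) :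
    ExampleClaim (pAdicFieldStructure K A c) (valuationTopology A) := by
  have := henselianLocalRing_of_isPAdicallyClosed hp h
  have := h.1.1
  -- The valuation is non-trivial because p is nonzero in K but not a unit of A.
  have hA : A ≠ ⊤ := by
    rintro rfl
    refine h.1.2.1 (IsUnit.of_mul_eq_one ⟨(p : K)⁻¹, trivial⟩ (Subtype.ext ?_))
    exact mul_inv_cancel₀ (Nat.cast_ne_zero.2 hp)
  exact exampleClaim_valuationTopology (pAdicFieldStructure K A c) (inferInstanceAs (CharZero K)) A
    hA (hasStableSimpleRoots_of_henselian A)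
    (valuationFormula (L := oneSortedLanguage (Fin d) PAdicRel) PAdicRel.div)
    (IsDivOf.realize_valuationFormula fun _ _ => Iff.rfl)

variable [CharZero K]

theorem rvMap_eq_zero_iff (n : RVIndex (residueChar A)) (x : K) : rvMap A n x = 0 ↔ x = 0 := by
  unfold rvMap
  split_ifs with h <;> simp [h]

/-- The quotient is by a group of elements of value 1. Hence the relation `div` on the sort, defined
through representatives, does not depend on them. -/
theorem valuation_eq_of_rvMap_eq (n : RVIndex (residueChar A)) {x y : K}
    (h : rvMap A n x = rvMap A n y) : A.valuation x = A.valuation y := by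
  by_cases hx : x = 0
  · have hy : y = 0 := by rw [← rvMap_eq_zero_iff K A n, ← h, rvMap_eq_zero_iff, hx]
    rw [hx, hy]
  · have hy : y ≠ 0 := by rwa [Ne, ← rvMap_eq_zero_iff K A n, ← h, rvMap_eq_zero_iff]
    rw [rvMap, rvMap, dif_neg hx, dif_neg hy, WithZero.coe_inj, QuotientGroup.eq] at h
    have h1 := rv_valuation_eq_one A n _ h
    rw [Units.val_mul, Units.val_inv_eq_inv_val, Units.val_mk0, Units.val_mk0, map_mul, map_inv₀,
      inv_mul_eq_one₀ ((A.valuation.ne_zero_iff).2 hx)] at h1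
    exact h1

/-- The formula `z ≠ 0 → v(x) > v(z)`, expressed by the relation `v(x) ≤ v(y)` on `RV_0`. -/
def rvFormula (p : ℕ) : Formula (rvLanguage p) [Srt.field, Srt.field] :=
  Formula.imp
    (Formula.not (Formula.eq (s := Srt.field)
      (Term.var (Γ := [Srt.field, Srt.field]) (1 : Fin 2)) Term.zero))
    (Formula.not (Formula.rel (L := rvLanguage p)
      (σ := [Srt.aux (⟨0, fun _ => rfl⟩ : RVIndex p), Srt.aux (⟨0, fun _ => rfl⟩ : RVIndex p)])
      (RVRel.div ⟨0, fun _ => rfl⟩) fun i =>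
        match i with
        | (0 : Fin 2) => Term.app (L := rvLanguage p) (σ := [Srt.field])
            (RVFn.rv ⟨0, fun _ => rfl⟩) fun j =>
              match j with
              | (0 : Fin 1) => Term.var (Γ := [Srt.field, Srt.field]) (0 : Fin 2)
        | (1 : Fin 2) => Term.app (L := rvLanguage p) (σ := [Srt.field])
            (RVFn.rv ⟨0, fun _ => rfl⟩) fun j =>
              match j with
              | (0 : Fin 1) => Term.var (Γ := [Srt.field, Srt.field]) (1 : Fin 2)))

theorem realize_rvFormula (x : K) (a : Tuple (rvStructure K A) [Srt.field]) :
    (rvFormula (residueChar A)).Realize (rvStructure K A) (Tuple.cons (s := Srt.field) x a) ↔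
      ((show K from a (0 : Fin 1)) ≠ 0 →
        A.valuation x < A.valuation (show K from a (0 : Fin 1))) := by
  refine imp_congr Iff.rfl ?_
  rw [← not_le]
  refine not_congr ⟨?_, fun h => ⟨x, (show K from a (0 : Fin 1)), rfl, rfl, h⟩⟩
  rintro ⟨x', z', hx, hz, h⟩
  have h1 : A.valuation x' = A.valuation x := valuation_eq_of_rvMap_eq K A _ hx
  have h2 : A.valuation z' = A.valuation (show K from a (0 : Fin 1)) :=
    valuation_eq_of_rvMap_eq K A _ hz
  rwa [h1, h2] at h

theorem exampleClaim_rvStructure (hA : A ≠ ⊤) [HenselianLocalRing A] :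
    ExampleClaim (rvStructure K A) (valuationTopology A) :=
  exampleClaim_valuationTopology (rvStructure K A) (inferInstanceAs (CharZero K)) A hA
    (hasStableSimpleRoots_of_henselian A) (rvFormula (residueChar A)) (realize_rvFormula K A)

end Valued

end GenericDerivation

theorem theorem2p6 :
    -- the topology comes, in elementary extensions, from henselian valuations
    (∀ (L : FieldLanguage.{u}) (T : Theory L) (Γ : List (Srt L.Aux))
        (χ : Formula L (Srt.field :: Γ)),
      IsTopologicalFieldTheory.{u, w} T χ →
      (∀ M : FieldStructure.{u, w} L, IsModel T M →
        ∃ (F : FieldStructure.{u, w} L) (_ : ElementaryEmbedding M F) (A : ValuationSubring F.K),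
          HenselianLocalRing A ∧ DefinesTopology χ F (valuationTopology A)) →
      HasGenericExtensions.{u, w} T χ ∧ IsConsistentTDeltaStar.{u, w} T χ) ∧
    -- languages with a symbol for a henselian valuation
    (∀ (L : FieldLanguage.{u}) (T : Theory L) (div : L.Rel [Srt.field, Srt.field]),
      IsTopologicalFieldTheory.{u, w} T (valuationFormula div) →
      (∀ M : FieldStructure.{u, w} L, IsModel T M →
        ∃ A : ValuationSubring M.K, HenselianLocalRing A ∧ IsDivOf div M A) →
      HasGenericExtensions.{u, w} T (valuationFormula div) ∧
        IsConsistentTDeltaStar.{u, w} T (valuationFormula div)) ∧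
    -- real closed fields with the order topology
    (∀ (K : Type w) [Field K] [LinearOrder K] [IsStrictOrderedRing K] [IsRealClosed K],
      ExampleClaim (orderedFieldStructure K) (Preorder.topology K)) ∧
    -- algebraically closed, non-trivially valued fields of characteristic zero
    (∀ (K : Type w) [Field K] [CharZero K] [IsAlgClosed K] (A : ValuationSubring K), A ≠ ⊤ →
      ExampleClaim (valuedFieldStructure K A) (valuationTopology A)) ∧
    -- real closed fields with a non-trivial convex valuation ring
    (∀ (K : Type w) [Field K] [LinearOrder K] [IsStrictOrderedRing K] [IsRealClosed K]
        (A : ValuationSubring K), A ≠ ⊤ → (∀ x y : K, 0 ≤ x → x ≤ y → y ∈ A → x ∈ A) →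
      valuationTopology A = Preorder.topology K ∧
        ExampleClaim (orderedValuedFieldStructure K A) (valuationTopology A)) ∧
    -- `p`-adically closed fields of `p`-rank `d`
    (∀ (p d : ℕ), p.Prime → ∀ (K : Type w) [Field K] (A : ValuationSubring K) (c : Fin d → A),
      IsPAdicallyClosed p d K A → IsResidueBasis p A c →
      ExampleClaim (pAdicFieldStructure K A c) (valuationTopology A)) ∧
    -- henselian, non-trivially valued fields of characteristic zero with leading term sorts
    (∀ (K : Type w) [Field K] [CharZero K] (A : ValuationSubring K), HenselianLocalRing A →
      A ≠ ⊤ → ExampleClaim (rvStructure K A) (valuationTopology A)) := by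
  refine ⟨fun L T Γ χ hT h => hasGenericExtensions_of_henselian hT h, fun L T div hT h => ?_,
    fun K => exampleClaim_orderedFieldStructure K, fun K _ _ _ A hA => ?_,
    fun K _ _ _ _ A hA hconv => ⟨valuationTopology_eq_preorderTopology K A hA hconv,
      exampleClaim_orderedValuedFieldStructure K A hA hconv⟩,
    fun p d hp K _ A c hA _ => exampleClaim_pAdicFieldStructure K A hp.ne_zero c hA,
    fun K _ _ A _ hA => exampleClaim_rvStructure K A hA⟩
  -- Here each model carries its own henselian valuation, so it serves as its own elementary
  -- extension.
  · refine hasGenericExtensions_of_henselian hT fun M hM => ?_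
    obtain ⟨A, hA, hdiv⟩ := h M hM
    exact ⟨M, ElementaryEmbedding.refl M, A, hA,
      definesTopology_valuationTopology A hdiv.realize_valuationFormula⟩
  · have := henselianLocalRing_of_isAlgClosed A
    exact exampleClaim_valuedFieldStructure K A hA
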